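/- Write $\langle x\rangle=\sqrt{1+|x|^2}$, $\hat v=v/\langle v\rangle$ for $v\in\mathbb R^3$, and $\mathbb P_k w=w-\frac{k\cdot w}{|k|^2}k$ for $k\in\mathbb R^3\setminus\{0\}$. Let $N_0\ge 11$ be an integer and let $F$ be holomorphic on $\{\Re z>0\}$ such that for all $R>0$ and $n\in\mathbb N$ there is $C_{R,n}$ with $$|F^{(n)}(sz)|\le C_{R,n}(s\,\Re z)^{-\frac{N_0}{2}-n}\qquad\text{for all } s\ge 1,\ \Re z>0,\ |z|\le R .$$ Put $\varphi(s)=F(s^2)$ and $\mu(v)=\varphi(\langle v\rangle)$, and assume that $\mu$ is real, non-negative and $\int_{\mathbb R^3}\mu\,dv\neq0$. Let $$\tau_0^2=\int_{\mathbb R^3}\frac{1+\frac23|v|^2}{(1+|v|^2)^{3/2}}\,\mu(v)\,dv,\qquad M(\lambda,k)=\lambda^2+|k|^2+\tau_0^2+\frac12\int_{\mathbb R^3}\frac{(ik\cdot\hat v)\,|\mathbb P_k\hat v|^2}{\lambda+ik\cdot\hat v}\,\varphi'(\langle v\rangle)\,dv\quad(\Re\lambda>0),$$ where for $k=0$ the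 last integral is $0$, and define the magnetic Green function, for $\gamma_0>0$ and $t\ge0$, by $$\widehat H_k(t)=\frac1{2\pi i}\int_{\{\Re\lambda=\gamma_0\}}\frac{e^{\lambda t}}{M(\lambda,k)}\,d\lambda .$$ **Proposition.** The integral defining $\widehat H_k(t)$ converges absolutely. There is a function $\nu_*$ such that for every $k\in\mathbb R^3$ one has $\nu_*(|k|)>|k|$ and $\pm i\nu_*(|k|)$ are exactly the zeros on the imaginary axis of (the continuous extension to $\{\Re\lambda\ge0\}$ of) $M(\cdot,k)$, and there are smooth functions $b_\pm:\mathbb R^3\to\mathbb C$ with $|b_\pm(k)|\lesssim\langle k\rangle^{-1}$ such that, for all $k\in\mathbb R^3$, $t\ge 0$ and every $\gamma_0>0$, $$\widehat H_k(t)=\sum_\pm e^{\pm i\nu_*(|k|)t}\,b_\pm(k)+\widehat H^r_k(t).$$ The regular part has the form $\widehat H^r_k(t)=\int_{\mathbb R}e^{i\tau t}\rho_k(\tau)\,d\tau$ with $\rho_k\in L^1(\mathbb R)$, and for every $\varepsilon>0$ there is a multiplier $\chi_\varepsilon(k,\tau)\in[0,1]$, smooth for $k\ne0$ and vanishing outside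 $\{|\tau|\le\varepsilon|k|,\ |k|\le\varepsilon\}$, such that, with $\widehat H^{r,\mathrm{low}}_k(t)=\int_{\mathbb R} e^{i\tau t}\chi_\varepsilon(k,\tau)\rho_k(\tau)\,d\tau$, the following holds for all integers $N\le\lfloor (N_0-9)/2\rfloor$ and all multi-indices $\alpha$ with $0\le|\alpha|<N$: for each $t\ge0$ the functions $k\mapsto\widehat H^r_k(t)$ and $k\mapsto\widehat H^{r,\mathrm{low}}_k(t)$ are of class $C^{|\alpha|}$ on $\mathbb R^3\setminus\{0\}$, and $$|k|^{|\alpha|}\,\bigl|\partial_k^\alpha\bigl(\widehat H^r_k-\widehat H^{r,\mathrm{low}}_k\bigr)(t)\bigr|\lesssim|k|\langle k\rangle^{-2}\langle |k|t\rangle^{|\alpha|-N},\qquad |k|^{|\alpha|}\,\bigl|\partial_k^\alpha\widehat H^{r,\mathrm{low}}_k(t)\bigr|\lesssim|k|\,\langle|k|^3t\rangle^{|\alpha|-N}$$ for all $t\ge0$ and all $k\in\mathbb R^3$ (for $\alpha\neq0$, $k\neq 0$). The implied constants depend only on $F,N_0,N,|\alpha|$ and $\varepsilon$, and not on $k$,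 $t$ or $\gamma_0$. -/

import Mathlib

open Filter Topology MeasureTheory
open scoped ContDiff RealInnerProductSpace

noncomputable section

namespace VlasovMaxwell

/-- Position, momentum and wave vectors live in Euclidean `ℝ³`. -/
abbrev R3 : Type := EuclideanSpace ℝ (Fin 3)

/-- The Japanese bracket `⟨x⟩ = √(1 + x²)`; for a vector use `⟨|v|⟩`. -/
def jap (x : ℝ) : ℝ := Real.sqrt (1 + x ^ 2)

/-- The profile `φ(s) = F(s²)`. For admissible `F` the value `F(s²)` is real when `s ≥ 1`,
and only these `s` enter below. -/
def profile (F : ℂ → ℂ) (s : ℝ) : ℝ := (F ((s : ℂ) ^ 2)).re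

/-- The equilibrium `μ(v) = φ(⟨v⟩) = F(⟨v⟩²)`. -/
def equilibrium (F : ℂ → ℂ) (v : R3) : ℝ := profile F (jap ‖v‖)

/-- The relativistic velocity `v̂ = v / ⟨v⟩`. -/
def velocity (v : R3) : R3 := (jap ‖v‖)⁻¹ • v

/-- The projection `ℙ_k w = w - (k·w) k / |k|²` onto `k^⊥` (it is the identity for `k = 0`). -/
def transverse (k w : R3) : R3 := w - (⟪k, w⟫ / ‖k‖ ^ 2) • k

/-- The assumptions on the equilibrium `μ(v) = F(⟨v⟩²)`. -/
structure IsAdmissible (F : ℂ → ℂ) (N₀ : ℕ) : Prop where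
  /-- `F` is holomorphic on the right half-plane. -/
  holomorphic : DifferentiableOn ℂ F {z : ℂ | 0 < z.re}
  /-- `F` and its derivatives decay along rays. -/
  decay : ∀ R : ℝ, 0 < R → ∀ n : ℕ, ∃ C : ℝ, ∀ s : ℝ, 1 ≤ s → ∀ z : ℂ, 0 < z.re → ‖z‖ ≤ R →
    ‖iteratedDeriv n F ((s : ℂ) * z)‖ ≤ C * (s * z.re) ^ (-((N₀ : ℝ) / 2) - (n : ℝ))
  /-- `μ` is real and non-negative (`⟨v⟩²` runs through `[1, ∞)`). -/
  nonneg : ∀ s : ℝ, 1 ≤ s → (F (s : ℂ)).im = 0 ∧ 0 ≤ (F (s : ℂ)).re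
  /-- The mass `n₀ = ∫ μ` does not vanish. -/
  mass_ne_zero : ∫ v : R3, equilibrium F v ≠ 0

/-- `τ₀² = ∫ (1 + (2/3)|v|²) / (1 + |v|²)^{3/2} μ(v) dv`. -/
def tauZeroSq (F : ℂ → ℂ) : ℝ :=
  ∫ v : R3, (1 + 2 / 3 * ‖v‖ ^ 2) / jap ‖v‖ ^ 3 * equilibrium F v

/-- The magnetic dispersion function, for `Re z > 0`:
`M(z,k) = z² + |k|² + τ₀² + ½ ∫ (i k·v̂) |ℙ_k v̂|² / (z + i k·v̂) φ'(⟨v⟩) dv`. -/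
def magDispersion (F : ℂ → ℂ) (z : ℂ) (k : R3) : ℂ :=
  z ^ 2 + ((‖k‖ ^ 2 : ℝ) : ℂ) + (tauZeroSq F : ℂ)
    + 1 / 2 * ∫ v : R3,
        Complex.I * (⟪k, velocity v⟫ : ℝ) * ((‖transverse k (velocity v)‖ ^ 2 : ℝ) : ℂ)
          / (z + Complex.I * (⟪k, velocity v⟫ : ℝ))
          * (deriv (profile F) (jap ‖v‖) : ℝ)

/-- `iτ` is a zero of the continuous extension of `M(·,k)` from `{Re z > 0}` to `{Re z ≥ 0}`. -/
def IsMagneticZero (F : ℂ → ℂ) (k : R3) (τ : ℝ) : Prop :=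
  Tendsto (fun z : ℂ => magDispersion F z k)
    (𝓝[{z : ℂ | 0 < z.re}] (Complex.I * (τ : ℂ))) (𝓝 0)

/-- The integrand `e^{zt} / M(z,k)` at `z = γ + iτ`. -/
def greenIntegrand (F : ℂ → ℂ) (γ : ℝ) (k : R3) (t τ : ℝ) : ℂ :=
  Complex.exp (((γ : ℂ) + Complex.I * (τ : ℂ)) * (t : ℂ))
    / magDispersion F ((γ : ℂ) + Complex.I * (τ : ℂ)) k

/-- The magnetic Green function `Ĥ_k(t) = (1/2πi) ∫_{Re z = γ} e^{zt} / M(z,k) dz`, with the line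
parametrized by `z = γ + iτ`, `dz = i dτ`. -/
def magGreen (F : ℂ → ℂ) (γ : ℝ) (k : R3) (t : ℝ) : ℂ :=
  ((2 * Real.pi : ℝ) : ℂ)⁻¹ * ∫ τ : ℝ, greenIntegrand F γ k t τ

/-- The function of `t` with temporal spectral density `ρ_k`: `∫ e^{iτt} ρ_k(τ) dτ`. -/
def synth (ρ : R3 → ℝ → ℂ) (k : R3) (t : ℝ) : ℂ :=
  ∫ τ : ℝ, Complex.exp (Complex.I * (τ : ℂ) * (t : ℂ)) * ρ k τ

/-- The Fourier multiplier in time `χ(k, ∂_t / i)` acting on `synth ρ`. -/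
def multiplier (χ : R3 → ℝ → ℝ) (ρ : R3 → ℝ → ℂ) (k : R3) (t : ℝ) : ℂ :=
  synth (fun k τ => (χ k τ : ℂ) * ρ k τ) k t

/-- `χ` is a smooth cutoff (away from `k = 0`) with values in `[0,1]` which lives on the region
`|τ| ≤ ε |k|`, `|k| ≤ ε`. -/
structure IsLowFrequencyCutoff (ε : ℝ) (χ : R3 → ℝ → ℝ) : Prop where
  smooth : ContDiffOn ℝ ∞ (fun p : R3 × ℝ => χ p.1 p.2) {p : R3 × ℝ | p.1 ≠ 0}
  range : ∀ k τ, χ k τ ∈ Set.Icc (0 : ℝ) 1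
  support : ∀ k τ, χ k τ ≠ 0 → |τ| ≤ ε * ‖k‖ ∧ ‖k‖ ≤ ε

end VlasovMaxwell

end

noncomputable section

namespace VlasovMaxwell

open Set

open scoped ENNReal

/-! ### The law of `(k̂·v̂, ⟨v⟩²)` under Lebesgue measure -/

/-! Reduction. The momentum integral depends on `v` only through `u = k̂·v̂` and `x = ⟨v⟩²`. In
these variables Lebesgue measure becomes `π√x du dx` on `x(1-u²) > 1`, and integration by parts in
`x` gives, with `κ = |k|`, `M = z² + κ² + ∫ z/(z+iκu) W(u) du`. Here `W` (`cutDensity`) is even,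
positive exactly on `(-1,1)`, and vanishes to high order at `±1`. In `p = z/κ` the integral is `p`
times a Cauchy transform, and its boundary values are read off from a Laplace integral of the
Fourier transform of `W` (`cauchyExt`).

Zeros. `Re (M/z) ≥ Re z` excludes zeros with `Re z > 0`. At `z = iκσ`, `|σ| ≤ 1`, one has `Im M =
πσW(σ)`, while `Re M` is positive near `|σ| = 1`; together these give `|M| ≳ κ²(1-σ²) + |σ|`
(`exists_norm_dispExt_ge`). For `|τ| > κ` the value `M(iτ)` is real, and with `s = κ²/τ²` its
vanishing reads `κ² = sJ(s)/(1-s)`, `J(s) = ∫ W/(1-su²)`. The right side increases from `0` to `∞`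
on `[0,1)`; inverting it produces `ν` and amplitudes smooth in `|k|²`, also at `k = 0`. Explicit
algebra then gives `M = (z²+ν²)E` with `E` free of zeros, and `1/M = B/(z²+ν²) + remainder`
(`dispExt_eq_mul`, `inv_dispExt_eq`).

Green function. The pole term yields `sin(νt)/ν`. The remainder is holomorphic for `Re z > 0`,
continuous up to the axis and `O(|z|⁻²)`, so the contour moves to the axis. For `t ≥ 0` the
conjugate boundary value contributes nothing, hence only the jump survives: at `τ = κσ` the spectral
density is `-iσW(σ)/|M(iκσ)|²`, supported in `|σ| < 1` (`magGreen_eq`).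

Decay. In `x = log κ` and `σ` this density is a symbol: derivatives in `x` are free and each
derivative in `σ` costs a factor `(1-σ²)(κ²+|σ|)/(1+κ²)`. The `x`-derivative of `κ∫e^{iσκt}f dσ` is
the same kind of integral, of `∂ₓf - σ∂_σf`, so derivatives in `k` cost regularity in `σ` but no
power of `t` (`Sym.exists_flow`). Where `κ²+|σ|` is not small, repeated integration by parts gives
powers of `⟨κt⟩`. Near `κ = σ = 0` each integration by parts costs up to `κ⁻²`, whence `⟨κ³t⟩`.
There the absolute value of the density would leave a logarithm of `κ` for short times; oddness in
`σ` removes it (`norm_oscInt_le_of_odd`). -/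

theorem map_normSq_volume :
    Measure.map (fun w : EuclideanSpace ℝ (Fin 2) => ‖w‖ ^ 2) volume
      = ENNReal.ofReal Real.pi • (volume.restrict (Ioi (0 : ℝ))) := by
  have hm : Measurable fun w : EuclideanSpace ℝ (Fin 2) => ‖w‖ ^ 2 := by fun_prop
  -- Both measures are compared on half-lines: the disc of squared radius `b` has area `πb`.
  have hIic : ∀ b : ℝ, Measure.map (fun w : EuclideanSpace ℝ (Fin 2) => ‖w‖ ^ 2) volume (Iic b)
      = (ENNReal.ofReal Real.pi • (volume.restrict (Ioi (0 : ℝ)))) (Iic b) := by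
    intro b
    rw [Measure.map_apply hm measurableSet_Iic, Measure.smul_apply,
      Measure.restrict_apply measurableSet_Iic, Set.inter_comm, Set.Ioi_inter_Iic,
      Real.volume_Ioc, sub_zero, smul_eq_mul]
    rcases lt_or_ge b 0 with hb | hb
    · have : (fun w : EuclideanSpace ℝ (Fin 2) => ‖w‖ ^ 2) ⁻¹' (Iic b) = ∅ := by
        ext w
        simp only [mem_preimage, mem_Iic, mem_empty_iff_false, iff_false, not_le]
        exact hb.trans_le (by positivity)
      rw [this, measure_empty, ENNReal.ofReal_of_nonpos hb.le, mul_zero]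
    · have : (fun w : EuclideanSpace ℝ (Fin 2) => ‖w‖ ^ 2) ⁻¹' (Iic b)
          = Metric.closedBall 0 (√b) := by
        ext w
        simp only [mem_preimage, mem_Iic, Metric.mem_closedBall, dist_zero_right]
        exact (Real.le_sqrt (norm_nonneg _) hb).symm
      rw [this, EuclideanSpace.volume_closedBall_fin_two, ← ENNReal.ofReal_pow (Real.sqrt_nonneg _),
        Real.sq_sqrt hb, mul_comm]
  have hfin : ∀ b : ℝ, (ENNReal.ofReal Real.pi • (volume.restrict (Ioi (0 : ℝ)))) (Iic b) ≠ ⊤ := by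
    intro b
    rw [Measure.smul_apply, Measure.restrict_apply measurableSet_Iic, Set.inter_comm,
      Set.Ioi_inter_Iic, Real.volume_Ioc, smul_eq_mul]
    exact ENNReal.mul_ne_top ENNReal.ofReal_ne_top ENNReal.ofReal_ne_top
  refine Measure.ext_of_Ioc' _ _ ?_ ?_
  · intro a b _
    refine ne_top_of_le_ne_top (hfin b) ?_
    rw [← hIic b]
    exact measure_mono Ioc_subset_Iic_self
  · intro a b hab
    have h : Ioc a b = Iic b \ Iic a := by ext; simp [and_comm]
    rw [h, measure_sdiff (Iic_subset_Iic.2 hab.le) measurableSet_Iic.nullMeasurableSet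
      (by rw [hIic]; exact hfin a),
      measure_sdiff (Iic_subset_Iic.2 hab.le) measurableSet_Iic.nullMeasurableSet (hfin a),
      hIic, hIic]

/-- Cylindrical coordinates about the first axis: the squared transverse radius carries the measure
`π dr` on `(0,∞)`. -/
theorem lintegral_first_normSq (f : ℝ → ℝ → ℝ≥0∞) (hf : Measurable (Function.uncurry f)) :
    ∫⁻ v : R3, f (v 0) (‖v‖ ^ 2)
      = ENNReal.ofReal Real.pi * ∫⁻ a : ℝ, ∫⁻ r in Ioi (0 : ℝ), f a (a ^ 2 + r) := by
  have hmp := PiLp.volume_preserving_toLp (Fin 3)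
  have h1 : ∫⁻ v : R3, f (v 0) (‖v‖ ^ 2)
      = ∫⁻ w : Fin 3 → ℝ, f (w 0) (w 0 ^ 2 + (w 1 ^ 2 + w 2 ^ 2)) := by
    rw [← hmp.lintegral_comp_emb (MeasurableEquiv.toLp 2 (Fin 3 → ℝ)).measurableEmbedding]
    refine lintegral_congr fun w => ?_
    rw [EuclideanSpace.real_norm_sq_eq, Fin.sum_univ_three, add_assoc]
  have hmp2 := volume_preserving_piFinSuccAbove (fun _ : Fin 3 => ℝ) 0
  have h2 : ∫⁻ w : Fin 3 → ℝ, f (w 0) (w 0 ^ 2 + (w 1 ^ 2 + w 2 ^ 2))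
      = ∫⁻ q : ℝ × (Fin 2 → ℝ), f q.1 (q.1 ^ 2 + (q.2 0 ^ 2 + q.2 1 ^ 2)) := by
    rw [← hmp2.lintegral_comp_emb (MeasurableEquiv.measurableEmbedding _)]
    rfl
  have hmp3 := PiLp.volume_preserving_toLp (Fin 2)
  have h3 : ∀ a : ℝ, ∫⁻ w : Fin 2 → ℝ, f a (a ^ 2 + (w 0 ^ 2 + w 1 ^ 2))
      = ENNReal.ofReal Real.pi * ∫⁻ r in Ioi (0 : ℝ), f a (a ^ 2 + r) := by
    intro a
    have hfa : Measurable fun r => f a (a ^ 2 + r) :=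
      hf.comp (by fun_prop : Measurable fun r : ℝ => (a, a ^ 2 + r))
    have : ∫⁻ w : Fin 2 → ℝ, f a (a ^ 2 + (w 0 ^ 2 + w 1 ^ 2))
        = ∫⁻ w : EuclideanSpace ℝ (Fin 2), f a (a ^ 2 + ‖w‖ ^ 2) := by
      rw [← hmp3.lintegral_comp_emb (MeasurableEquiv.toLp 2 (Fin 2 → ℝ)).measurableEmbedding]
      refine lintegral_congr fun w => ?_
      rw [EuclideanSpace.real_norm_sq_eq, Fin.sum_univ_two]
    rw [this, ← lintegral_map (f := fun r => f a (a ^ 2 + r)) hfa (by fun_prop), map_normSq_volume,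
      lintegral_smul_measure, smul_eq_mul]
  rw [h1, h2, Measure.volume_eq_prod, lintegral_prod]
  · simp_rw [h3]
    rw [lintegral_const_mul]
    refine Measurable.lintegral_prod_right' (f := fun q : ℝ × ℝ => f q.1 (q.1 ^ 2 + q.2)) ?_
    exact hf.comp (by fun_prop : Measurable fun q : ℝ × ℝ => (q.1, q.1 ^ 2 + q.2))
  · exact (hf.comp (by fun_prop : Measurable fun q : ℝ × (Fin 2 → ℝ) =>
      (q.1, q.1 ^ 2 + (q.2 0 ^ 2 + q.2 1 ^ 2)))).aemeasurable

/-- The region swept out by `(k̂·v̂, ⟨v⟩²)`. -/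
def shellRegion : Set (ℝ × ℝ) := {q | 0 < q.2 ∧ 1 < q.2 * (1 - q.1 ^ 2)}

theorem measurableSet_shellRegion : MeasurableSet shellRegion := by
  have h1 : MeasurableSet {q : ℝ × ℝ | 0 < q.2} := measurableSet_lt (by fun_prop) (by fun_prop)
  have h2 : MeasurableSet {q : ℝ × ℝ | 1 < q.2 * (1 - q.1 ^ 2)} :=
    measurableSet_lt (by fun_prop) (by fun_prop)
  exact h1.inter h2

theorem lintegral_add_left_Ioi (g : ℝ → ℝ≥0∞) (b : ℝ) :
    ∫⁻ r in Ioi (0 : ℝ), g (b + r) = ∫⁻ x in Ioi b, g x := by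
  rw [← lintegral_indicator measurableSet_Ioi, ← lintegral_indicator measurableSet_Ioi,
    ← lintegral_add_right_eq_self ((Ioi b).indicator g) b]
  refine lintegral_congr fun r => ?_
  simp [indicator, add_comm]

theorem lintegral_mul_left_comp (g : ℝ → ℝ≥0∞) (hg : Measurable g) {a : ℝ} (ha : 0 < a) :
    ∫⁻ y, g y = ENNReal.ofReal a * ∫⁻ u, g (a * u) := by
  conv_lhs => rw [← Real.smul_map_volume_mul_left ha.ne']
  rw [lintegral_smul_measure, lintegral_map hg (by fun_prop), abs_of_pos ha, smul_eq_mul]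

/-- Substitute `x = 1 + a² + r` at fixed `a`, exchange the integrals, then `a = √x·u` at fixed `x`.
The last Jacobian is the factor `√x`, and `r > 0` turns into `1 < x(1-u²)`. -/
theorem lintegral_shell (f : ℝ → ℝ → ℝ≥0∞) (hf : Measurable (Function.uncurry f)) :
    ∫⁻ v : R3, f (v 0 / √(1 + ‖v‖ ^ 2)) (1 + ‖v‖ ^ 2)
      = ∫⁻ q in shellRegion, ENNReal.ofReal (Real.pi * √q.2) * f q.1 q.2 := by
  rw [lintegral_first_normSq (fun a r => f (a / √(1 + r)) (1 + r))
    (hf.comp (by fun_prop : Measurable fun q : ℝ × ℝ => (q.1 / √(1 + q.2), 1 + q.2)))]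
  let g : ℝ → ℝ → ℝ≥0∞ := fun a x => (Ioi (1 + a ^ 2)).indicator (fun x => f (a / √x) x) x
  have hg : Measurable (Function.uncurry g) := by
    have : Function.uncurry g = {q : ℝ × ℝ | 1 + q.1 ^ 2 < q.2}.indicator
        (fun q => f (q.1 / √q.2) q.2) := by
      ext ⟨a, x⟩; simp [g, Function.uncurry, indicator]
    rw [this]
    exact (hf.comp (by fun_prop : Measurable fun q : ℝ × ℝ => (q.1 / √q.2, q.2))).indicator
      (measurableSet_lt (by fun_prop) (by fun_prop))
  have h1 : ∀ a : ℝ, ∫⁻ r in Ioi (0 : ℝ), f (a / √(1 + (a ^ 2 + r))) (1 + (a ^ 2 + r))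
      = ∫⁻ x, g a x := by
    intro a
    simp_rw [g, lintegral_indicator measurableSet_Ioi]
    rw [← lintegral_add_left_Ioi (fun x => f (a / √x) x) (1 + a ^ 2)]
    simp_rw [add_assoc]
  simp_rw [h1]
  rw [lintegral_lintegral_swap hg.aemeasurable]
  let h : ℝ → ℝ → ℝ≥0∞ := fun x u => shellRegion.indicator
    (fun q : ℝ × ℝ => ENNReal.ofReal (√q.2) * f q.1 q.2) (u, x)
  have hh0 : Measurable fun q : ℝ × ℝ => ENNReal.ofReal (√q.2) * f q.1 q.2 :=
    (by fun_prop : Measurable fun q : ℝ × ℝ => ENNReal.ofReal (√q.2)).mul hf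
  have hh : Measurable (Function.uncurry h) :=
    (hh0.indicator measurableSet_shellRegion).comp measurable_swap
  have h2 : ∀ x : ℝ, ∫⁻ a, g a x = ∫⁻ u, h x u := by
    intro x
    rcases le_or_gt x 0 with hx | hx
    · have e1 : ∀ a, g a x = 0 := fun a => indicator_of_notMem (by
        simp only [mem_Ioi, not_lt]; nlinarith [sq_nonneg a]) _
      have e2 : ∀ u, h x u = 0 := fun u => indicator_of_notMem (by
        simp only [shellRegion, mem_ofPred_eq, not_and]; intro h; linarith) _
      simp [e1, e2]
    · have hs : 0 < √x := Real.sqrt_pos.2 hx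
      rw [lintegral_mul_left_comp (fun a => g a x)
        (hg.comp (by fun_prop : Measurable fun a : ℝ => (a, x))) hs, ← lintegral_const_mul]
      · refine lintegral_congr fun u => ?_
        have hiff : x ∈ Ioi (1 + (√x * u) ^ 2) ↔ (u, x) ∈ shellRegion := by
          simp only [mem_Ioi, shellRegion, mem_ofPred_eq, hx, true_and, mul_pow, Real.sq_sqrt hx.le]
          constructor <;> intro h <;> linarith
        by_cases hu : (u, x) ∈ shellRegion
        · simp only [g, h, indicator_of_mem hu, indicator_of_mem (hiff.2 hu)]
          rw [mul_div_cancel_left₀ _ hs.ne']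
        · simp only [g, h, indicator_of_notMem hu, indicator_of_notMem (fun h => hu (hiff.1 h)),
            mul_zero]
      · exact hg.comp (by fun_prop : Measurable fun u : ℝ => (√x * u, x))
  simp_rw [h2]
  rw [lintegral_lintegral_swap hh.aemeasurable]
  have h3 : ∫⁻ u, ∫⁻ x, h x u = ∫⁻ q in shellRegion, ENNReal.ofReal (√q.2) * f q.1 q.2 := by
    rw [← lintegral_indicator measurableSet_shellRegion, Measure.volume_eq_prod,
      lintegral_prod _ (hh0.indicator measurableSet_shellRegion).aemeasurable]
  rw [h3, ← lintegral_const_mul _ hh0]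
  refine lintegral_congr fun q => ?_
  rw [ENNReal.ofReal_mul Real.pi_pos.le, mul_assoc]

/-- The reflection exchanging `e` with the first basis vector. It carries the computation for the
first coordinate over to an arbitrary direction. -/
theorem exists_isometry_first (e : R3) (he : ‖e‖ = 1) :
    ∃ T : R3 ≃ₗᵢ[ℝ] R3, ∀ v : R3, ⟪e, T v⟫ = v 0 := by
  have hs : ‖(EuclideanSpace.single 0 1 : R3)‖ = ‖e‖ := by simp [he]
  refine ⟨(ℝ ∙ ((EuclideanSpace.single 0 1 : R3) - e))ᗮ.reflection, fun v => ?_⟩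
  have h := Submodule.reflection_sub hs
  generalize (ℝ ∙ ((EuclideanSpace.single 0 1 : R3) - e))ᗮ.reflection = T at h ⊢
  rw [← h, LinearIsometryEquiv.inner_map_map]
  simp [EuclideanSpace.inner_single_left]

/-- The law of `(e·v̂, ⟨v⟩²)`. -/
def shellMeasure : Measure (ℝ × ℝ) :=
  (volume.restrict shellRegion).withDensity fun q => ENNReal.ofReal (Real.pi * √q.2)

theorem jap_sq (x : ℝ) : jap x ^ 2 = 1 + x ^ 2 := Real.sq_sqrt (by positivity)

theorem jap_pos (x : ℝ) : 0 < jap x := Real.sqrt_pos.2 (by positivity)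

theorem one_le_jap (x : ℝ) : 1 ≤ jap x := by
  rw [jap, Real.one_le_sqrt]; nlinarith [sq_nonneg x]

theorem continuous_jap : Continuous jap := by unfold jap; fun_prop

theorem measurable_velocity : Measurable velocity := by
  have h : Measurable fun v : R3 => jap ‖v‖ := continuous_jap.measurable.comp measurable_norm
  exact h.inv.smul measurable_id

theorem measurable_shellMap (e : R3) :
    Measurable fun v : R3 => (⟪e, velocity v⟫, 1 + ‖v‖ ^ 2) := by
  have := measurable_velocity
  fun_prop

theorem map_shellMap (e : R3) (he : ‖e‖ = 1) :
    Measure.map (fun v : R3 => ((⟪e, velocity v⟫ : ℝ), 1 + ‖v‖ ^ 2)) volume = shellMeasure := by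
  obtain ⟨T, hT⟩ := exists_isometry_first e he
  ext s hs
  have hden : Measurable fun q : ℝ × ℝ => ENNReal.ofReal (Real.pi * √q.2) := by fun_prop
  have hf : Measurable (s.indicator (1 : ℝ × ℝ → ℝ≥0∞)) := measurable_one.indicator hs
  rw [← lintegral_indicator_one hs, ← lintegral_indicator_one hs,
    lintegral_map hf (measurable_shellMap e),
    shellMeasure, lintegral_withDensity_eq_lintegral_mul _ hden hf,
    ← T.measurePreserving.lintegral_comp_emb T.toHomeomorph.measurableEmbedding]
  have := lintegral_shell (fun a x => s.indicator (1 : ℝ × ℝ → ℝ≥0∞) (a, x)) hf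
  refine Eq.trans (lintegral_congr fun v => ?_) this
  rw [velocity, real_inner_smul_right, hT, LinearIsometryEquiv.norm_map, jap, inv_mul_eq_div]

theorem integrable_shell_iff (e : R3) (he : ‖e‖ = 1) {g : ℝ × ℝ → ℂ} (hg : Measurable g) :
    Integrable (fun v : R3 => g (⟪e, velocity v⟫, 1 + ‖v‖ ^ 2))
      ↔ IntegrableOn (fun q : ℝ × ℝ => (Real.pi * √q.2) • g q) shellRegion := by
  have hden : Measurable fun q : ℝ × ℝ => ENNReal.ofReal (Real.pi * √q.2) := by fun_prop
  rw [show (fun v : R3 => g (⟪e, velocity v⟫, 1 + ‖v‖ ^ 2))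
    = g ∘ (fun v : R3 => ((⟪e, velocity v⟫ : ℝ), 1 + ‖v‖ ^ 2)) from rfl,
    ← integrable_map_measure hg.aestronglyMeasurable (measurable_shellMap e).aemeasurable,
    map_shellMap e he, shellMeasure,
    integrable_withDensity_iff_integrable_smul' hden (by simp), IntegrableOn]
  refine integrable_congr (ae_of_all _ fun q => ?_)
  simp only
  rw [ENNReal.toReal_ofReal (by positivity)]

theorem integral_shell (e : R3) (he : ‖e‖ = 1) {g : ℝ × ℝ → ℂ} (hg : Measurable g) :
    ∫ v : R3, g (⟪e, velocity v⟫, 1 + ‖v‖ ^ 2)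
      = ∫ q in shellRegion, (Real.pi * √q.2) • g q := by
  have hden : Measurable fun q : ℝ × ℝ => ENNReal.ofReal (Real.pi * √q.2) := by fun_prop
  rw [← integral_map (φ := fun v : R3 => ((⟪e, velocity v⟫ : ℝ), 1 + ‖v‖ ^ 2))
    (measurable_shellMap e).aemeasurable hg.aestronglyMeasurable,
    map_shellMap e he, shellMeasure, integral_withDensity_eq_integral_toReal_smul hden (by simp)]
  refine integral_congr_ae (ae_of_all _ fun q => ?_)
  simp only
  rw [ENNReal.toReal_ofReal (by positivity)]

/-! ### The equilibrium on the positive half-line -/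

/-- The `j`-th derivative of `F` on the positive half-line. -/
def realDeriv (F : ℂ → ℂ) (j : ℕ) : ℝ → ℝ :=
  (Ioi (0 : ℝ)).piecewise (fun x => (iteratedDeriv j F (x : ℂ)).re) (fun _ => 0)

theorem realDeriv_of_pos (F : ℂ → ℂ) (j : ℕ) {x : ℝ} (hx : 0 < x) :
    realDeriv F j x = (iteratedDeriv j F (x : ℂ)).re := piecewise_eq_of_mem _ _ _ hx

theorem isOpen_rightHalfPlane : IsOpen {z : ℂ | 0 < z.re} := isOpen_lt continuous_const Complex.continuous_re

theorem IsAdmissible.hasDerivAt_realDeriv {F : ℂ → ℂ} {N₀ : ℕ} (hF : IsAdmissible F N₀) (j : ℕ)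
    {x : ℝ} (hx : 0 < x) : HasDerivAt (realDeriv F j) (realDeriv F (j + 1) x) x := by
  have han : AnalyticOnNhd ℂ (iteratedDeriv j F) {z : ℂ | 0 < z.re} := by
    rw [iteratedDeriv_eq_iterate]
    exact (hF.holomorphic.analyticOnNhd isOpen_rightHalfPlane).iterated_deriv j
  have hd : HasDerivAt (iteratedDeriv j F) (iteratedDeriv (j + 1) F x) (x : ℂ) := by
    rw [iteratedDeriv_succ]
    exact (han (x : ℂ) (by simpa using hx)).differentiableAt.hasDerivAt
  rw [realDeriv_of_pos F _ hx]
  refine hd.real_of_complex.congr_of_eventuallyEq ?_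
  filter_upwards [Ioi_mem_nhds hx] with y hy using realDeriv_of_pos F j hy

theorem IsAdmissible.continuousOn_realDeriv {F : ℂ → ℂ} {N₀ : ℕ} (hF : IsAdmissible F N₀) (j : ℕ) :
    ContinuousOn (realDeriv F j) (Ioi 0) := fun _ hx =>
  (hF.hasDerivAt_realDeriv j hx).continuousAt.continuousWithinAt

theorem IsAdmissible.measurable_realDeriv {F : ℂ → ℂ} {N₀ : ℕ} (hF : IsAdmissible F N₀) (j : ℕ) :
    Measurable (realDeriv F j) := by
  refine ContinuousOn.measurable_piecewise ?_ continuousOn_const measurableSet_Ioi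
  exact (hF.continuousOn_realDeriv j).congr fun x hx => (realDeriv_of_pos F j hx).symm

theorem IsAdmissible.exists_abs_realDeriv_le {F : ℂ → ℂ} {N₀ : ℕ} (hF : IsAdmissible F N₀) (j : ℕ) :
    ∃ C : ℝ, 0 ≤ C ∧ ∀ x : ℝ, 0 < x → |realDeriv F j x| ≤ C * x ^ (-((N₀ : ℝ) / 2) - (j : ℝ)) := by
  obtain ⟨C, hC⟩ := hF.decay 1 one_pos j
  refine ⟨max C 0, le_max_right _ _, fun x hx => ?_⟩
  rw [realDeriv_of_pos F j hx]
  -- With `R = 1` the decay assumption covers the whole half-line: scale `s = x`, point `1` for `x ≥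
  -- 1`, and scale `1`, point `x` for `x ≤ 1`.
  have key : ‖iteratedDeriv j F (x : ℂ)‖ ≤ C * x ^ (-((N₀ : ℝ) / 2) - (j : ℝ)) := by
    rcases le_total 1 x with h | h
    · simpa using hC x h 1 (by simp) (by simp)
    · simpa using hC 1 le_rfl x (by simpa using hx) (by simpa [abs_of_pos hx] using h)
  exact (Complex.abs_re_le_norm _).trans (key.trans (by gcongr; exact le_max_left _ _))

theorem IsAdmissible.realDeriv_zero_nonneg {F : ℂ → ℂ} {N₀ : ℕ} (hF : IsAdmissible F N₀)
    {x : ℝ} (hx : 1 ≤ x) : 0 ≤ realDeriv F 0 x := by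
  rw [realDeriv_of_pos F 0 (by linarith), iteratedDeriv_zero]
  exact (hF.nonneg x hx).2

theorem profile_eq_realDeriv (F : ℂ → ℂ) {s : ℝ} (hs : 0 < s) :
    profile F s = realDeriv F 0 (s ^ 2) := by
  rw [realDeriv_of_pos F 0 (by positivity), iteratedDeriv_zero, profile]
  simp

theorem IsAdmissible.deriv_profile {F : ℂ → ℂ} {N₀ : ℕ} (hF : IsAdmissible F N₀) {s : ℝ}
    (hs : 0 < s) : deriv (profile F) s = realDeriv F 1 (s ^ 2) * (2 * s) := by
  have h := (hF.hasDerivAt_realDeriv 0 (x := s ^ 2) (by positivity)).comp s (hasDerivAt_pow 2 s)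
  refine (HasDerivAt.congr_of_eventuallyEq (f := realDeriv F 0 ∘ fun s => s ^ 2) ?_ ?_).deriv
  · simpa using h
  · filter_upwards [Ioi_mem_nhds hs] with y hy using profile_eq_realDeriv F hy

theorem equilibrium_eq (F : ℂ → ℂ) (v : R3) :
    equilibrium F v = realDeriv F 0 (1 + ‖v‖ ^ 2) := by
  rw [equilibrium, profile_eq_realDeriv F (jap_pos _), jap_sq]

theorem IsAdmissible.integrableOn_realDeriv {F : ℂ → ℂ} {N₀ : ℕ} (hF : IsAdmissible F N₀)
    (hN : 11 ≤ N₀) {a : ℝ} (ha : 0 < a) : IntegrableOn (realDeriv F 0) (Ioi a) := by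
  obtain ⟨C, -, hC⟩ := hF.exists_abs_realDeriv_le 0
  have hN' : (11 : ℝ) ≤ N₀ := by exact_mod_cast hN
  have hi : IntegrableOn (fun x : ℝ => C * x ^ (-((N₀ : ℝ) / 2) - ((0 : ℕ) : ℝ))) (Ioi a) :=
    (integrableOn_Ioi_rpow_of_lt (by push_cast; linarith) ha).const_mul C
  refine hi.mono' (hF.measurable_realDeriv 0).aestronglyMeasurable ?_
  filter_upwards [ae_restrict_mem measurableSet_Ioi] with x hx
  exact hC x (ha.trans hx)

/-- `∫_x^∞ F`. -/
def tail (F : ℂ → ℂ) (x : ℝ) : ℝ := ∫ y in Ioi x, realDeriv F 0 y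

theorem IsAdmissible.hasDerivAt_tail {F : ℂ → ℂ} {N₀ : ℕ} (hF : IsAdmissible F N₀)
    (hN : 11 ≤ N₀) {x : ℝ} (hx : 0 < x) : HasDerivAt (tail F) (-realDeriv F 0 x) x := by
  have hx2 : 0 < x / 2 := by positivity
  have hi := hF.integrableOn_realDeriv hN hx2
  have heq : ∀ y ∈ Ioi (x / 2), tail F y = tail F (x / 2) - ∫ t in (x / 2)..y, realDeriv F 0 t := by
    intro y hy
    have hy' : x / 2 ≤ y := le_of_lt hy
    rw [tail, tail, intervalIntegral.integral_of_le hy', ← Ioc_union_Ioi_eq_Ioi hy',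
      setIntegral_union (Ioc_disjoint_Ioi le_rfl) measurableSet_Ioi
        (hi.mono_set Ioc_subset_Ioi_self) (hi.mono_set (Ioi_subset_Ioi hy'))]
    ring
  have hd : HasDerivAt (fun y => ∫ t in (x / 2)..y, realDeriv F 0 t) (realDeriv F 0 x) x := by
    refine intervalIntegral.integral_hasDerivAt_right ?_ ?_ ?_
    · rw [intervalIntegrable_iff_integrableOn_Ioc_of_le (by linarith)]
      exact hi.mono_set Ioc_subset_Ioi_self
    · exact (hF.measurable_realDeriv 0).stronglyMeasurable.stronglyMeasurableAtFilter
    · exact (hF.hasDerivAt_realDeriv 0 hx).continuousAt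
  refine (hd.const_sub (tail F (x / 2))).congr_of_eventuallyEq ?_
  filter_upwards [Ioi_mem_nhds (by linarith : x / 2 < x)] with y hy using heq y hy

theorem IsAdmissible.exists_abs_tail_le {F : ℂ → ℂ} {N₀ : ℕ} (hF : IsAdmissible F N₀)
    (hN : 11 ≤ N₀) : ∃ C : ℝ, 0 ≤ C ∧ ∀ x : ℝ, 0 < x → |tail F x| ≤ C * x ^ (1 - (N₀ : ℝ) / 2) := by
  obtain ⟨C, hC0, hC⟩ := hF.exists_abs_realDeriv_le 0
  have hN' : (11 : ℝ) ≤ N₀ := by exact_mod_cast hN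
  have hlt : -((N₀ : ℝ) / 2) - ((0 : ℕ) : ℝ) < -1 := by push_cast; linarith
  refine ⟨C / ((N₀ : ℝ) / 2 - 1), div_nonneg hC0 (by linarith), fun x hx => ?_⟩
  have hi : IntegrableOn (fun x : ℝ => C * x ^ (-((N₀ : ℝ) / 2) - ((0 : ℕ) : ℝ))) (Ioi x) :=
    (integrableOn_Ioi_rpow_of_lt hlt hx).const_mul C
  have h := norm_integral_le_of_norm_le hi (f := realDeriv F 0) (by
    filter_upwards [ae_restrict_mem measurableSet_Ioi] with y hy using hC y (hx.trans hy))
  rw [integral_const_mul, integral_Ioi_rpow_of_lt hlt hx] at h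
  refine h.trans (le_of_eq ?_)
  have : (N₀ : ℝ) / 2 - 1 ≠ 0 := by linarith
  rw [show -((N₀ : ℝ) / 2) - ((0 : ℕ) : ℝ) + 1 = 1 - (N₀ : ℝ) / 2 by push_cast; ring]
  rw [show (1 - (N₀ : ℝ) / 2) = -((N₀ : ℝ) / 2 - 1) by ring, neg_div_neg_eq]
  ring

/-- A vanishing tail forces the non-negative continuous `F` to vanish on a half-line, hence
identically by the identity theorem, and then the mass would be zero. -/
theorem IsAdmissible.tail_pos {F : ℂ → ℂ} {N₀ : ℕ} (hF : IsAdmissible F N₀)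
    (hN : 11 ≤ N₀) {x : ℝ} (hx : 1 ≤ x) : 0 < tail F x := by
  have hx0 : 0 < x := by linarith
  have hi := hF.integrableOn_realDeriv hN hx0
  have hnn : 0 ≤ᵐ[volume.restrict (Ioi x)] realDeriv F 0 := by
    filter_upwards [ae_restrict_mem measurableSet_Ioi] with y hy
    exact hF.realDeriv_zero_nonneg (hx.trans (le_of_lt hy))
  rcases (integral_nonneg_of_ae hnn).lt_or_eq with h | h
  · exact h
  exfalso
  have hae := (integral_eq_zero_iff_of_nonneg_ae hnn hi).1 h.symm
  have hzero : ∀ y ∈ Ioi x, realDeriv F 0 y = 0 := by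
    refine (Measure.eqOn_open_of_ae_eq (μ := volume) (g := fun _ => (0 : ℝ)) hae isOpen_Ioi ?_
      continuousOn_const)
    exact (hF.continuousOn_realDeriv 0).mono fun y hy => hx0.trans hy
  have hFz : ∀ y : ℝ, x < y → F y = 0 := by
    intro y hy
    have h1 := hzero y hy
    rw [realDeriv_of_pos F 0 (hx0.trans hy), iteratedDeriv_zero] at h1
    exact Complex.ext h1 (hF.nonneg y (by linarith)).1
  have han := hF.holomorphic.analyticOnNhd isOpen_rightHalfPlane
  have hconn : IsPreconnected {z : ℂ | 0 < z.re} := (convex_halfSpace_re_gt 0).isPreconnected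
  have hmem : ((x + 1 : ℝ) : ℂ) ∈ {z : ℂ | 0 < z.re} := by
    simp only [mem_ofPred_eq, Complex.ofReal_re]; linarith
  have hfreq : ∃ᶠ z in 𝓝[≠] ((x + 1 : ℝ) : ℂ), F z = 0 := by
    have ht : Tendsto (fun y : ℝ => (y : ℂ)) (𝓝[>] (x + 1)) (𝓝[≠] ((x + 1 : ℝ) : ℂ)) := by
      refine tendsto_nhdsWithin_iff.2 ⟨?_, ?_⟩
      · exact (Complex.continuous_ofReal.tendsto (x + 1)).mono_left nhdsWithin_le_nhds
      · filter_upwards [self_mem_nhdsWithin] with y hy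
        simp only [mem_compl_iff, mem_singleton_iff, Complex.ofReal_inj]
        exact ne_of_gt hy
    refine ht.frequently (Eventually.frequently ?_)
    filter_upwards [self_mem_nhdsWithin] with y hy
    have : x + 1 < y := hy
    exact hFz y (by linarith)
  have hall := han.eqOn_zero_of_preconnected_of_frequently_eq_zero hconn hmem hfreq
  refine hF.mass_ne_zero ?_
  rw [integral_eq_zero_of_ae]
  refine ae_of_all _ fun v => ?_
  rw [equilibrium_eq, realDeriv_of_pos F 0 (by positivity), iteratedDeriv_zero,
    hall (by simp only [mem_ofPred_eq, Complex.ofReal_re]; positivity)]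
  rfl

/-- The density of the transverse current response with respect to `u = k̂·v̂`. -/
def cutDensity (F : ℂ → ℂ) : ℝ → ℝ :=
  (Ioo (-1 : ℝ) 1).indicator fun u => Real.pi * (1 - u ^ 2) * tail F (1 / (1 - u ^ 2))

theorem one_sub_sq_pos {u : ℝ} (hu : u ∈ Ioo (-1 : ℝ) 1) : 0 < 1 - u ^ 2 := by
  nlinarith [hu.1, hu.2]

theorem one_sub_sq_le_one (u : ℝ) : 1 - u ^ 2 ≤ 1 := by nlinarith [sq_nonneg u]

theorem one_le_inv_one_sub_sq {u : ℝ} (hu : u ∈ Ioo (-1 : ℝ) 1) : 1 ≤ 1 / (1 - u ^ 2) := by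
  rw [one_le_div (one_sub_sq_pos hu)]; exact one_sub_sq_le_one u

theorem cutDensity_of_mem (F : ℂ → ℂ) {u : ℝ} (hu : u ∈ Ioo (-1 : ℝ) 1) :
    cutDensity F u = Real.pi * (1 - u ^ 2) * tail F (1 / (1 - u ^ 2)) := indicator_of_mem hu _

theorem cutDensity_of_notMem (F : ℂ → ℂ) {u : ℝ} (hu : u ∉ Ioo (-1 : ℝ) 1) :
    cutDensity F u = 0 := indicator_of_notMem hu _

theorem IsAdmissible.cutDensity_pos {F : ℂ → ℂ} {N₀ : ℕ} (hF : IsAdmissible F N₀)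
    (hN : 11 ≤ N₀) {u : ℝ} (hu : u ∈ Ioo (-1 : ℝ) 1) : 0 < cutDensity F u := by
  rw [cutDensity_of_mem F hu]
  have := hF.tail_pos hN (one_le_inv_one_sub_sq hu)
  have := one_sub_sq_pos hu
  positivity

theorem IsAdmissible.cutDensity_nonneg {F : ℂ → ℂ} {N₀ : ℕ} (hF : IsAdmissible F N₀)
    (hN : 11 ≤ N₀) (u : ℝ) : 0 ≤ cutDensity F u := by
  by_cases hu : u ∈ Ioo (-1 : ℝ) 1
  · exact (hF.cutDensity_pos hN hu).le
  · exact (cutDensity_of_notMem F hu).ge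

theorem cutDensity_neg (F : ℂ → ℂ) (u : ℝ) : cutDensity F (-u) = cutDensity F u := by
  by_cases hu : u ∈ Ioo (-1 : ℝ) 1
  · have hu' : -u ∈ Ioo (-1 : ℝ) 1 := ⟨by linarith [hu.2], by linarith [hu.1]⟩
    rw [cutDensity_of_mem F hu, cutDensity_of_mem F hu', neg_sq]
  · have hu' : -u ∉ Ioo (-1 : ℝ) 1 := fun h => hu ⟨by linarith [h.2], by linarith [h.1]⟩
    rw [cutDensity_of_notMem F hu, cutDensity_of_notMem F hu']

/-! ### Reduction of momentum integrals -/

theorem shellRegion_subset : shellRegion ⊆ Ioo (-1 : ℝ) 1 ×ˢ Ioi (1 : ℝ) := by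
  rintro ⟨u, x⟩ ⟨hx, h⟩
  simp only at hx h
  have hc : 0 < 1 - u ^ 2 := by
    by_contra hc
    nlinarith [mul_nonneg hx.le (not_lt.1 hc |> sub_nonneg.2)]
  refine ⟨⟨by nlinarith, by nlinarith⟩, ?_⟩
  simp only [mem_Ioi]
  nlinarith [mul_nonneg hx.le (sq_nonneg u)]

theorem integrableOn_shell {h : ℝ × ℝ → ℂ} (hm : Measurable h) {C a : ℝ} (ha : a < -1)
    (hb : ∀ q ∈ shellRegion, ‖h q‖ ≤ C * q.2 ^ a) : IntegrableOn h shellRegion := by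
  have h1 : IntegrableOn (fun q : ℝ × ℝ => C * q.2 ^ a) (Ioo (-1 : ℝ) 1 ×ˢ Ioi (1 : ℝ)) := by
    have hi : IntegrableOn (fun _ : ℝ => C) (Ioo (-1 : ℝ) 1) :=
      integrableOn_const (by simp)
    have hj : IntegrableOn (fun x : ℝ => x ^ a) (Ioi (1 : ℝ)) :=
      integrableOn_Ioi_rpow_of_lt ha one_pos
    have := Integrable.mul_prod hi hj
    rw [Measure.prod_restrict] at this
    exact this
  refine (h1.mono_set shellRegion_subset).mono' hm.aestronglyMeasurable ?_
  filter_upwards [ae_restrict_mem measurableSet_shellRegion] with q hq using hb q hq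

theorem mem_shellRegion_iff {u x : ℝ} (hu : u ∈ Ioo (-1 : ℝ) 1) :
    (u, x) ∈ shellRegion ↔ x ∈ Ioi (1 / (1 - u ^ 2)) := by
  have hc := one_sub_sq_pos hu
  simp only [shellRegion, mem_ofPred_eq, mem_Ioi, div_lt_iff₀ hc]
  refine ⟨fun h => h.2, fun h => ⟨?_, h⟩⟩
  by_contra hx
  nlinarith [mul_nonneg hc.le (sub_nonneg.2 (not_lt.1 hx))]

theorem integral_shellRegion {h : ℝ × ℝ → ℂ} (hi : IntegrableOn h shellRegion) :
    ∫ q in shellRegion, h q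
      = ∫ u in Ioo (-1 : ℝ) 1, ∫ x in Ioi (1 / (1 - u ^ 2)), h (u, x) := by
  rw [← integral_indicator measurableSet_shellRegion, Measure.volume_eq_prod, integral_prod,
    ← integral_indicator measurableSet_Ioo]
  · refine integral_congr_ae (ae_of_all _ fun u => ?_)
    by_cases hu : u ∈ Ioo (-1 : ℝ) 1
    · rw [indicator_of_mem hu]
      simp only
      rw [← integral_indicator measurableSet_Ioi]
      refine integral_congr_ae (ae_of_all _ fun x => ?_)
      simp only [indicator, mem_shellRegion_iff hu]
    · rw [indicator_of_notMem hu]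
      refine integral_eq_zero_of_ae (ae_of_all _ fun x => ?_)
      exact indicator_of_notMem (fun hq => hu (shellRegion_subset hq).1) _
  · rw [← Measure.volume_eq_prod]
    exact (integrable_indicator_iff measurableSet_shellRegion).2 hi

/-- The integrand has primitive `(xc-1)F(x) + c·tail(x)`. It tends to `0` at infinity, and its first
term vanishes at the lower limit `1/c`. -/
theorem IsAdmissible.integral_Ioi_realDeriv_one {F : ℂ → ℂ} {N₀ : ℕ} (hF : IsAdmissible F N₀)
    (hN : 11 ≤ N₀) {c : ℝ} (hc : 0 < c) :
    ∫ x in Ioi (1 / c), (x * c - 1) * realDeriv F 1 x = -(c * tail F (1 / c)) := by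
  have hN' : (11 : ℝ) ≤ N₀ := by exact_mod_cast hN
  have hc' : 0 < 1 / c := by positivity
  obtain ⟨C0, hC0, h0⟩ := hF.exists_abs_realDeriv_le 0
  obtain ⟨C1, hC1, h1⟩ := hF.exists_abs_realDeriv_le 1
  obtain ⟨C2, hC2, h2⟩ := hF.exists_abs_tail_le hN
  have hd : ∀ x ∈ Ici (1 / c), HasDerivAt (fun x => (x * c - 1) * realDeriv F 0 x + c * tail F x)
      ((x * c - 1) * realDeriv F 1 x) x := by
    intro x hx
    have hx0 : 0 < x := hc'.trans_le hx
    have := (((hasDerivAt_id x).mul_const c).sub_const 1).mul (hF.hasDerivAt_realDeriv 0 hx0)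
    have := this.add ((hF.hasDerivAt_tail hN hx0).const_mul c)
    refine this.congr_deriv ?_
    simp
  have hpow : ∀ x : ℝ, 0 < x → ∀ a : ℝ, x * x ^ a = x ^ (1 + a) := fun x hx a => by
    rw [Real.rpow_add hx, Real.rpow_one]
  have hle : ∀ x ∈ Ioi (1 / c), |x * c - 1| ≤ c * x := by
    intro x hx
    have : 1 < x * c := (div_lt_iff₀ hc).1 hx
    rw [abs_of_pos (by linarith)]
    linarith
  have hint : IntegrableOn (fun x => (x * c - 1) * realDeriv F 1 x) (Ioi (1 / c)) := by
    have hi : IntegrableOn (fun x : ℝ => (c * C1) * x ^ (1 + (-((N₀ : ℝ) / 2) - ((1 : ℕ) : ℝ))))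
        (Ioi (1 / c)) :=
      (integrableOn_Ioi_rpow_of_lt (by push_cast; linarith) hc').const_mul _
    refine hi.mono' ?_ ?_
    · have := hF.measurable_realDeriv 1
      exact Measurable.aestronglyMeasurable (by fun_prop)
    · filter_upwards [ae_restrict_mem measurableSet_Ioi] with x hx
      have hx0 : 0 < x := hc'.trans hx
      rw [norm_mul, Real.norm_eq_abs, Real.norm_eq_abs, ← hpow x hx0]
      calc _ ≤ (c * x) * (C1 * x ^ (-((N₀ : ℝ) / 2) - ((1 : ℕ) : ℝ))) := by
            gcongr
            · exact hle x hx
            · exact h1 x hx0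
        _ = _ := by ring
  have hlim : Tendsto (fun x => (x * c - 1) * realDeriv F 0 x + c * tail F x) atTop (𝓝 0) := by
    have hz : Tendsto (fun x : ℝ => (c * C0 + c * C2) * x ^ (1 - (N₀ : ℝ) / 2)) atTop (𝓝 0) := by
      have := (tendsto_rpow_neg_atTop (y := (N₀ : ℝ) / 2 - 1) (by linarith)).const_mul
        (c * C0 + c * C2)
      simpa using this
    refine squeeze_zero_norm' ?_ hz
    filter_upwards [Ioi_mem_atTop (1 / c)] with x hx
    have hx0 : 0 < x := hc'.trans hx
    have e0 := h0 x hx0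
    rw [show -((N₀ : ℝ) / 2) - ((0 : ℕ) : ℝ) = -((N₀ : ℝ) / 2) by simp] at e0
    calc ‖(x * c - 1) * realDeriv F 0 x + c * tail F x‖
        ≤ |x * c - 1| * |realDeriv F 0 x| + c * |tail F x| := by
          refine (norm_add_le _ _).trans (le_of_eq ?_)
          rw [norm_mul, norm_mul, Real.norm_eq_abs, Real.norm_eq_abs, Real.norm_eq_abs,
            Real.norm_eq_abs, abs_of_pos hc]
      _ ≤ (c * x) * (C0 * x ^ (-((N₀ : ℝ) / 2))) + c * (C2 * x ^ (1 - (N₀ : ℝ) / 2)) := by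
          gcongr
          · exact hle x hx
          · exact h2 x hx0
      _ = (c * C0 + c * C2) * x ^ (1 - (N₀ : ℝ) / 2) := by
          rw [show (1 - (N₀ : ℝ) / 2) = 1 + -((N₀ : ℝ) / 2) by ring, ← hpow x hx0]; ring
  rw [integral_Ioi_of_hasDerivAt_of_tendsto' hd hint hlim]
  field_simp
  ring

/-- Only the `x`-integral is carried out, so the multiplier `m(u)` may be any bounded function. The
factor `1 - u² - 1/x` is `|ℙ_k v̂|²`, and `2√x F'(x)` is `φ'(⟨v⟩)`; together with the weight `√x`
they produce `(x(1-u²)-1)F'(x)`, to which the preceding integration by parts applies. -/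
theorem IsAdmissible.integral_shell_deriv {F : ℂ → ℂ} {N₀ : ℕ} (hF : IsAdmissible F N₀)
    (hN : 11 ≤ N₀) {m : ℝ → ℂ} (hm : Measurable m) {K : ℝ} (hK : ∀ u, ‖m u‖ ≤ K) :
    ∫ q in shellRegion, (Real.pi * √q.2) • (m q.1 * ((1 - q.1 ^ 2 - 1 / q.2 : ℝ) : ℂ)
        * ((realDeriv F 1 q.2 * (2 * √q.2) : ℝ) : ℂ))
      = -2 * ∫ u, m u * (cutDensity F u : ℂ) := by
  have hN' : (11 : ℝ) ≤ N₀ := by exact_mod_cast hN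
  obtain ⟨C1, hC1, h1⟩ := hF.exists_abs_realDeriv_le 1
  have hmr := hF.measurable_realDeriv 1
  have hi : IntegrableOn (fun q : ℝ × ℝ => (Real.pi * √q.2) •
      (m q.1 * ((1 - q.1 ^ 2 - 1 / q.2 : ℝ) : ℂ) * ((realDeriv F 1 q.2 * (2 * √q.2) : ℝ) : ℂ)))
      shellRegion := by
    refine integrableOn_shell (by fun_prop) (C := 2 * Real.pi * K * C1) (a := -((N₀ : ℝ) / 2))
      (by linarith) ?_
    rintro ⟨u, x⟩ hq
    obtain ⟨hx, hxc⟩ := hq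
    have hK0 : 0 ≤ K := (norm_nonneg _).trans (hK 0)
    simp only at hx hxc
    have hb : |1 - u ^ 2 - 1 / x| ≤ 1 := by
      have : 1 / x < 1 - u ^ 2 := by rw [div_lt_iff₀ hx]; linarith
      have : 0 < 1 / x := by positivity
      rw [abs_le]; constructor <;> nlinarith [sq_nonneg u]
    simp only
    rw [norm_smul, norm_mul (m u * _), norm_mul (m u), Complex.norm_real, Complex.norm_real,
      Real.norm_eq_abs, Real.norm_eq_abs, Real.norm_eq_abs, abs_mul (realDeriv F 1 x), abs_of_nonneg
        (by positivity : 0 ≤ Real.pi * √x), abs_of_nonneg (by positivity : 0 ≤ 2 * √x)]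
    calc _ ≤ Real.pi * √x * (K * 1 * (C1 * x ^ (-((N₀ : ℝ) / 2) - ((1 : ℕ) : ℝ)) * (2 * √x))) := by
          gcongr
          · exact hK u
          · exact h1 x hx
      _ = 2 * Real.pi * K * C1 * (√x * √x * x ^ (-((N₀ : ℝ) / 2) - ((1 : ℕ) : ℝ))) := by ring
      _ = _ := by
          rw [Real.mul_self_sqrt hx.le]
          nth_rewrite 1 [← Real.rpow_one x]
          rw [← Real.rpow_add hx]
          congr 2; push_cast; ring
  rw [integral_shellRegion hi, ← integral_const_mul]
  rw [← integral_indicator measurableSet_Ioo]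
  refine integral_congr_ae (ae_of_all _ fun u => ?_)
  by_cases hu : u ∈ Ioo (-1 : ℝ) 1
  · simp only [indicator_of_mem hu]
    have hc := one_sub_sq_pos hu
    rw [cutDensity_of_mem F hu]
    have := hF.integral_Ioi_realDeriv_one hN hc
    calc ∫ x in Ioi (1 / (1 - u ^ 2)), (Real.pi * √x) • (m u * ((1 - u ^ 2 - 1 / x : ℝ) : ℂ)
          * ((realDeriv F 1 x * (2 * √x) : ℝ) : ℂ))
        = ∫ x in Ioi (1 / (1 - u ^ 2)), (2 * Real.pi * m u) *
            (((x * (1 - u ^ 2) - 1) * realDeriv F 1 x : ℝ) : ℂ) := by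
          refine setIntegral_congr_fun measurableSet_Ioi fun x hx => ?_
          have hx0 : 0 < x := (by positivity : 0 < 1 / (1 - u ^ 2)).trans hx
          have hs := Real.mul_self_sqrt hx0.le
          have : Real.pi * √x * ((1 - u ^ 2 - 1 / x) * (realDeriv F 1 x * (2 * √x)))
              = 2 * Real.pi * ((x * (1 - u ^ 2) - 1) * realDeriv F 1 x) := by
            calc _ = 2 * Real.pi * ((√x * √x) * (1 - u ^ 2 - 1 / x) * realDeriv F 1 x) := by ring
              _ = _ := by rw [hs]; field_simp
          have h2 := congrArg (fun r : ℝ => m u * (r : ℂ)) this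
          simp only [Complex.real_smul]
          push_cast at h2 ⊢
          linear_combination h2
      _ = _ := by
          rw [integral_const_mul, integral_complex_ofReal, this]
          push_cast
          ring
  · simp only [indicator_of_notMem hu, cutDensity_of_notMem F hu]
    simp

theorem IsAdmissible.integral_shell_zero {F : ℂ → ℂ} {N₀ : ℕ} (hF : IsAdmissible F N₀)
    (hN : 11 ≤ N₀) :
    ∫ q in shellRegion, (Real.pi * √q.2) • (((1 - q.1 ^ 2) / √q.2 * realDeriv F 0 q.2 : ℝ) : ℂ)
      = ∫ u, (cutDensity F u : ℂ) ∧
    IntegrableOn (fun q : ℝ × ℝ => (Real.pi * √q.2) •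
      (((1 - q.1 ^ 2) / √q.2 * realDeriv F 0 q.2 : ℝ) : ℂ)) shellRegion := by
  have hN' : (11 : ℝ) ≤ N₀ := by exact_mod_cast hN
  obtain ⟨C1, hC1, h1⟩ := hF.exists_abs_realDeriv_le 0
  have hmr := hF.measurable_realDeriv 0
  have hi : IntegrableOn (fun q : ℝ × ℝ => (Real.pi * √q.2) •
      (((1 - q.1 ^ 2) / √q.2 * realDeriv F 0 q.2 : ℝ) : ℂ)) shellRegion := by
    refine integrableOn_shell (by fun_prop) (C := Real.pi * C1) (a := -((N₀ : ℝ) / 2))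
      (by linarith) ?_
    rintro ⟨u, x⟩ hq
    have hu := (shellRegion_subset hq).1
    obtain ⟨hx, hxc⟩ := hq
    simp only at hx hxc hu
    have hs : 0 < √x := Real.sqrt_pos.2 hx
    have e1 := h1 x hx
    have hc := one_sub_sq_pos hu
    simp only
    rw [norm_smul, Complex.norm_real, Real.norm_eq_abs, Real.norm_eq_abs,
      abs_mul ((1 - u ^ 2) / √x), abs_of_nonneg
      (by positivity : 0 ≤ Real.pi * √x), abs_of_nonneg (by positivity : 0 ≤ (1 - u ^ 2) / √x)]
    calc _ = Real.pi * (1 - u ^ 2) * |realDeriv F 0 x| := by field_simp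
      _ ≤ Real.pi * 1 * (C1 * x ^ (-((N₀ : ℝ) / 2) - ((0 : ℕ) : ℝ))) := by
          gcongr
          exact one_sub_sq_le_one u
      _ = _ := by simp [mul_assoc]
  refine ⟨?_, hi⟩
  rw [integral_shellRegion hi, ← integral_indicator measurableSet_Ioo]
  refine integral_congr_ae (ae_of_all _ fun u => ?_)
  by_cases hu : u ∈ Ioo (-1 : ℝ) 1
  · simp only [indicator_of_mem hu]
    have hc := one_sub_sq_pos hu
    rw [cutDensity_of_mem F hu, tail]
    calc ∫ x in Ioi (1 / (1 - u ^ 2)), (Real.pi * √x) •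
          (((1 - u ^ 2) / √x * realDeriv F 0 x : ℝ) : ℂ)
        = ∫ x in Ioi (1 / (1 - u ^ 2)), ((Real.pi * (1 - u ^ 2) * realDeriv F 0 x : ℝ) : ℂ) := by
          refine setIntegral_congr_fun measurableSet_Ioi fun x hx => ?_
          have hx0 : 0 < x := (by positivity : 0 < 1 / (1 - u ^ 2)).trans hx
          have hs : 0 < √x := Real.sqrt_pos.2 hx0
          simp only [Complex.real_smul, ← Complex.ofReal_mul]
          congr 1
          field_simp
      _ = _ := by rw [integral_complex_ofReal, integral_const_mul]
  · simp only [indicator_of_notMem hu, cutDensity_of_notMem F hu]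
    simp

theorem norm_velocity_sq (v : R3) : ‖velocity v‖ ^ 2 = 1 - 1 / (1 + ‖v‖ ^ 2) := by
  have h := jap_pos ‖v‖
  have h1 : (0 : ℝ) < 1 + ‖v‖ ^ 2 := by positivity
  rw [velocity, norm_smul, norm_inv, Real.norm_eq_abs, abs_of_pos h, mul_pow, inv_pow, jap_sq]
  field_simp
  ring

theorem norm_transverse_sq {κ : ℝ} (hκ : κ ≠ 0) {e : R3} (he : ‖e‖ = 1) (w : R3) :
    ‖transverse (κ • e) w‖ ^ 2 = ‖w‖ ^ 2 - ⟪e, w⟫ ^ 2 := by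
  have h : transverse (κ • e) w = w - ⟪e, w⟫ • e := by
    rw [transverse, real_inner_smul_left, norm_smul, he, smul_smul, mul_one, Real.norm_eq_abs,
      sq_abs]
    congr 2
    field_simp
  rw [h, norm_sub_sq_real, norm_smul, he, real_inner_smul_right, real_inner_comm,
    Real.norm_eq_abs, mul_one, sq_abs]
  ring

/-- Average over the three coordinate directions: each gives `∫ W` by rotation invariance, and `Σᵢ
(1 - v̂ᵢ²) = 3 - |v̂|² = (3 + 2|v|²)/(1 + |v|²)` reproduces the weight in `τ₀²`. -/
theorem IsAdmissible.tauZeroSq_eq {F : ℂ → ℂ} {N₀ : ℕ} (hF : IsAdmissible F N₀)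
    (hN : 11 ≤ N₀) : tauZeroSq F = ∫ u, cutDensity F u := by
  have hmr := hF.measurable_realDeriv 0
  obtain ⟨hI, hint⟩ := hF.integral_shell_zero hN
  let g : ℝ × ℝ → ℂ := fun q => (((1 - q.1 ^ 2) / √q.2 * realDeriv F 0 q.2 : ℝ) : ℂ)
  have hg : Measurable g := by fun_prop
  let e : Fin 3 → R3 := fun i => EuclideanSpace.single i 1
  have he : ∀ i, ‖e i‖ = 1 := fun i => by simp [e]
  have hi : ∀ i, ∫ v : R3, g (⟪e i, velocity v⟫, 1 + ‖v‖ ^ 2) = ∫ u, (cutDensity F u : ℂ) :=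
    fun i => (integral_shell (e i) (he i) hg).trans hI
  have hig : ∀ i, Integrable fun v : R3 => g (⟪e i, velocity v⟫, 1 + ‖v‖ ^ 2) :=
    fun i => (integrable_shell_iff (e i) (he i) hg).2 hint
  have hsum : ∫ v : R3, ∑ i, g (⟪e i, velocity v⟫, 1 + ‖v‖ ^ 2)
      = 3 * ∫ u, (cutDensity F u : ℂ) := by
    rw [integral_finsetSum _ fun i _ => hig i]
    simp [hi]
  have hpt : ∀ v : R3, ∑ i, g (⟪e i, velocity v⟫, 1 + ‖v‖ ^ 2)
      = 3 * (((1 + 2 / 3 * ‖v‖ ^ 2) / jap ‖v‖ ^ 3 * equilibrium F v : ℝ) : ℂ) := by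
    intro v
    have hs : ∑ i, ⟪e i, velocity v⟫ ^ 2 = 1 - 1 / (1 + ‖v‖ ^ 2) := by
      rw [← norm_velocity_sq, EuclideanSpace.real_norm_sq_eq]
      simp [e, EuclideanSpace.inner_single_left]
    have hj := jap_pos ‖v‖
    have hj2 := jap_sq ‖v‖
    have hreal : ∑ i, ((1 - ⟪e i, velocity v⟫ ^ 2) / jap ‖v‖ * realDeriv F 0 (1 + ‖v‖ ^ 2))
        = 3 * ((1 + 2 / 3 * ‖v‖ ^ 2) / jap ‖v‖ ^ 3 * equilibrium F v) := by
      rw [← Finset.sum_mul, ← Finset.sum_div, Finset.sum_sub_distrib, hs, equilibrium_eq, ← hj2]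
      have : ‖v‖ ^ 2 = jap ‖v‖ ^ 2 - 1 := by linarith
      rw [this]
      simp only [Finset.sum_const, Finset.card_univ, Fintype.card_fin]
      field_simp
      ring
    have := congrArg (fun r : ℝ => (r : ℂ)) hreal
    simp only [Complex.ofReal_sum, Complex.ofReal_mul 3] at this
    rw [Complex.ofReal_ofNat] at this
    exact this
  simp_rw [hpt] at hsum
  rw [integral_const_mul, integral_complex_ofReal, integral_complex_ofReal] at hsum
  have h3 := mul_left_cancel₀ (by norm_num : (3 : ℂ) ≠ 0) hsum
  exact_mod_cast h3

/-- The dispersion function in terms of a Cauchy-type integral on `[-1, 1]`. -/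
theorem IsAdmissible.magDispersion_eq {F : ℂ → ℂ} {N₀ : ℕ} (hF : IsAdmissible F N₀)
    (hN : 11 ≤ N₀) (hint : Integrable (cutDensity F)) {z : ℂ} (hz : 0 < z.re) (k : R3) :
    magDispersion F z k = z ^ 2 + (‖k‖ : ℂ) ^ 2
      + ∫ u, z / (z + Complex.I * (‖k‖ * u)) * (cutDensity F u : ℂ) := by
  have hz0 : z ≠ 0 := by rintro rfl; simp at hz
  have hden : ∀ r : ℝ, z + Complex.I * (r : ℂ) ≠ 0 := by
    intro r h
    have := congrArg Complex.re h
    simp at this; linarith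
  have hτ : (tauZeroSq F : ℂ) = ∫ u, (cutDensity F u : ℂ) := by
    rw [hF.tauZeroSq_eq hN, integral_complex_ofReal]
  rw [magDispersion, hτ]
  rcases eq_or_ne k 0 with rfl | hk
  · simp [hz0]
  have hκ : ‖k‖ ≠ 0 := norm_ne_zero_iff.2 hk
  let e : R3 := ‖k‖⁻¹ • k
  have he : ‖e‖ = 1 := by simp [e, norm_smul, hκ]
  have hke : k = ‖k‖ • e := by simp [e, smul_smul, hκ]
  set κ := ‖k‖
  let m : ℝ → ℂ := fun u => Complex.I * ((κ * u : ℝ) : ℂ) / (z + Complex.I * ((κ * u : ℝ) : ℂ))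
  have hm : Measurable m := by fun_prop
  have hmb : ∀ u, ‖m u‖ ≤ 1 + ‖z‖ / z.re := by
    intro u
    -- This form bounds the multiplier uniformly in `u`, since `|z + iκu| ≥ Re z`.
    have h1 : m u = 1 - z / (z + Complex.I * ((κ * u : ℝ) : ℂ)) := by
      have := hden (κ * u)
      simp only [m]
      rw [eq_sub_iff_add_eq, ← add_div, div_eq_one_iff_eq this]; ring
    rw [h1]
    refine (norm_sub_le _ _).trans ?_
    rw [norm_one, norm_div]
    gcongr
    refine le_trans (le_of_eq ?_) (Complex.re_le_norm _)
    simp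
  have hmr := hF.measurable_realDeriv 1
  have hI : ∫ v : R3, Complex.I * (⟪k, velocity v⟫ : ℝ) * ((‖transverse k (velocity v)‖ ^ 2 : ℝ) : ℂ)
      / (z + Complex.I * (⟪k, velocity v⟫ : ℝ)) * (deriv (profile F) (jap ‖v‖) : ℝ)
      = -2 * ∫ u, m u * (cutDensity F u : ℂ) := by
    rw [← hF.integral_shell_deriv hN hm hmb, ← integral_shell e he (g := fun q : ℝ × ℝ =>
      m q.1 * ((1 - q.1 ^ 2 - 1 / q.2 : ℝ) : ℂ) * ((realDeriv F 1 q.2 * (2 * √q.2) : ℝ) : ℂ))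
      (by fun_prop)]
    refine integral_congr_ae (ae_of_all _ fun v => ?_)
    simp only
    rw [hke, norm_transverse_sq hκ he, real_inner_smul_left, norm_velocity_sq,
      hF.deriv_profile (jap_pos _), jap_sq]
    simp only [m, jap]
    rw [sub_right_comm]
    ring
  rw [hI]
  have hmi : Integrable fun u => m u * (cutDensity F u : ℂ) :=
    hint.ofReal.bdd_mul hm.aestronglyMeasurable (ae_of_all _ hmb)
  -- The constant `τ₀² = ∫ W` absorbs the response term, because `1 - m(u) = z/(z + iκu)`.
  have hsub : ∫ u, z / (z + Complex.I * (κ * u)) * (cutDensity F u : ℂ)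
      = (∫ u, (cutDensity F u : ℂ)) - ∫ u, m u * (cutDensity F u : ℂ) := by
    have hintC : Integrable fun u => (cutDensity F u : ℂ) := hint.ofReal
    rw [← integral_sub hintC hmi]
    refine integral_congr_ae (ae_of_all _ fun u => ?_)
    have := hden (κ * u)
    simp only [m]
    push_cast at this ⊢
    rw [eq_sub_iff_add_eq, ← add_mul, ← add_div, div_self this, one_mul]
  rw [hsub]
  push_cast
  ring

/-! ### A symbol class in the variables `x = log |k|` and `σ = τ / |k|` -/

/-- The weight `(κ² + |σ|) / (1 + κ²)`, `κ = eˣ`. -/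
def lowWeight (x σ : ℝ) : ℝ := (Real.exp (2 * x) + |σ|) / (1 + Real.exp (2 * x))

/-- The scale on which symbols may vary in `σ`. -/
def scaleWeight (x σ : ℝ) : ℝ := (1 - σ ^ 2) * lowWeight x σ

theorem lowWeight_pos (x σ : ℝ) : 0 < lowWeight x σ := by unfold lowWeight; positivity

theorem abs_lt_one_of_mem {σ : ℝ} (hσ : σ ∈ Ioo (-1 : ℝ) 1) : |σ| < 1 := abs_lt.2 hσ

theorem lowWeight_le_one (x : ℝ) {σ : ℝ} (hσ : σ ∈ Ioo (-1 : ℝ) 1) : lowWeight x σ ≤ 1 := by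
  rw [lowWeight, div_le_one (by positivity)]
  linarith [abs_lt_one_of_mem hσ]

theorem abs_le_lowWeight (x : ℝ) {σ : ℝ} (hσ : σ ∈ Ioo (-1 : ℝ) 1) : |σ| ≤ lowWeight x σ := by
  rw [lowWeight, le_div_iff₀ (by positivity)]
  nlinarith [abs_lt_one_of_mem hσ, Real.exp_pos (2 * x)]

theorem scaleWeight_pos (x : ℝ) {σ : ℝ} (hσ : σ ∈ Ioo (-1 : ℝ) 1) : 0 < scaleWeight x σ :=
  mul_pos (one_sub_sq_pos hσ) (lowWeight_pos x σ)

theorem scaleWeight_le_one (x : ℝ) {σ : ℝ} (hσ : σ ∈ Ioo (-1 : ℝ) 1) : scaleWeight x σ ≤ 1 :=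
  mul_le_one₀ (one_sub_sq_le_one σ) (lowWeight_pos x σ).le (lowWeight_le_one x hσ)

/-- `f` is bounded by `w` on `ℝ × (-1, 1)`. -/
def WBound (w : ℝ → ℝ → ℝ) (f : ℝ → ℝ → ℂ) : Prop :=
  ∃ C : ℝ, 0 ≤ C ∧ ∀ x : ℝ, ∀ σ ∈ Ioo (-1 : ℝ) 1, ‖f x σ‖ ≤ C * w x σ

/-- Symbols of order `w` with `m` derivatives: each derivative in `σ` costs one factor
`scaleWeight`, derivatives in `x` are free. -/
def Sym : ℕ → (ℝ → ℝ → ℝ) → (ℝ → ℝ → ℂ) → Prop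
  | 0, w, f => WBound w f ∧ ∀ x, ContinuousOn (f x) (Ioo (-1 : ℝ) 1)
  | m + 1, w, f => WBound w f ∧ ∃ fx fσ : ℝ → ℝ → ℂ,
      (∀ x : ℝ, ∀ σ ∈ Ioo (-1 : ℝ) 1, HasDerivAt (fun y => f y σ) (fx x σ) x ∧
        HasDerivAt (f x) (fσ x σ) σ) ∧
      Sym m w fx ∧ Sym m (fun x σ => w x σ / scaleWeight x σ) fσ

theorem WBound.mono {w w' : ℝ → ℝ → ℝ} {f : ℝ → ℝ → ℂ} (hf : WBound w f) {K : ℝ} (hK : 0 ≤ K)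
    (h : ∀ x, ∀ σ ∈ Ioo (-1 : ℝ) 1, w x σ ≤ K * w' x σ) : WBound w' f := by
  obtain ⟨C, hC, hb⟩ := hf
  refine ⟨C * K, mul_nonneg hC hK, fun x σ hσ => (hb x σ hσ).trans ?_⟩
  rw [mul_assoc]
  exact mul_le_mul_of_nonneg_left (h x σ hσ) hC

theorem WBound.add {w : ℝ → ℝ → ℝ} {f g : ℝ → ℝ → ℂ} (hf : WBound w f) (hg : WBound w g) :
    WBound w (fun x σ => f x σ + g x σ) := by
  obtain ⟨C, hC, hb⟩ := hf
  obtain ⟨D, hD, hd⟩ := hg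
  refine ⟨C + D, add_nonneg hC hD, fun x σ hσ => (norm_add_le _ _).trans ?_⟩
  rw [add_mul]
  exact add_le_add (hb x σ hσ) (hd x σ hσ)

theorem WBound.mul {w w' : ℝ → ℝ → ℝ} {f g : ℝ → ℝ → ℂ} (hf : WBound w f) (hg : WBound w' g) :
    WBound (fun x σ => w x σ * w' x σ) (fun x σ => f x σ * g x σ) := by
  obtain ⟨C, hC, hb⟩ := hf
  obtain ⟨D, hD, hd⟩ := hg
  refine ⟨C * D, mul_nonneg hC hD, fun x σ hσ => ?_⟩
  rw [norm_mul, mul_mul_mul_comm]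
  exact mul_le_mul (hb x σ hσ) (hd x σ hσ) (norm_nonneg _) ((norm_nonneg _).trans (hb x σ hσ))

namespace Sym

theorem bound : ∀ {m : ℕ} {w : ℝ → ℝ → ℝ} {f : ℝ → ℝ → ℂ}, Sym m w f → WBound w f
  | 0, _, _, h => h.1
  | _ + 1, _, _, h => h.1

theorem continuousOn : ∀ {m : ℕ} {w : ℝ → ℝ → ℝ} {f : ℝ → ℝ → ℂ}, Sym m w f →
    ∀ x, ContinuousOn (f x) (Ioo (-1 : ℝ) 1)
  | 0, _, _, h, x => h.2 x
  | _ + 1, _, _, ⟨_, _, _, h, _⟩, x => fun σ hσ =>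
    (h x σ hσ).2.continuousAt.continuousWithinAt

theorem of_succ : ∀ {m : ℕ} {w : ℝ → ℝ → ℝ} {f : ℝ → ℝ → ℂ}, Sym (m + 1) w f → Sym m w f
  | 0, _, _, h => ⟨h.bound, h.continuousOn⟩
  | _ + 1, _, _, ⟨hb, fx, fσ, hd, hx, hσ⟩ => ⟨hb, fx, fσ, hd, hx.of_succ, hσ.of_succ⟩

theorem mono : ∀ {m : ℕ} {w w' : ℝ → ℝ → ℝ} {f : ℝ → ℝ → ℂ}, Sym m w f → ∀ {K : ℝ}, 0 ≤ K →
    (∀ x, ∀ σ ∈ Ioo (-1 : ℝ) 1, w x σ ≤ K * w' x σ) → Sym m w' f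
  | 0, _, _, _, hf, _, hK, h => ⟨hf.1.mono hK h, hf.2⟩
  | _ + 1, _, _, _, ⟨hb, fx, fσ, hd, hx, hσ⟩, _, hK, h =>
    ⟨hb.mono hK h, fx, fσ, hd, hx.mono hK h, hσ.mono hK fun x σ hmem => by
      rw [← mul_div_assoc]
      exact div_le_div_of_nonneg_right (h x σ hmem) (scaleWeight_pos x hmem).le⟩

theorem mono' {m : ℕ} {w w' : ℝ → ℝ → ℝ} {f : ℝ → ℝ → ℂ} (hf : Sym m w f)
    (h : ∀ x, ∀ σ ∈ Ioo (-1 : ℝ) 1, w x σ ≤ w' x σ) : Sym m w' f :=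
  hf.mono zero_le_one fun x σ hσ => by rw [one_mul]; exact h x σ hσ

theorem congr : ∀ {m : ℕ} {w : ℝ → ℝ → ℝ} {f g : ℝ → ℝ → ℂ}, Sym m w f →
    (∀ x, ∀ σ ∈ Ioo (-1 : ℝ) 1, f x σ = g x σ) → Sym m w g
  | 0, _, _, _, ⟨⟨C, hC, hb⟩, hc⟩, h =>
    ⟨⟨C, hC, fun x σ hσ => h x σ hσ ▸ hb x σ hσ⟩, fun x => (hc x).congr fun σ hσ => (h x σ hσ).symm⟩
  | _ + 1, _, f, g, ⟨⟨C, hC, hb⟩, fx, fσ, hd, hx, hs⟩, h =>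
    ⟨⟨C, hC, fun x σ hσ => h x σ hσ ▸ hb x σ hσ⟩, fx, fσ, fun x σ hσ =>
      ⟨by
        have : (fun y => g y σ) = fun y => f y σ := funext fun y => (h y σ hσ).symm
        rw [this]; exact (hd x σ hσ).1,
       (hd x σ hσ).2.congr_of_eventuallyEq (by
        filter_upwards [isOpen_Ioo.mem_nhds hσ] with s hs' using (h x s hs').symm)⟩, hx, hs⟩

theorem add : ∀ {m : ℕ} {w : ℝ → ℝ → ℝ} {f g : ℝ → ℝ → ℂ}, Sym m w f → Sym m w g →
    Sym m w (fun x σ => f x σ + g x σ)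
  | 0, _, _, _, hf, hg => ⟨hf.1.add hg.1, fun x => (hf.2 x).add (hg.2 x)⟩
  | _ + 1, _, _, _, ⟨hb, fx, fσ, hd, hx, hσ⟩, ⟨hb', gx, gσ, hd', hx', hσ'⟩ =>
    ⟨hb.add hb', fun x σ => fx x σ + gx x σ, fun x σ => fσ x σ + gσ x σ, fun x σ h =>
      ⟨(hd x σ h).1.add (hd' x σ h).1, (hd x σ h).2.add (hd' x σ h).2⟩, hx.add hx', hσ.add hσ'⟩

theorem mul : ∀ {m : ℕ} {w w' : ℝ → ℝ → ℝ} {f g : ℝ → ℝ → ℂ}, Sym m w f → Sym m w' g →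
    Sym m (fun x σ => w x σ * w' x σ) (fun x σ => f x σ * g x σ)
  | 0, _, _, _, _, hf, hg => ⟨hf.1.mul hg.1, fun x => (hf.2 x).mul (hg.2 x)⟩
  | _ + 1, _, _, f, g, hf@⟨hb, fx, fσ, hd, hx, hσ⟩, hg@⟨hb', gx, gσ, hd', hx', hσ'⟩ =>
    ⟨hb.mul hb', fun x σ => fx x σ * g x σ + f x σ * gx x σ,
      fun x σ => fσ x σ * g x σ + f x σ * gσ x σ, fun x σ h =>
      ⟨(hd x σ h).1.mul (hd' x σ h).1, (hd x σ h).2.mul (hd' x σ h).2⟩,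
      (hx.mul hg.of_succ).add (hf.of_succ.mul hx'),
      ((hσ.mul hg.of_succ).mono' fun x σ _ => le_of_eq (by ring)).add
        ((hf.of_succ.mul hσ').mono' fun x σ _ => le_of_eq (by ring))⟩

theorem zero : ∀ (m : ℕ) (w : ℝ → ℝ → ℝ), Sym m w (fun _ _ => 0)
  | 0, _ => ⟨⟨0, le_rfl, fun _ _ _ => by simp⟩, fun _ => continuousOn_const⟩
  | m + 1, _ => ⟨⟨0, le_rfl, fun _ _ _ => by simp⟩, fun _ _ => 0, fun _ _ => 0,
      fun _ _ _ => ⟨hasDerivAt_const _ _, hasDerivAt_const _ _⟩, zero m _, zero m _⟩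

theorem const : ∀ (m : ℕ) (c : ℂ), Sym m (fun _ _ => 1) (fun _ _ => c)
  | 0, c => ⟨⟨‖c‖, norm_nonneg _, fun _ _ _ => by simp⟩, fun _ => continuousOn_const⟩
  | m + 1, c => ⟨⟨‖c‖, norm_nonneg _, fun _ _ _ => by simp⟩, fun _ _ => 0, fun _ _ => 0,
      fun _ _ _ => ⟨hasDerivAt_const _ _, hasDerivAt_const _ _⟩, zero m _, zero m _⟩

theorem const_mul {m : ℕ} {w : ℝ → ℝ → ℝ} {f : ℝ → ℝ → ℂ} (c : ℂ) (hf : Sym m w f) :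
    Sym m w (fun x σ => c * f x σ) :=
  ((const m c).mul hf).mono' fun _ _ _ => (one_mul _).le

theorem conj : ∀ {m : ℕ} {w : ℝ → ℝ → ℝ} {f : ℝ → ℝ → ℂ}, Sym m w f →
    Sym m w (fun x σ => (starRingEnd ℂ) (f x σ))
  | 0, _, _, ⟨⟨C, hC, hb⟩, hc⟩ =>
    ⟨⟨C, hC, fun x σ hσ => by rw [Complex.norm_conj]; exact hb x σ hσ⟩,
      fun x => Complex.continuous_conj.comp_continuousOn (hc x)⟩
  | _ + 1, _, f, ⟨⟨C, hC, hb⟩, fx, fσ, hd, hx, hs⟩ =>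
    ⟨⟨C, hC, fun x σ hσ => by rw [Complex.norm_conj]; exact hb x σ hσ⟩,
      fun x σ => (starRingEnd ℂ) (fx x σ), fun x σ => (starRingEnd ℂ) (fσ x σ), fun x σ h =>
      ⟨(Complex.conjCLE : ℂ →L[ℝ] ℂ).hasFDerivAt.comp_hasDerivAt x (hd x σ h).1,
        (Complex.conjCLE : ℂ →L[ℝ] ℂ).hasFDerivAt.comp_hasDerivAt σ (hd x σ h).2⟩,
      hx.conj, hs.conj⟩

/-- Induction through `(1/f)' = -f'·f⁻¹·f⁻¹`, in which the lower-order statement already makes `f⁻¹`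
a symbol. -/
theorem inv : ∀ {m : ℕ} {w : ℝ → ℝ → ℝ} {f : ℝ → ℝ → ℂ}, Sym m w f → ∀ {c : ℝ}, 0 < c →
    (∀ x, ∀ σ ∈ Ioo (-1 : ℝ) 1, 0 < w x σ) → (∀ x, ∀ σ ∈ Ioo (-1 : ℝ) 1, c * w x σ ≤ ‖f x σ‖) →
    Sym m (fun x σ => (w x σ)⁻¹) (fun x σ => (f x σ)⁻¹) := by
  intro m w f hf c hc hw hlow
  have hne : ∀ x, ∀ σ ∈ Ioo (-1 : ℝ) 1, f x σ ≠ 0 := fun x σ hσ =>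
    norm_pos_iff.1 ((mul_pos hc (hw x σ hσ)).trans_le (hlow x σ hσ))
  have hb : WBound (fun x σ => (w x σ)⁻¹) (fun x σ => (f x σ)⁻¹) := by
    refine ⟨c⁻¹, (inv_pos.2 hc).le, fun x σ hσ => ?_⟩
    rw [norm_inv, ← mul_inv]
    exact inv_anti₀ (mul_pos hc (hw x σ hσ)) (hlow x σ hσ)
  induction m with
  | zero => exact ⟨hb, fun x => (hf.2 x).inv₀ fun σ hσ => hne x σ hσ⟩
  | succ m ih =>
    have ih' := ih hf.of_succ
    obtain ⟨_, fx, fσ, hd, hx, hs⟩ := hf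
    refine ⟨hb, fun x σ => -1 * (fx x σ * ((f x σ)⁻¹ * (f x σ)⁻¹)),
      fun x σ => -1 * (fσ x σ * ((f x σ)⁻¹ * (f x σ)⁻¹)), fun x σ h => ⟨?_, ?_⟩, ?_, ?_⟩
    · refine ((hd x σ h).1.fun_inv (hne x σ h)).congr_deriv ?_
      have := hne x σ h
      field_simp
    · refine ((hd x σ h).2.inv (hne x σ h)).congr_deriv ?_
      have := hne x σ h
      field_simp
    · refine (const_mul (-1) (hx.mul (ih'.mul ih'))).mono' fun x σ h => le_of_eq ?_
      have := (hw x σ h).ne'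
      field_simp
    · refine (const_mul (-1) (hs.mul (ih'.mul ih'))).mono' fun x σ h => le_of_eq ?_
      have := (hw x σ h).ne'
      field_simp

/-- Where `h` does not vanish one has `lowWeight ≥ |σ| ≥ c`, so any power of `lowWeight` may be
inserted at the price of a constant. For `L = 0` there is nothing to insert and no vanishing is
required. -/
theorem of_contDiff : ∀ {m : ℕ} {h : ℝ → ℂ}, ContDiff ℝ m h →
    ∀ (c : ℝ) (L : ℕ), 0 < c → (L ≠ 0 → ∀ σ, |σ| < c → h σ = 0) →
    Sym m (fun x σ => lowWeight x σ ^ L) (fun _ σ => h σ) := by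
  intro m
  have hb : ∀ {h : ℝ → ℂ}, Continuous h → ∀ (c : ℝ) (L : ℕ), 0 < c →
      (L ≠ 0 → ∀ σ, |σ| < c → h σ = 0) →
      WBound (fun x σ => lowWeight x σ ^ L) (fun _ σ => h σ) := by
    intro h hh c L hc hz
    obtain ⟨C, hC⟩ := (isCompact_Icc (a := (-1 : ℝ)) (b := 1)).exists_bound_of_continuousOn
      hh.continuousOn
    have hC0 : 0 ≤ C := (norm_nonneg _).trans (hC 0 (by simp))
    refine ⟨C * (c⁻¹) ^ L, by positivity, fun x σ hσ => ?_⟩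
    have hCσ := hC σ (Ioo_subset_Icc_self hσ)
    rcases eq_or_ne L 0 with rfl | hL
    · simpa using hCσ
    rcases lt_or_ge |σ| c with hσc | hσc
    · simp only
      rw [hz hL σ hσc, norm_zero]
      have := lowWeight_pos x σ
      positivity
    · refine hCσ.trans ?_
      rw [mul_assoc, ← mul_pow]
      refine le_mul_of_one_le_right hC0 (one_le_pow₀ ?_)
      rw [inv_mul_eq_div, one_le_div hc]
      exact hσc.trans (abs_le_lowWeight x hσ)
  induction m with
  | zero =>
    intro h hh c L hc hz
    exact ⟨hb hh.continuous c L hc hz, fun _ => hh.continuous.continuousOn⟩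
  | succ m ih =>
    intro h hh c L hc hz
    have hh' : ContDiff ℝ m (deriv h) :=
      (contDiff_succ_iff_deriv.1 (by exact_mod_cast hh)).2.2
    refine ⟨hb hh.continuous c L hc hz, fun _ _ => 0, fun _ σ => deriv h σ, fun x σ _ =>
      ⟨hasDerivAt_const _ _, ((hh.differentiable (by simp)) σ).hasDerivAt⟩, zero _ _, ?_⟩
    refine (ih hh' c L hc fun hL σ hσ => ?_).mono' fun x σ hσ => ?_
    · have : h =ᶠ[𝓝 σ] fun _ => 0 := by
        filter_upwards [(isOpen_lt continuous_abs continuous_const).mem_nhds hσ] with s hs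
          using hz hL s hs
      rw [this.deriv_eq]; simp
    · exact le_div_self (pow_nonneg (lowWeight_pos x σ).le _) (scaleWeight_pos x hσ)
        (scaleWeight_le_one x hσ)

/-- As `x`-derivatives are free, a function of `x` alone needs the same bound on all its
derivatives. They are passed as a sequence so that the induction can shift it. -/
theorem of_fst {w : ℝ → ℝ → ℝ} : ∀ {m : ℕ} {h : ℕ → ℝ → ℂ},
    (∀ j x, HasDerivAt (h j) (h (j + 1) x) x) → (∀ j, WBound w (fun x _ => h j x)) →
    Sym m w (fun x _ => h 0 x)
  | 0, _, _, hb => ⟨hb 0, fun _ => continuousOn_const⟩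
  | _ + 1, h, hd, hb => ⟨hb 0, fun x _ => h 1 x, fun _ _ => 0, fun x _ _ =>
      ⟨hd 0 x, hasDerivAt_const _ _⟩,
      of_fst (h := fun j => h (j + 1)) (fun j x => hd (j + 1) x) (fun j => hb (j + 1)), zero _ _⟩

theorem exp (m : ℕ) : Sym m (fun x _ => Real.exp (2 * x)) (fun x _ => (Real.exp (2 * x) : ℂ)) := by
  have := of_fst (m := m) (w := fun x _ => Real.exp (2 * x))
    (h := fun j x => (2 : ℂ) ^ j * (Real.exp (2 * x) : ℂ)) ?_ ?_
  · simpa using this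
  · intro j x
    have : HasDerivAt (fun x : ℝ => Real.exp (2 * x)) (Real.exp (2 * x) * 2) x := by
      simpa using ((hasDerivAt_id x).const_mul 2).exp
    refine (this.ofReal_comp.const_mul ((2 : ℂ) ^ j)).congr_deriv ?_
    push_cast; ring
  · intro j
    refine ⟨2 ^ j, by positivity, fun x σ _ => ?_⟩
    rw [norm_mul, norm_pow, Complex.norm_real, Real.norm_eq_abs, Real.abs_exp]
    simp

/-- `σ` gains a factor `lowWeight`. -/
theorem snd (m : ℕ) : Sym m lowWeight (fun _ σ => (σ : ℂ)) := by
  have hb : WBound lowWeight (fun _ σ => (σ : ℂ)) :=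
    ⟨1, zero_le_one, fun x σ hσ => by
      rw [Complex.norm_real, Real.norm_eq_abs, one_mul]; exact abs_le_lowWeight x hσ⟩
  cases m with
  | zero => exact ⟨hb, fun _ => Complex.continuous_ofReal.continuousOn⟩
  | succ m =>
    refine ⟨hb, fun _ _ => 0, fun _ _ => 1, fun x σ _ =>
      ⟨hasDerivAt_const _ _, (hasDerivAt_id σ).ofReal_comp⟩, zero _ _,
      (const m 1).mono' fun x σ hσ => ?_⟩
    have := one_sub_sq_pos hσ
    have hl := lowWeight_pos x σ
    rw [scaleWeight, one_le_div (by positivity)]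
    exact mul_le_of_le_one_left hl.le (one_sub_sq_le_one σ)

theorem one_sub_sq (m : ℕ) :
    Sym m (fun _ σ => 1 - σ ^ 2) (fun _ σ => ((1 - σ ^ 2 : ℝ) : ℂ)) := by
  have hb : WBound (fun _ σ => 1 - σ ^ 2) (fun _ σ => ((1 - σ ^ 2 : ℝ) : ℂ)) :=
    ⟨1, zero_le_one, fun x σ hσ => by
      rw [Complex.norm_real, Real.norm_eq_abs, one_mul, abs_of_pos (one_sub_sq_pos hσ)]⟩
  cases m with
  | zero => exact ⟨hb, fun _ => by fun_prop⟩
  | succ m =>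
    refine ⟨hb, fun _ _ => 0, fun _ σ => -2 * (σ : ℂ), fun x σ _ =>
      ⟨hasDerivAt_const _ _, ?_⟩, zero _ _,
      (const_mul (-2) (snd m)).mono' fun x σ hσ => ?_⟩
    · have : HasDerivAt (fun σ : ℝ => 1 - σ ^ 2) (-(2 * σ)) σ := by
        simpa using (hasDerivAt_pow 2 σ).const_sub 1
      refine this.ofReal_comp.congr_deriv ?_
      push_cast; ring
    · have := one_sub_sq_pos hσ
      have hl := lowWeight_pos x σ
      have h1 := lowWeight_le_one x hσ
      rw [scaleWeight, le_div_iff₀ (by positivity)]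
      nlinarith [mul_nonneg this.le (mul_nonneg hl.le (sub_nonneg.2 h1)),
        mul_nonneg this.le (sub_nonneg.2 h1)]

theorem one_sub_sq_inv (m : ℕ) :
    Sym m (fun _ σ => (1 - σ ^ 2)⁻¹) (fun _ σ => (((1 - σ ^ 2 : ℝ) : ℂ))⁻¹) :=
  (one_sub_sq m).inv one_pos (fun _ _ hσ => one_sub_sq_pos hσ) fun x σ hσ => by
    rw [Complex.norm_real, Real.norm_eq_abs, one_mul, abs_of_pos (one_sub_sq_pos hσ)]

end Sym

/-! ### Extension by zero from `(-1, 1)` -/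

/-- Quadratic vanishing at the endpoints makes the extension by zero differentiable there: for `|σ|
≥ 1` and `|s| < 1` one has `1 - s² ≤ 2|s - σ|`, so the extension is `O(|s-σ|²)` at `σ`. -/
theorem hasDerivAt_indicator_Ioo {g : ℝ → ℂ} {g' : ℝ → ℂ} {C : ℝ}
    (hd : ∀ σ ∈ Ioo (-1 : ℝ) 1, HasDerivAt g (g' σ) σ)
    (hb : ∀ σ ∈ Ioo (-1 : ℝ) 1, ‖g σ‖ ≤ C * (1 - σ ^ 2) ^ 2) (σ : ℝ) :
    HasDerivAt ((Ioo (-1 : ℝ) 1).indicator g) ((Ioo (-1 : ℝ) 1).indicator g' σ) σ := by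
  by_cases hσ : σ ∈ Ioo (-1 : ℝ) 1
  · rw [indicator_of_mem hσ]
    refine (hd σ hσ).congr_of_eventuallyEq ?_
    filter_upwards [isOpen_Ioo.mem_nhds hσ] with s hs using indicator_of_mem hs _
  rw [indicator_of_notMem hσ]
  have hC : 0 ≤ C := by
    have := (norm_nonneg _).trans (hb 0 (by norm_num))
    simpa using this
  have h1 : 1 ≤ |σ| := by
    by_contra h
    exact hσ (abs_lt.1 (not_le.1 h))
  have hO : (Ioo (-1 : ℝ) 1).indicator g =O[𝓝 σ] fun s => ‖s - σ‖ ^ 2 := by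
    refine Asymptotics.IsBigO.of_bound (4 * C) (Eventually.of_forall fun s => ?_)
    by_cases hs : s ∈ Ioo (-1 : ℝ) 1
    · rw [indicator_of_mem hs]
      refine (hb s hs).trans ?_
      have hp := one_sub_sq_pos hs
      have hle : 1 - s ^ 2 ≤ 2 * |s - σ| := by
        have h2 : |σ| - |s| ≤ |s - σ| := by rw [abs_sub_comm]; exact abs_sub_abs_le_abs_sub σ s
        have h3 := abs_lt.2 hs
        have h4 : 1 - s ^ 2 = (1 - |s|) * (1 + |s|) := by rw [← sq_abs]; ring
        rw [h4]
        nlinarith [abs_nonneg s]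
      rw [Real.norm_eq_abs, Real.norm_eq_abs, abs_pow, abs_abs]
      calc C * (1 - s ^ 2) ^ 2 ≤ C * (2 * |s - σ|) ^ 2 := by gcongr
        _ = _ := by ring
    · rw [indicator_of_notMem hs, norm_zero]; positivity
  have hF := hO.hasFDerivAt (𝕜 := ℝ) (by norm_num : 1 < 2)
  have := hF.hasDerivAt
  simpa using this

theorem continuous_indicator_Ioo {g : ℝ → ℂ} {C : ℝ} (hc : ContinuousOn g (Ioo (-1 : ℝ) 1))
    (hb : ∀ σ ∈ Ioo (-1 : ℝ) 1, ‖g σ‖ ≤ C * (1 - σ ^ 2)) :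
    Continuous ((Ioo (-1 : ℝ) 1).indicator g) := by
  rw [continuous_iff_continuousAt]
  intro σ
  by_cases hσ : σ ∈ Ioo (-1 : ℝ) 1
  · refine (hc.continuousAt (isOpen_Ioo.mem_nhds hσ)).congr ?_
    filter_upwards [isOpen_Ioo.mem_nhds hσ] with s hs using (indicator_of_mem hs _).symm
  have hC : 0 ≤ C := by
    have := (norm_nonneg _).trans (hb 0 (by norm_num))
    simpa using this
  rw [ContinuousAt, indicator_of_notMem hσ]
  have hz : Tendsto (fun s : ℝ => C * max 0 (1 - s ^ 2)) (𝓝 σ) (𝓝 0) := by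
    have hcont : Continuous fun s : ℝ => C * max 0 (1 - s ^ 2) := by fun_prop
    have h0 : C * max 0 (1 - σ ^ 2) = 0 := by
      have : 1 - σ ^ 2 ≤ 0 := by
        by_contra h
        exact hσ (abs_lt.1 ((sq_lt_one_iff_abs_lt_one σ).1 (by linarith)))
      rw [max_eq_left this, mul_zero]
    have := hcont.tendsto σ
    rwa [h0] at this
  refine squeeze_zero_norm (fun s => ?_) hz
  by_cases hs : s ∈ Ioo (-1 : ℝ) 1
  · rw [indicator_of_mem hs]
    exact (hb s hs).trans (mul_le_mul_of_nonneg_left (le_max_right _ _) hC)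
  · rw [indicator_of_notMem hs, norm_zero]; positivity

/-- The symbol is frozen at `x = 0`, where each `σ`-derivative costs only one factor `1 - σ²`. A
weight with more than `m` such factors therefore survives `m` derivatives and still vanishes at
`±1`. -/
theorem Sym.contDiff_indicator : ∀ {m : ℕ} {w : ℝ → ℝ → ℝ} {f : ℝ → ℝ → ℂ}, Sym m w f →
    ∀ {a : ℕ}, m + 1 ≤ a → ∀ {K : ℝ}, 0 ≤ K →
    (∀ σ ∈ Ioo (-1 : ℝ) 1, w 0 σ ≤ K * (1 - σ ^ 2) ^ a) →
    ContDiff ℝ m ((Ioo (-1 : ℝ) 1).indicator (f 0)) := by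
  intro m
  have hpow : ∀ {a b : ℕ}, a ≤ b → ∀ {σ : ℝ}, σ ∈ Ioo (-1 : ℝ) 1 →
      (1 - σ ^ 2) ^ b ≤ (1 - σ ^ 2) ^ a := fun hab σ hσ =>
    pow_le_pow_of_le_one (one_sub_sq_pos hσ).le (one_sub_sq_le_one σ) hab
  induction m with
  | zero =>
    intro w f hf a ha K hK hw
    obtain ⟨C, hC, hb⟩ := hf.bound
    refine contDiff_zero.2 (continuous_indicator_Ioo (hf.continuousOn 0) (C := C * K) ?_)
    intro σ hσ
    refine (hb 0 σ hσ).trans ?_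
    rw [mul_assoc]
    refine mul_le_mul_of_nonneg_left ((hw σ hσ).trans ?_) hC
    refine mul_le_mul_of_nonneg_left ?_ hK
    simpa using hpow ha hσ
  | succ m ih =>
    intro w f hf a ha K hK hw
    obtain ⟨⟨C, hC, hb⟩, fx, fσ, hd, hx, hs⟩ := hf
    have hder : ∀ σ, HasDerivAt ((Ioo (-1 : ℝ) 1).indicator (f 0))
        ((Ioo (-1 : ℝ) 1).indicator (fσ 0) σ) σ := by
      refine hasDerivAt_indicator_Ioo (C := C * K) (fun σ hσ => (hd 0 σ hσ).2) fun σ hσ => ?_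
      refine (hb 0 σ hσ).trans ?_
      rw [mul_assoc]
      refine mul_le_mul_of_nonneg_left ((hw σ hσ).trans ?_) hC
      exact mul_le_mul_of_nonneg_left (hpow (by omega) hσ) hK
    have hdeq : deriv ((Ioo (-1 : ℝ) 1).indicator (f 0)) = (Ioo (-1 : ℝ) 1).indicator (fσ 0) :=
      funext fun σ => (hder σ).deriv
    have : ContDiff ℝ ((m : WithTop ℕ∞) + 1) ((Ioo (-1 : ℝ) 1).indicator (f 0)) := by
      refine contDiff_succ_iff_deriv.2 ⟨fun σ => (hder σ).differentiableAt, by simp, ?_⟩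
      rw [hdeq]
      obtain ⟨b, rfl⟩ : ∃ b, a = b + 1 := ⟨a - 1, by omega⟩
      refine ih hs (a := b) (by omega) (K := K * 2) (by positivity) fun σ hσ => ?_
      have hp := one_sub_sq_pos hσ
      have hl : 1 / 2 ≤ lowWeight 0 σ := by
        rw [lowWeight, mul_zero, Real.exp_zero]
        have := abs_nonneg σ
        linarith
      have hsw : (1 - σ ^ 2) / 2 ≤ scaleWeight 0 σ := by
        rw [scaleWeight]; nlinarith
      rw [div_le_iff₀ (scaleWeight_pos 0 hσ)]
      calc w 0 σ ≤ K * (1 - σ ^ 2) ^ (b + 1) := hw σ hσ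
        _ = K * 2 * (1 - σ ^ 2) ^ b * ((1 - σ ^ 2) / 2) := by ring
        _ ≤ _ := by gcongr
    exact_mod_cast this

/-! ### Regularity of the density -/

theorem rpow_inv_le_pow {c : ℝ} (hc : 0 < c) (hc1 : c ≤ 1) {a : ℝ} {K : ℕ} (h : (K : ℝ) ≤ a) :
    (1 / c) ^ (-a) ≤ c ^ K := by
  rw [one_div, Real.inv_rpow hc.le, Real.rpow_neg hc.le, inv_inv, ← Real.rpow_natCast]
  exact Real.rpow_le_rpow_of_exponent_ge hc hc1 h

/-- The chain rule for `σ ↦ 1/(1-σ²)` produces `(1-σ²)⁻²`, while one more derivative of `F` gains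
`1-σ²`. The net loss is one factor `1-σ²`, which is within the allowance of the symbol class. -/
theorem IsAdmissible.sym_realDeriv {F : ℂ → ℂ} {N₀ : ℕ} (hF : IsAdmissible F N₀) {K : ℕ}
    (hK : 2 * K ≤ N₀) (m : ℕ) : ∀ j : ℕ,
    Sym m (fun _ σ => (1 - σ ^ 2) ^ (K + j)) (fun _ σ => (realDeriv F j (1 / (1 - σ ^ 2)) : ℂ)) := by
  have hK' : (K : ℝ) ≤ (N₀ : ℝ) / 2 := by
    rw [le_div_iff₀ two_pos]; exact_mod_cast (by omega : K * 2 ≤ N₀)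
  have hb : ∀ j, WBound (fun _ σ => (1 - σ ^ 2) ^ (K + j))
      (fun _ σ => (realDeriv F j (1 / (1 - σ ^ 2)) : ℂ)) := by
    intro j
    obtain ⟨C, hC0, hC⟩ := hF.exists_abs_realDeriv_le j
    refine ⟨C, hC0, fun x σ hσ => ?_⟩
    have hc := one_sub_sq_pos hσ
    rw [Complex.norm_real, Real.norm_eq_abs]
    refine (hC _ (by positivity)).trans (mul_le_mul_of_nonneg_left ?_ hC0)
    rw [show -((N₀ : ℝ) / 2) - (j : ℝ) = -((N₀ : ℝ) / 2 + j) by ring]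
    exact rpow_inv_le_pow hc (one_sub_sq_le_one σ) (by push_cast; linarith)
  have hd : ∀ j, ∀ σ ∈ Ioo (-1 : ℝ) 1, HasDerivAt (fun s : ℝ => (realDeriv F j (1 / (1 - s ^ 2)) : ℂ))
      ((realDeriv F (j + 1) (1 / (1 - σ ^ 2)) : ℂ) * (2 * ((σ : ℂ) *
        ((((1 - σ ^ 2 : ℝ) : ℂ))⁻¹ * (((1 - σ ^ 2 : ℝ) : ℂ))⁻¹)))) σ := by
    intro j σ hσ
    have hc := one_sub_sq_pos hσ
    have h1 : HasDerivAt (fun s : ℝ => 1 / (1 - s ^ 2)) (2 * σ * ((1 - σ ^ 2)⁻¹ * (1 - σ ^ 2)⁻¹)) σ := by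
      have : HasDerivAt (fun σ : ℝ => 1 - σ ^ 2) (-(2 * σ)) σ := by
        simpa using (hasDerivAt_pow 2 σ).const_sub 1
      refine (this.fun_inv hc.ne').congr_of_eventuallyEq (by simp [one_div]) |>.congr_deriv ?_
      field_simp
    have := ((hF.hasDerivAt_realDeriv j (x := 1 / (1 - σ ^ 2)) (by positivity)).comp σ h1).ofReal_comp
    refine this.congr_deriv ?_
    push_cast; ring
  induction m with
  | zero => exact fun j => ⟨hb j, fun x σ hσ => (hd j σ hσ).continuousAt.continuousWithinAt⟩
  | succ m ih =>
    intro j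
    refine ⟨hb j, fun _ _ => 0, _, fun x σ hσ => ⟨hasDerivAt_const _ _, hd j σ hσ⟩, Sym.zero _ _, ?_⟩
    have h1 := (ih (j + 1)).mul (Sym.const_mul 2 ((Sym.snd m).mul
      ((Sym.one_sub_sq_inv m).mul (Sym.one_sub_sq_inv m))))
    refine h1.mono' fun x σ hσ => ?_
    have hc := one_sub_sq_pos hσ
    have hl := lowWeight_pos x σ
    have hl1 := lowWeight_le_one x hσ
    rw [scaleWeight, le_div_iff₀ (by positivity), ← add_assoc, pow_succ]
    calc _ = (1 - σ ^ 2) ^ (K + j) * (lowWeight x σ * lowWeight x σ) := by field_simp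
      _ ≤ (1 - σ ^ 2) ^ (K + j) * 1 := by
          gcongr
          exact mul_le_one₀ hl1 hl.le hl1
      _ = _ := mul_one _

/-- Integrating `F` once loses one power of `1-σ²`; the explicit prefactor of `W` restores it, so
`W` vanishes to the same order as `F(1/(1-σ²))`. -/
theorem IsAdmissible.sym_cutDensity {F : ℂ → ℂ} {N₀ : ℕ} (hF : IsAdmissible F N₀) (hN : 11 ≤ N₀)
    {K : ℕ} (hK1 : 1 ≤ K) (hK : 2 * K ≤ N₀) (m : ℕ) :
    Sym m (fun _ σ => (1 - σ ^ 2) ^ K) (fun _ σ => (cutDensity F σ : ℂ)) := by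
  obtain ⟨k, rfl⟩ : ∃ k, K = k + 1 := ⟨K - 1, by omega⟩
  have hK' : ((k + 1 : ℕ) : ℝ) ≤ (N₀ : ℝ) / 2 := by
    rw [le_div_iff₀ two_pos]; exact_mod_cast (by omega : (k + 1) * 2 ≤ N₀)
  push_cast at hK'
  have htail : Sym m (fun _ σ => (1 - σ ^ 2) ^ k) (fun _ σ => (tail F (1 / (1 - σ ^ 2)) : ℂ)) := by
    have hb : WBound (fun _ σ => (1 - σ ^ 2) ^ k) (fun _ σ => (tail F (1 / (1 - σ ^ 2)) : ℂ)) := by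
      obtain ⟨C, hC0, hC⟩ := hF.exists_abs_tail_le hN
      refine ⟨C, hC0, fun x σ hσ => ?_⟩
      have hc := one_sub_sq_pos hσ
      rw [Complex.norm_real, Real.norm_eq_abs]
      refine (hC _ (by positivity)).trans (mul_le_mul_of_nonneg_left ?_ hC0)
      rw [show 1 - (N₀ : ℝ) / 2 = -((N₀ : ℝ) / 2 - 1) by ring]
      exact rpow_inv_le_pow hc (one_sub_sq_le_one σ) (by linarith)
    have hd : ∀ σ ∈ Ioo (-1 : ℝ) 1, HasDerivAt (fun s : ℝ => (tail F (1 / (1 - s ^ 2)) : ℂ))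
        ((realDeriv F 0 (1 / (1 - σ ^ 2)) : ℂ) * (-2 * ((σ : ℂ) *
          ((((1 - σ ^ 2 : ℝ) : ℂ))⁻¹ * (((1 - σ ^ 2 : ℝ) : ℂ))⁻¹)))) σ := by
      intro σ hσ
      have hc := one_sub_sq_pos hσ
      have h1 : HasDerivAt (fun s : ℝ => 1 / (1 - s ^ 2))
          (2 * σ * ((1 - σ ^ 2)⁻¹ * (1 - σ ^ 2)⁻¹)) σ := by
        have : HasDerivAt (fun σ : ℝ => 1 - σ ^ 2) (-(2 * σ)) σ := by
          simpa using (hasDerivAt_pow 2 σ).const_sub 1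
        refine (this.fun_inv hc.ne').congr_of_eventuallyEq (by simp [one_div]) |>.congr_deriv ?_
        field_simp
      have := ((hF.hasDerivAt_tail hN (x := 1 / (1 - σ ^ 2)) (by positivity)).comp σ h1).ofReal_comp
      refine this.congr_deriv ?_
      push_cast; ring
    cases m with
    | zero => exact ⟨hb, fun x σ hσ => (hd σ hσ).continuousAt.continuousWithinAt⟩
    | succ m =>
      refine ⟨hb, fun _ _ => 0, _, fun x σ hσ => ⟨hasDerivAt_const _ _, hd σ hσ⟩, Sym.zero _ _, ?_⟩
      have h1 := (hF.sym_realDeriv hK m 0).mul (Sym.const_mul (-2) ((Sym.snd m).mul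
        ((Sym.one_sub_sq_inv m).mul (Sym.one_sub_sq_inv m))))
      refine h1.mono' fun x σ hσ => ?_
      have hc := one_sub_sq_pos hσ
      have hl := lowWeight_pos x σ
      have hl1 := lowWeight_le_one x hσ
      rw [scaleWeight, le_div_iff₀ (by positivity), add_zero, pow_succ]
      calc _ = (1 - σ ^ 2) ^ k * (lowWeight x σ * lowWeight x σ) := by field_simp
        _ ≤ (1 - σ ^ 2) ^ k * 1 := by
            gcongr
            exact mul_le_one₀ hl1 hl.le hl1
        _ = _ := mul_one _
  refine ((Sym.const_mul (Real.pi : ℂ) ((Sym.one_sub_sq m).mul htail)).mono' fun x σ _ =>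
    le_of_eq (by ring)).congr fun x σ hσ => ?_
  rw [cutDensity_of_mem F hσ]
  push_cast; ring

theorem IsAdmissible.contDiff_cutDensity {F : ℂ → ℂ} {N₀ : ℕ} (hF : IsAdmissible F N₀)
    (hN : 11 ≤ N₀) {m : ℕ} (hm : 2 * (m + 1) ≤ N₀) :
    ContDiff ℝ m (fun u => (cutDensity F u : ℂ)) := by
  have h := (hF.sym_cutDensity hN (K := m + 1) (by omega) hm m).contDiff_indicator le_rfl
    zero_le_one fun σ _ => (one_mul _).ge
  convert h using 1
  ext u
  by_cases hu : u ∈ Ioo (-1 : ℝ) 1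
  · rw [indicator_of_mem hu]
  · rw [indicator_of_notMem hu, cutDensity_of_notMem F hu, Complex.ofReal_zero]

theorem hasCompactSupport_of_Ioo {E : Type*} [Zero E] {f : ℝ → E}
    (hf : ∀ u, u ∉ Ioo (-1 : ℝ) 1 → f u = 0) : HasCompactSupport f :=
  HasCompactSupport.intro (isCompact_Icc (a := (-1 : ℝ)) (b := 1)) fun u hu =>
    hf u fun h => hu (Ioo_subset_Icc_self h)

theorem IsAdmissible.continuous_cutDensity {F : ℂ → ℂ} {N₀ : ℕ} (hF : IsAdmissible F N₀)
    (hN : 11 ≤ N₀) : Continuous (cutDensity F) := by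
  have h := (hF.contDiff_cutDensity hN (m := 0) (by omega)).continuous
  have := Complex.continuous_re.comp h
  simpa [Function.comp_def] using this

theorem IsAdmissible.integrable_cutDensity {F : ℂ → ℂ} {N₀ : ℕ} (hF : IsAdmissible F N₀)
    (hN : 11 ≤ N₀) : Integrable (cutDensity F) :=
  (hF.continuous_cutDensity hN).integrable_of_hasCompactSupport
    (hasCompactSupport_of_Ioo fun _ hu => cutDensity_of_notMem F hu)

/-! ### Cauchy integrals with boundary values -/

open FourierTransform in
/-- The boundary-value extension of `p ↦ ∫ f(u) / (p + iu) du` to the closed right half-plane. -/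
def cauchyExt (f : ℝ → ℂ) (p : ℂ) : ℂ :=
  2 * Real.pi * ∫ ξ in Ioi (0 : ℝ), Complex.exp (-(2 * Real.pi * p * ξ)) * 𝓕 f ξ

open FourierTransform in
theorem pow_mul_norm_fourier_le {f : ℝ → ℂ} {m : ℕ} (hf : ContDiff ℝ m f)
    (hs : HasCompactSupport f) {j : ℕ} (hj : j ≤ m) :
    ∃ C : ℝ, ∀ ξ : ℝ, |ξ| ^ j * ‖𝓕 f ξ‖ ≤ C := by
  have hint : ∀ n : ℕ, (n : ℕ∞) ≤ (m : ℕ∞) → Integrable (iteratedDeriv n f) := by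
    intro n hn
    have hc : Continuous (iteratedDeriv n f) := hf.continuous_iteratedDeriv n (by exact_mod_cast hn)
    refine hc.integrable_of_hasCompactSupport ?_
    refine (hs.iteratedFDeriv (𝕜 := ℝ) n).mono fun x hx => ?_
    rw [Function.mem_support] at hx ⊢
    rw [← norm_ne_zero_iff, norm_iteratedFDeriv_eq_norm_iteratedDeriv]
    exact norm_ne_zero_iff.2 hx
  have h := Real.fourier_iteratedDeriv (N := (m : ℕ∞)) (by exact_mod_cast hf) hint
    (by exact_mod_cast hj : (j : ℕ∞) ≤ m)
  refine ⟨∫ u, ‖iteratedDeriv j f u‖, fun ξ => ?_⟩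
  have h1 : ‖𝓕 (iteratedDeriv j f) ξ‖ ≤ ∫ u, ‖iteratedDeriv j f u‖ :=
    VectorFourier.norm_fourierIntegral_le_integral_norm _ _ _ _ _
  refine le_trans ?_ h1
  rw [h, norm_smul, norm_pow]
  gcongr
  rw [norm_mul, norm_mul, norm_mul, Complex.norm_I, Complex.norm_real, Complex.norm_real,
    Complex.norm_ofNat, mul_one, Real.norm_eq_abs, Real.norm_eq_abs, abs_of_pos Real.pi_pos]
  nlinarith [abs_nonneg ξ, Real.pi_gt_three]

open FourierTransform in
-- Adding the bounds with exponents `j` and `j + 2` gives the integrable majorant `(1+ξ²)⁻¹`, which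
-- is why two extra derivatives of `f` are needed.
theorem exists_pow_mul_norm_fourier_le {f : ℝ → ℂ} {m : ℕ} (hf : ContDiff ℝ (m + 2 : ℕ) f)
    (hs : HasCompactSupport f) :
    ∃ C : ℝ, ∀ j ≤ m, ∀ ξ : ℝ, |ξ| ^ j * ‖𝓕 f ξ‖ ≤ C * (1 + ξ ^ 2)⁻¹ := by
  have h := fun j : Fin (m + 3) => pow_mul_norm_fourier_le hf hs (j := j) (by omega)
  choose C hC using h
  refine ⟨∑ j, |C j| + ∑ j, |C j|, fun j hj ξ => ?_⟩
  rw [← div_eq_mul_inv, le_div_iff₀ (by positivity)]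
  have hle : ∀ j : Fin (m + 3), |ξ| ^ (j : ℕ) * ‖𝓕 f ξ‖ ≤ ∑ j, |C j| := fun j =>
    (hC j ξ).trans ((le_abs_self _).trans
      (Finset.single_le_sum (f := fun j => |C j|) (fun _ _ => abs_nonneg _) (Finset.mem_univ j)))
  have h1 := hle ⟨j, by omega⟩
  have h2 := hle ⟨j + 2, by omega⟩
  simp only at h1 h2
  calc |ξ| ^ j * ‖𝓕 f ξ‖ * (1 + ξ ^ 2) = |ξ| ^ j * ‖𝓕 f ξ‖ + |ξ| ^ (j + 2) * ‖𝓕 f ξ‖ := by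
        rw [pow_add, sq_abs]; ring
    _ ≤ _ := add_le_add h1 h2

open FourierTransform in
theorem continuous_fourier_of_integrable {f : ℝ → ℂ} (hf : Integrable f) : Continuous (𝓕 f) := by
  refine (Real.contDiff_fourier (N := 0) fun n hn => ?_).continuous
  have : n = 0 := by exact_mod_cast (nonpos_iff_eq_zero.1 hn)
  simpa [this] using hf.norm

open FourierTransform in
theorem integrable_fourier {f : ℝ → ℂ} (hf : ContDiff ℝ 2 f) (hs : HasCompactSupport f) :
    Integrable (𝓕 f) := by
  obtain ⟨C, hC⟩ := exists_pow_mul_norm_fourier_le (m := 0) (by exact_mod_cast hf) hs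
  have hi : Integrable f := hf.continuous.integrable_of_hasCompactSupport hs
  refine (integrable_inv_one_add_sq.const_mul C).mono'
    (continuous_fourier_of_integrable hi).aestronglyMeasurable (ae_of_all _ fun ξ => ?_)
  simpa using hC 0 le_rfl ξ

open FourierTransform in
theorem norm_exp_cauchy_le {p : ℂ} (hp : 0 ≤ p.re) {ξ : ℝ} (hξ : 0 < ξ) :
    ‖Complex.exp (-(2 * Real.pi * p * ξ))‖ ≤ 1 := by
  rw [Complex.norm_exp, Real.exp_le_one_iff]
  have : (-(2 * (Real.pi : ℂ) * p * ξ)).re = -(2 * Real.pi * p.re * ξ) := by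
    simp [Complex.mul_re]
  rw [this]
  have := Real.pi_pos
  have : 0 ≤ 2 * Real.pi * p.re * ξ := by positivity
  linarith

open FourierTransform in
theorem continuousOn_cauchyExt {f : ℝ → ℂ} (hf : Integrable (𝓕 f)) (hc : Continuous (𝓕 f)) :
    ContinuousOn (cauchyExt f) {p : ℂ | 0 ≤ p.re} := by
  refine ContinuousOn.const_mul ?_ _ |>.congr fun p _ => rfl
  refine continuousOn_of_dominated (bound := fun ξ => ‖𝓕 f ξ‖) ?_ ?_ hf.norm.integrableOn ?_
  · intro p _
    exact Continuous.aestronglyMeasurable (by fun_prop)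
  · intro p hp
    filter_upwards [ae_restrict_mem measurableSet_Ioi] with ξ hξ
    rw [norm_mul]
    exact mul_le_of_le_one_left (norm_nonneg _) (norm_exp_cauchy_le hp hξ)
  · exact ae_of_all _ fun ξ => Continuous.continuousOn (by fun_prop)

theorem add_I_mul_ne_zero {p : ℂ} (hp : 0 < p.re) (u : ℝ) : p + Complex.I * u ≠ 0 := by
  intro h
  have := congrArg Complex.re h
  simp at this; linarith

open FourierTransform in
-- Insert `1/(p+iu) = 2π∫₀^∞ e^{-2π(p+iu)ξ} dξ` and apply Fubini, which `Re p > 0` justifies.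
theorem cauchyExt_eq_integral {f : ℝ → ℂ} (hf : Integrable f) {p : ℂ} (hp : 0 < p.re) :
    cauchyExt f p = ∫ u : ℝ, f u / (p + Complex.I * u) := by
  have hexp : ∀ u : ℝ, ∫ ξ in Ioi (0 : ℝ), Complex.exp (-(2 * Real.pi * (p + Complex.I * u)) * ξ)
      = 1 / (2 * Real.pi * (p + Complex.I * u)) := by
    intro u
    rw [integral_exp_mul_complex_Ioi]
    · simp [neg_div_neg_eq, one_div]
    · have : (-(2 * (Real.pi : ℂ) * (p + Complex.I * u))).re = -(2 * Real.pi * p.re) := by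
        simp [Complex.mul_re]
      rw [this]
      have := Real.pi_pos
      have : 0 < 2 * Real.pi * p.re := by positivity
      linarith
  have hprod : Integrable (fun q : ℝ × ℝ =>
      Complex.exp (-(2 * Real.pi * (p + Complex.I * q.2)) * q.1) * f q.2)
      ((volume.restrict (Ioi (0 : ℝ))).prod volume) := by
    have h1 : Integrable (fun ξ : ℝ => Real.exp (-(2 * Real.pi * p.re) * ξ))
        (volume.restrict (Ioi (0 : ℝ))) := by
      have := exp_neg_integrableOn_Ioi 0 (b := 2 * Real.pi * p.re)
        (by have := Real.pi_pos; positivity)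
      exact this
    refine (h1.mul_prod hf.norm).mono' ?_ ?_
    · have := hf.aestronglyMeasurable.comp_snd (μ := volume.restrict (Ioi (0 : ℝ)))
      refine AEStronglyMeasurable.mul ?_ this
      exact Continuous.aestronglyMeasurable (by fun_prop)
    · refine ae_of_all _ fun q => ?_
      rw [norm_mul, Complex.norm_exp]
      refine le_of_eq ?_
      congr 2
      simp [Complex.mul_re]
  have h1 : ∫ ξ in Ioi (0 : ℝ), Complex.exp (-(2 * Real.pi * p * ξ)) * 𝓕 f ξ
      = ∫ ξ in Ioi (0 : ℝ), ∫ u : ℝ, Complex.exp (-(2 * Real.pi * (p + Complex.I * u)) * ξ) * f u := by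
    refine integral_congr_ae (ae_of_all _ fun ξ => ?_)
    simp only
    rw [Real.fourier_real_eq_integral_exp_smul, ← integral_const_mul]
    refine integral_congr_ae (ae_of_all _ fun u => ?_)
    simp only [smul_eq_mul]
    rw [← mul_assoc, ← Complex.exp_add]
    congr 2
    push_cast; ring
  rw [cauchyExt, h1, integral_integral_swap hprod, ← integral_const_mul]
  refine integral_congr_ae (ae_of_all _ fun u => ?_)
  simp only
  rw [integral_mul_const, hexp]
  have h2 := add_I_mul_ne_zero hp u
  have h3 : (Real.pi : ℂ) ≠ 0 := by exact_mod_cast Real.pi_ne_zero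
  field_simp

open FourierTransform in
theorem cauchyExt_I_mul (f : ℝ → ℂ) (σ : ℝ) :
    cauchyExt f (Complex.I * σ) = 2 * Real.pi * 𝓕 ((Ioi (0 : ℝ)).indicator (𝓕 f)) σ := by
  rw [cauchyExt, Real.fourier_real_eq_integral_exp_smul]
  congr 1
  rw [← integral_indicator measurableSet_Ioi]
  refine integral_congr_ae (ae_of_all _ fun ξ => ?_)
  by_cases hξ : ξ ∈ Ioi (0 : ℝ)
  · simp only [indicator_of_mem hξ, smul_eq_mul]
    congr 2
    push_cast; ring
  · simp [indicator_of_notMem hξ]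

open FourierTransform in
-- On the axis the Cauchy transform is the Fourier transform of the truncated function `1_{ξ>0}·𝓕f`.
-- Its regularity depends only on the decay in `ξ`, so the jump of the truncation at `ξ = 0` does no
-- harm.
theorem contDiff_cauchyExt_I_mul {f : ℝ → ℂ} {m : ℕ} (hf : ContDiff ℝ (m + 2 : ℕ) f)
    (hs : HasCompactSupport f) : ContDiff ℝ m (fun σ : ℝ => cauchyExt f (Complex.I * σ)) := by
  obtain ⟨C, hC⟩ := exists_pow_mul_norm_fourier_le hf hs
  have hi : Integrable f := hf.continuous.integrable_of_hasCompactSupport hs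
  have hc := continuous_fourier_of_integrable hi
  simp_rw [cauchyExt_I_mul]
  refine contDiff_const.mul ?_
  have := Real.contDiff_fourier (f := (Ioi (0 : ℝ)).indicator (𝓕 f)) (N := (m : ℕ∞)) fun n hn => ?_
  · exact_mod_cast this
  have hn' : n ≤ m := by exact_mod_cast hn
  refine (integrable_inv_one_add_sq.const_mul C).mono' ?_ (ae_of_all _ fun ξ => ?_)
  · exact ((continuous_norm.pow n).aestronglyMeasurable).mul
      (hc.aestronglyMeasurable.indicator measurableSet_Ioi).norm
  · rw [norm_mul, norm_pow, norm_norm, norm_norm]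
    refine le_trans ?_ (hC n hn' ξ)
    rw [Real.norm_eq_abs]
    gcongr
    exact norm_indicator_le_norm_self _ _

open FourierTransform in
theorem conj_fourier_of_even {f : ℝ → ℂ} (he : ∀ u, f (-u) = f u)
    (hr : ∀ u, (starRingEnd ℂ) (f u) = f u) (ξ : ℝ) :
    (starRingEnd ℂ) (𝓕 f ξ) = 𝓕 f ξ := by
  rw [Real.fourier_real_eq_integral_exp_smul, ← integral_conj, ← integral_neg_eq_self]
  refine integral_congr_ae (ae_of_all _ fun u => ?_)
  simp only [smul_eq_mul, map_mul, hr, he, ← Complex.exp_conj, Complex.conj_I, Complex.conj_ofReal]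
  congr 2
  push_cast; ring

open FourierTransform in
theorem fourier_neg_of_even {f : ℝ → ℂ} (he : ∀ u, f (-u) = f u) (ξ : ℝ) :
    𝓕 f (-ξ) = 𝓕 f ξ := by
  rw [Real.fourier_real_eq_integral_exp_smul, Real.fourier_real_eq_integral_exp_smul,
    ← integral_neg_eq_self]
  refine integral_congr_ae (ae_of_all _ fun u => ?_)
  simp only [smul_eq_mul, he]
  congr 2
  push_cast; ring

theorem conj_cauchyExt {f : ℝ → ℂ} (he : ∀ u, f (-u) = f u)
    (hr : ∀ u, (starRingEnd ℂ) (f u) = f u) (p : ℂ) :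
    (starRingEnd ℂ) (cauchyExt f p) = cauchyExt f ((starRingEnd ℂ) p) := by
  rw [cauchyExt, cauchyExt, map_mul, ← integral_conj]
  have h2 : (starRingEnd ℂ) 2 = 2 := Complex.conj_ofNat 2
  congr 1
  · simp [h2]
  · refine integral_congr_ae (ae_of_all _ fun ξ => ?_)
    simp only [map_mul, conj_fourier_of_even he hr, ← Complex.exp_conj]
    simp [h2]

open FourierTransform in
-- The Plemelj formula. For real even `f` the transform `𝓕f` is real and even, so the halves `ξ > 0`
-- and `ξ < 0` of the inversion integral are complex conjugates of each other.
theorem re_cauchyExt_I_mul {f : ℝ → ℂ} (hf : Continuous f) (hi : Integrable f)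
    (hF : Integrable (𝓕 f)) (he : ∀ u, f (-u) = f u) (hr : ∀ u, (starRingEnd ℂ) (f u) = f u)
    (σ : ℝ) : (cauchyExt f (Complex.I * σ)).re = Real.pi * (f σ).re := by
  have hinv : f σ = ∫ ξ : ℝ, Complex.exp (2 * Real.pi * (Complex.I * σ) * ξ) * 𝓕 f ξ := by
    have h := congrFun (hf.fourierInv_fourier_eq hi hF) σ
    rw [Real.fourierInv_eq'] at h
    rw [← h]
    refine integral_congr_ae (ae_of_all _ fun ξ => ?_)
    simp only [smul_eq_mul, RCLike.inner_apply, conj_trivial]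
    congr 2
    push_cast; ring
  have hint : Integrable fun ξ : ℝ => Complex.exp (2 * Real.pi * (Complex.I * σ) * ξ) * 𝓕 f ξ := by
    refine hF.bdd_mul (c := 1) (Continuous.aestronglyMeasurable (by fun_prop))
      (ae_of_all _ fun ξ => ?_)
    rw [Complex.norm_exp]
    simp [Complex.mul_re]
  have hsplit : f σ = (∫ ξ in Ioi (0 : ℝ), Complex.exp (2 * Real.pi * (Complex.I * σ) * ξ) * 𝓕 f ξ)
      + ∫ ξ in Ioi (0 : ℝ), Complex.exp (-(2 * Real.pi * (Complex.I * σ) * ξ)) * 𝓕 f ξ := by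
    have h2 : ∫ ξ in Ioi (0 : ℝ), Complex.exp (-(2 * Real.pi * (Complex.I * σ) * ξ)) * 𝓕 f ξ
        = ∫ ξ in Iic (0 : ℝ), Complex.exp (2 * Real.pi * (Complex.I * σ) * ξ) * 𝓕 f ξ := by
      have := integral_comp_neg_Ioi (0 : ℝ)
        (fun ξ : ℝ => Complex.exp (2 * Real.pi * (Complex.I * σ) * ξ) * 𝓕 f ξ)
      rw [neg_zero] at this
      rw [← this]
      refine integral_congr_ae (ae_of_all _ fun ξ => ?_)
      simp only [fourier_neg_of_even he]
      congr 2
      push_cast; ring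
    rw [h2, add_comm, intervalIntegral.integral_Iic_add_Ioi hint.integrableOn hint.integrableOn]
    exact hinv
  have hsum : cauchyExt f (Complex.I * σ) + (starRingEnd ℂ) (cauchyExt f (Complex.I * σ))
      = 2 * Real.pi * f σ := by
    rw [conj_cauchyExt he hr, hsplit, cauchyExt, cauchyExt, ← mul_add, add_comm]
    congr 2
    refine integral_congr_ae (ae_of_all _ fun ξ => ?_)
    simp
  have := congrArg Complex.re hsum
  rw [Complex.add_conj] at this
  have h2 : (2 * (Real.pi : ℂ) * f σ).re = 2 * Real.pi * (f σ).re := by simp [Complex.mul_re]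
  rw [h2, Complex.ofReal_re] at this
  linarith

theorem differentiableOn_cauchyIntegral {f : ℝ → ℂ} (hf : Integrable f) :
    DifferentiableOn ℂ (fun p : ℂ => ∫ u : ℝ, f u / (p + Complex.I * u)) {p : ℂ | 0 < p.re} := by
  intro p hp
  have hp' : 0 < p.re := hp
  refine DifferentiableAt.differentiableWithinAt ?_
  have hball : ∀ q ∈ Metric.ball p (p.re / 2), p.re / 2 < q.re := by
    intro q hq
    rw [Metric.mem_ball, dist_eq_norm] at hq
    have := (Complex.abs_re_le_norm (q - p)).trans_lt hq
    rw [Complex.sub_re, abs_lt] at this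
    linarith [this.1]
  have hne : ∀ q : ℂ, p.re / 2 < q.re → ∀ u : ℝ, q + Complex.I * u ≠ 0 := fun q hq u =>
    add_I_mul_ne_zero (by linarith) u
  have hlow : ∀ q : ℂ, p.re / 2 < q.re → ∀ u : ℝ, p.re / 2 ≤ ‖q + Complex.I * u‖ := by
    intro q hq u
    refine hq.le.trans (le_trans (le_of_eq ?_) (Complex.re_le_norm _))
    simp
  have hden : ∀ q : ℂ, AEStronglyMeasurable (fun u : ℝ => (q + Complex.I * u)⁻¹) := fun q =>
    Measurable.aestronglyMeasurable (by fun_prop)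
  have h := hasDerivAt_integral_of_dominated_loc_of_deriv_le (μ := volume) (𝕜 := ℂ)
    (F := fun q u => f u / (q + Complex.I * u))
    (F' := fun q u => -(f u * ((q + Complex.I * u)⁻¹ * (q + Complex.I * u)⁻¹))) (x₀ := p)
    (s := Metric.ball p (p.re / 2)) (bound := fun u => ‖f u‖ * ((p.re / 2)⁻¹ * (p.re / 2)⁻¹))
    (Metric.ball_mem_nhds _ (by positivity)) ?_ ?_ ?_ ?_ (hf.norm.mul_const _) ?_
  · exact h.2.differentiableAt
  · exact Eventually.of_forall fun q => by
      simp only [div_eq_mul_inv]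
      exact hf.aestronglyMeasurable.mul (hden q)
  · simp only [div_eq_mul_inv]
    refine hf.mul_bdd (c := (p.re / 2)⁻¹) (hden p) (ae_of_all _ fun u => ?_)
    rw [norm_inv]
    exact inv_anti₀ (by positivity) (hlow p (by linarith) u)
  · exact (hf.aestronglyMeasurable.mul ((hden p).mul (hden p))).neg
  · refine ae_of_all _ fun u q hq => ?_
    rw [norm_neg, norm_mul, norm_mul, norm_inv]
    have := inv_anti₀ (by positivity) (hlow q (hball q hq) u)
    gcongr
  · refine ae_of_all _ fun u q hq => ?_
    have hq0 := hne q (hball q hq) u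
    have hd : HasDerivAt (fun q : ℂ => q + Complex.I * u) 1 q := (hasDerivAt_id q).add_const _
    refine ((hasDerivAt_const q (f u)).div hd hq0).congr_deriv ?_
    field_simp
    ring

/-! ### The dispersion function up to the imaginary axis -/

/-- The Cauchy integral `∫ W(u) / (p + iu) du` of the density, up to the imaginary axis. -/
def current (F : ℂ → ℂ) (p : ℂ) : ℂ := cauchyExt (fun u => (cutDensity F u : ℂ)) p

/-- The continuous extension of `M(·, k)`, `|k| = κ > 0`, to the closed right half-plane. -/
def dispExt (F : ℂ → ℂ) (κ : ℝ) (z : ℂ) : ℂ := z ^ 2 + (κ : ℂ) ^ 2 + z / κ * current F (z / κ)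

section

variable {F : ℂ → ℂ} {N₀ : ℕ}

theorem hasCompactSupport_cutDensity (F : ℂ → ℂ) :
    HasCompactSupport (fun u => (cutDensity F u : ℂ)) :=
  hasCompactSupport_of_Ioo fun u hu => by rw [cutDensity_of_notMem F hu, Complex.ofReal_zero]

theorem IsAdmissible.integrable_cutDensity_complex (hF : IsAdmissible F N₀) (hN : 11 ≤ N₀) :
    Integrable (fun u => (cutDensity F u : ℂ)) := (hF.integrable_cutDensity hN).ofReal

theorem IsAdmissible.contDiff_two_cutDensity (hF : IsAdmissible F N₀) (hN : 11 ≤ N₀) :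
    ContDiff ℝ 2 (fun u => (cutDensity F u : ℂ)) := by
  have := hF.contDiff_cutDensity hN (m := 2) (by omega)
  exact_mod_cast this

theorem IsAdmissible.continuousOn_current (hF : IsAdmissible F N₀) (hN : 11 ≤ N₀) :
    ContinuousOn (current F) {p : ℂ | 0 ≤ p.re} :=
  continuousOn_cauchyExt (integrable_fourier (hF.contDiff_two_cutDensity hN) (hasCompactSupport_cutDensity F))
    (continuous_fourier_of_integrable (hF.integrable_cutDensity_complex hN))

theorem IsAdmissible.current_eq (hF : IsAdmissible F N₀) (hN : 11 ≤ N₀) {p : ℂ} (hp : 0 < p.re) :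
    current F p = ∫ u : ℝ, (cutDensity F u : ℂ) / (p + Complex.I * u) :=
  cauchyExt_eq_integral (hF.integrable_cutDensity_complex hN) hp

theorem conj_current (F : ℂ → ℂ) (p : ℂ) :
    (starRingEnd ℂ) (current F p) = current F ((starRingEnd ℂ) p) :=
  conj_cauchyExt (fun u => by rw [cutDensity_neg]) (fun u => Complex.conj_ofReal _) p

theorem IsAdmissible.re_current_I_mul (hF : IsAdmissible F N₀) (hN : 11 ≤ N₀) (σ : ℝ) :
    (current F (Complex.I * σ)).re = Real.pi * cutDensity F σ :=
  re_cauchyExt_I_mul (f := fun u => (cutDensity F u : ℂ)) (Complex.continuous_ofReal.comp (hF.continuous_cutDensity hN))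
    (hF.integrable_cutDensity_complex hN)
    (integrable_fourier (hF.contDiff_two_cutDensity hN)
      (hasCompactSupport_cutDensity F))
    (fun u => by rw [cutDensity_neg]) (fun u => Complex.conj_ofReal _) σ

theorem IsAdmissible.contDiff_current_I_mul (hF : IsAdmissible F N₀) (hN : 11 ≤ N₀) {m : ℕ}
    (hm : 2 * (m + 3) ≤ N₀) : ContDiff ℝ m (fun σ : ℝ => current F (Complex.I * σ)) :=
  contDiff_cauchyExt_I_mul (hF.contDiff_cutDensity hN (by omega)) (hasCompactSupport_cutDensity F)

theorem div_ofReal_re (z : ℂ) (κ : ℝ) : (z / κ).re = z.re / κ := Complex.div_ofReal_re z κ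

theorem IsAdmissible.continuousOn_dispExt (hF : IsAdmissible F N₀) (hN : 11 ≤ N₀) {κ : ℝ}
    (hκ : 0 < κ) : ContinuousOn (dispExt F κ) {z : ℂ | 0 ≤ z.re} := by
  have h : ContinuousOn (fun z : ℂ => current F (z / κ)) {z : ℂ | 0 ≤ z.re} :=
    (hF.continuousOn_current hN).comp (by fun_prop) fun z (hz : 0 ≤ z.re) => by
      simp only [mem_ofPred_eq, div_ofReal_re]; positivity
  unfold dispExt
  fun_prop

theorem IsAdmissible.magDispersion_eq_dispExt (hF : IsAdmissible F N₀) (hN : 11 ≤ N₀) {z : ℂ}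
    (hz : 0 < z.re) {k : R3} (hk : k ≠ 0) : magDispersion F z k = dispExt F ‖k‖ z := by
  have hκ : 0 < ‖k‖ := norm_pos_iff.2 hk
  have hκ' : (‖k‖ : ℂ) ≠ 0 := by exact_mod_cast hκ.ne'
  have hzre : 0 < (z / ‖k‖).re := by rw [div_ofReal_re]; positivity
  rw [hF.magDispersion_eq hN (hF.integrable_cutDensity hN) hz, dispExt, hF.current_eq hN hzre,
    ← integral_const_mul]
  congr 1
  refine integral_congr_ae (ae_of_all _ fun u => ?_)
  have h1 := add_I_mul_ne_zero hzre u
  have h2 := add_I_mul_ne_zero hz (‖k‖ * u)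
  push_cast at h2
  simp only
  have h3 : z / ‖k‖ + Complex.I * u = (z + Complex.I * (‖k‖ * u)) / ‖k‖ := by
    field_simp
  rw [h3]
  field_simp

theorem IsAdmissible.continuousOn_magDispersion (hF : IsAdmissible F N₀) (hN : 11 ≤ N₀) (k : R3) :
    ContinuousOn (fun z => magDispersion F z k) {z : ℂ | 0 < z.re} := by
  rcases eq_or_ne k 0 with rfl | hk
  · unfold magDispersion
    simp only [inner_zero_left, Complex.ofReal_zero, mul_zero, zero_mul, zero_div, integral_zero]
    fun_prop
  · refine ((hF.continuousOn_dispExt hN (norm_pos_iff.2 hk)).mono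
      fun z (hz : 0 < z.re) => hz.le).congr fun z hz => hF.magDispersion_eq_dispExt hN hz hk

theorem IsAdmissible.integrable_kernel (hF : IsAdmissible F N₀) (hN : 11 ≤ N₀) {z : ℂ}
    (hz : 0 < z.re) (κ : ℝ) :
    Integrable fun u : ℝ => z / (z + Complex.I * (κ * u)) * (cutDensity F u : ℂ) := by
  refine (hF.integrable_cutDensity_complex hN).bdd_mul (c := ‖z‖ / z.re)
    (Measurable.aestronglyMeasurable (by fun_prop)) (ae_of_all _ fun u => ?_)
  rw [norm_div]
  gcongr
  refine le_trans (le_of_eq ?_) (Complex.re_le_norm _)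
  simp

/-- `M(z,k) / z` has positive real part, quantitatively. -/
theorem IsAdmissible.norm_magDispersion_ge (hF : IsAdmissible F N₀) (hN : 11 ≤ N₀) {z : ℂ}
    (hz : 0 < z.re) (k : R3) : ‖z‖ * z.re ≤ ‖magDispersion F z k‖ := by
  have hz0 : z ≠ 0 := by rintro rfl; simp at hz
  have hint : Integrable fun u : ℝ => (cutDensity F u : ℂ) / (z + Complex.I * (‖k‖ * u)) := by
    refine ((hF.integrable_kernel hN hz ‖k‖).const_mul z⁻¹).congr (ae_of_all _ fun u => ?_)
    have := add_I_mul_ne_zero hz (‖k‖ * u)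
    push_cast at this
    simp only
    field_simp
  -- After division by `z` the three summands `z`, `κ²/z` and `∫ W/(z+iκu)` all have non-negative
  -- real part, because `W ≥ 0`.
  have heq : magDispersion F z k = z * (z + (‖k‖ : ℂ) ^ 2 / z +
      ∫ u : ℝ, (cutDensity F u : ℂ) / (z + Complex.I * (‖k‖ * u))) := by
    rw [hF.magDispersion_eq hN (hF.integrable_cutDensity hN) hz, mul_add, ← integral_const_mul,
      mul_add, mul_div_cancel₀ _ hz0, sq z]
    congr 2
    ext u
    ring
  rw [heq, norm_mul]
  refine mul_le_mul_of_nonneg_left (le_trans ?_ (Complex.re_le_norm _)) (norm_nonneg _)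
  rw [Complex.add_re, Complex.add_re]
  have h1 : 0 ≤ ((‖k‖ : ℂ) ^ 2 / z).re := by
    rw [← Complex.ofReal_pow, div_eq_mul_inv, Complex.re_ofReal_mul, Complex.inv_re]
    have := Complex.normSq_nonneg z
    positivity
  have h2 : 0 ≤ (∫ u : ℝ, (cutDensity F u : ℂ) / (z + Complex.I * (‖k‖ * u))).re := by
    have := integral_re hint
    rw [RCLike.re_eq_complex_re] at this
    rw [← this]
    refine integral_nonneg fun u => ?_
    rw [div_eq_mul_inv, Complex.re_ofReal_mul, Complex.inv_re]
    have h3 := hF.cutDensity_nonneg hN u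
    have h4 : (z + Complex.I * (‖k‖ * u)).re = z.re := by simp
    rw [h4]
    have := Complex.normSq_nonneg (z + Complex.I * (‖k‖ * u))
    positivity
  linarith

theorem IsAdmissible.magDispersion_ne_zero (hF : IsAdmissible F N₀) (hN : 11 ≤ N₀) {z : ℂ}
    (hz : 0 < z.re) (k : R3) : magDispersion F z k ≠ 0 := by
  have h := hF.norm_magDispersion_ge hN hz k
  have hz0 : z ≠ 0 := by rintro rfl; simp at hz
  have : 0 < ‖z‖ * z.re := mul_pos (norm_pos_iff.2 hz0) hz
  exact norm_pos_iff.1 (this.trans_le h)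

/-- A crude bound showing that `z²` dominates on a vertical line; it serves for the absolute
convergence of the Green integral. -/
theorem IsAdmissible.norm_magDispersion_sub_le (hF : IsAdmissible F N₀) (hN : 11 ≤ N₀) {z : ℂ}
    (hz : 0 < z.re) (k : R3) :
    ‖z‖ ^ 2 - ‖k‖ ^ 2 - ‖z‖ / z.re * ∫ u, cutDensity F u ≤ ‖magDispersion F z k‖ := by
  have hb : ‖∫ u : ℝ, z / (z + Complex.I * (‖k‖ * u)) * (cutDensity F u : ℂ)‖
      ≤ ‖z‖ / z.re * ∫ u, cutDensity F u := by
    rw [← integral_const_mul]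
    refine norm_integral_le_of_norm_le ((hF.integrable_cutDensity hN).const_mul _)
      (ae_of_all _ fun u => ?_)
    rw [norm_mul, Complex.norm_real, Real.norm_eq_abs, abs_of_nonneg (hF.cutDensity_nonneg hN u)]
    refine mul_le_mul_of_nonneg_right ?_ (hF.cutDensity_nonneg hN u)
    rw [norm_div]
    gcongr
    refine le_trans (le_of_eq ?_) (Complex.re_le_norm _)
    simp
  rw [hF.magDispersion_eq hN (hF.integrable_cutDensity hN) hz, add_assoc]
  have h1 := norm_sub_le_norm_add (z ^ 2) ((‖k‖ : ℂ) ^ 2 +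
    ∫ u : ℝ, z / (z + Complex.I * (‖k‖ * u)) * (cutDensity F u : ℂ))
  have h2 := norm_add_le ((‖k‖ : ℂ) ^ 2)
    (∫ u : ℝ, z / (z + Complex.I * (‖k‖ * u)) * (cutDensity F u : ℂ))
  rw [norm_pow] at h1 h2
  rw [Complex.norm_real, norm_norm] at h2
  linarith

theorem integrable_of_continuous_of_bound {f : ℝ → ℂ} (hf : Continuous f) {C T : ℝ}
    (h : ∀ τ, T ≤ |τ| → ‖f τ‖ ≤ C * (1 + τ ^ 2)⁻¹) :
    ∃ C', ∀ τ, ‖f τ‖ ≤ C' * (1 + τ ^ 2)⁻¹ := by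
  obtain ⟨D, hD⟩ := (isCompact_Icc (a := -T) (b := T)).exists_bound_of_continuousOn hf.continuousOn
  refine ⟨max C (D * (1 + T ^ 2)), fun τ => ?_⟩
  rcases le_or_gt T |τ| with hτ | hτ
  · refine (h τ hτ).trans ?_
    gcongr
    exact le_max_left _ _
  · have h1 := hD τ ⟨by linarith [neg_abs_le τ], by linarith [le_abs_self τ]⟩
    have hD0 : 0 ≤ D := (norm_nonneg _).trans h1
    rw [← div_eq_mul_inv, le_div_iff₀ (by positivity)]
    refine le_trans ?_ (le_max_right _ _)
    have h2 : τ ^ 2 ≤ T ^ 2 := sq_le_sq' (by linarith [neg_abs_le τ]) (by linarith [le_abs_self τ])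
    gcongr

theorem integrable_of_continuous_of_decay {f : ℝ → ℂ} (hf : Continuous f) {C T : ℝ}
    (h : ∀ τ, T ≤ |τ| → ‖f τ‖ ≤ C * (1 + τ ^ 2)⁻¹) : Integrable f := by
  obtain ⟨C', hC'⟩ := integrable_of_continuous_of_bound hf h
  exact (integrable_inv_one_add_sq.const_mul C').mono' hf.aestronglyMeasurable
    (ae_of_all _ hC')

theorem IsAdmissible.continuous_greenIntegrand (hF : IsAdmissible F N₀) (hN : 11 ≤ N₀) {γ : ℝ}
    (hγ : 0 < γ) (k : R3) (t : ℝ) : Continuous (greenIntegrand F γ k t) := by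
  unfold greenIntegrand
  refine Continuous.div (by fun_prop) ?_ fun τ => hF.magDispersion_ne_zero hN (by simpa using hγ) k
  exact (hF.continuousOn_magDispersion hN k).comp_continuous (by fun_prop)
    fun τ => by simpa using hγ

theorem norm_sq_add_I_mul (γ τ : ℝ) : ‖(γ : ℂ) + Complex.I * (τ : ℂ)‖ ^ 2 = γ ^ 2 + τ ^ 2 := by
  rw [← Complex.normSq_eq_norm_sq, Complex.normSq_apply]
  simp; ring

theorem IsAdmissible.integrable_greenIntegrand (hF : IsAdmissible F N₀) (hN : 11 ≤ N₀) {γ : ℝ}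
    (hγ : 0 < γ) (k : R3) (t : ℝ) : Integrable (greenIntegrand F γ k t) := by
  set A := ∫ u, cutDensity F u with hA
  have hA0 : 0 ≤ A := integral_nonneg fun u => hF.cutDensity_nonneg hN u
  -- For `|z| ≥ T` both `|k|²` and `|z|A/γ` are at most `|z|²/4`, which leaves `|M| ≥ |z|²/2`.
  set T := 2 + 2 * ‖k‖ + 4 * (A / γ) with hT
  have hAγ : 0 ≤ A / γ := by positivity
  refine integrable_of_continuous_of_decay (hF.continuous_greenIntegrand hN hγ k t)
    (C := Real.exp (γ * t) * 4) (T := T) fun τ hτ => ?_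
  set z : ℂ := (γ : ℂ) + Complex.I * (τ : ℂ) with hz
  have hre : z.re = γ := by simp [hz]
  have hzn : ‖z‖ ^ 2 = γ ^ 2 + τ ^ 2 := norm_sq_add_I_mul γ τ
  have hτz : |τ| ≤ ‖z‖ := by
    rw [← abs_norm z, ← sq_le_sq, hzn]; nlinarith [sq_nonneg γ]
  have hlow := hF.norm_magDispersion_sub_le hN (z := z) (by rw [hre]; exact hγ) k
  rw [hre, ← hA] at hlow
  have h1 : 2 + 2 * ‖k‖ + 4 * (A / γ) ≤ ‖z‖ := hτ.trans hτz
  have hk := norm_nonneg k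
  have h2 : ‖z‖ ^ 2 / 2 ≤ ‖magDispersion F z k‖ := by
    refine le_trans ?_ hlow
    have e1 : ‖z‖ / γ * A = ‖z‖ * (A / γ) := by ring
    rw [e1]
    nlinarith [mul_nonneg (norm_nonneg z) hk, mul_nonneg (norm_nonneg z) hAγ,
      mul_nonneg (norm_nonneg z) (sub_nonneg.2 h1)]
  have h3 : (1 + τ ^ 2) / 4 ≤ ‖magDispersion F z k‖ := by
    refine le_trans ?_ h2
    have : 1 ≤ τ ^ 2 := by
      rw [← sq_abs]; nlinarith
    nlinarith [sq_nonneg γ]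
  rw [greenIntegrand, norm_div, ← hz, Complex.norm_exp]
  have h4 : (z * t).re = γ * t := by simp [hz]
  rw [h4, mul_assoc, div_eq_mul_inv]
  refine mul_le_mul_of_nonneg_left ?_ (Real.exp_pos _).le
  refine (inv_anti₀ (by positivity) h3).trans (le_of_eq ?_)
  rw [inv_div, div_eq_mul_inv]

/-! ### Boundary values on the imaginary axis -/

theorem dispExt_I_mul (F : ℂ → ℂ) {κ : ℝ} (hκ : 0 < κ) (σ : ℝ) :
    dispExt F κ (Complex.I * ((κ * σ : ℝ) : ℂ))
      = ((κ ^ 2 * (1 - σ ^ 2) : ℝ) : ℂ) + Complex.I * σ * current F (Complex.I * σ) := by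
  have hκ' : (κ : ℂ) ≠ 0 := by exact_mod_cast hκ.ne'
  have h : Complex.I * ((κ * σ : ℝ) : ℂ) / κ = Complex.I * σ := by
    push_cast; field_simp
  rw [dispExt, h]
  push_cast
  rw [mul_pow, Complex.I_sq]
  ring

theorem IsAdmissible.im_dispExt (hF : IsAdmissible F N₀) (hN : 11 ≤ N₀) {κ : ℝ} (hκ : 0 < κ)
    (σ : ℝ) : (dispExt F κ (Complex.I * ((κ * σ : ℝ) : ℂ))).im
      = Real.pi * (σ * cutDensity F σ) := by
  rw [dispExt_I_mul F hκ, Complex.add_im, Complex.ofReal_im, mul_assoc, Complex.I_mul_im,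
    Complex.re_ofReal_mul, hF.re_current_I_mul hN]
  ring

theorem re_dispExt (F : ℂ → ℂ) {κ : ℝ} (hκ : 0 < κ) (σ : ℝ) :
    (dispExt F κ (Complex.I * ((κ * σ : ℝ) : ℂ))).re
      = κ ^ 2 * (1 - σ ^ 2) - σ * (current F (Complex.I * σ)).im := by
  rw [dispExt_I_mul F hκ, Complex.add_re, Complex.ofReal_re, mul_assoc, Complex.I_mul_re,
    Complex.im_ofReal_mul]
  ring

theorem conj_I_mul_ofReal (σ : ℝ) :
    (starRingEnd ℂ) (Complex.I * (σ : ℂ)) = Complex.I * ((-σ : ℝ) : ℂ) := by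
  rw [map_mul, Complex.conj_I, Complex.conj_ofReal]; push_cast; ring

theorem conj_dispExt (F : ℂ → ℂ) (κ : ℝ) (z : ℂ) :
    (starRingEnd ℂ) (dispExt F κ z) = dispExt F κ ((starRingEnd ℂ) z) := by
  simp only [dispExt, map_add, map_mul, map_pow, map_div₀, Complex.conj_ofReal, conj_current]

/-- At `ε + i` the imaginary part is `-∫ W(1+u)/(ε²+(1+u)²) du`. The denominator is at most `5` for
`ε < 1`, which gives a negative bound uniform in `ε`; continuity carries it to `ε = 0`, so the
singular integral at `i` never has to be handled. -/
theorem IsAdmissible.im_current_I_neg (hF : IsAdmissible F N₀) (hN : 11 ≤ N₀) :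
    (current F Complex.I).im < 0 := by
  set δ := ∫ u, cutDensity F u * (1 + u) with hδ
  have hcont := hF.continuous_cutDensity hN
  have hsupp : HasCompactSupport (fun u => cutDensity F u * (1 + u)) :=
    hasCompactSupport_of_Ioo fun u hu => by rw [cutDensity_of_notMem F hu, zero_mul]
  have hδint : Integrable fun u => cutDensity F u * (1 + u) :=
    (by fun_prop : Continuous fun u => cutDensity F u * (1 + u)).integrable_of_hasCompactSupport hsupp
  have hnn : ∀ u, 0 ≤ cutDensity F u * (1 + u) := by
    intro u
    by_cases hu : u ∈ Ioo (-1 : ℝ) 1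
    · exact mul_nonneg (hF.cutDensity_nonneg hN u) (by linarith [hu.1])
    · rw [cutDensity_of_notMem F hu, zero_mul]
  have hδpos : 0 < δ := by
    refine (by fun_prop : Continuous fun u => cutDensity F u * (1 + u)).integral_pos_of_hasCompactSupport_nonneg_nonzero hsupp hnn (x := 0) ?_
    have := hF.cutDensity_pos hN (u := 0) (by norm_num)
    simp [this.ne']
  have hev : ∀ᶠ ε : ℝ in 𝓝[>] 0, (current F ((ε : ℂ) + Complex.I)).im ≤ -(δ / 5) := by
    filter_upwards [Ioo_mem_nhdsGT (one_pos)] with ε hε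
    have hre : 0 < ((ε : ℂ) + Complex.I).re := by simpa using hε.1
    rw [hF.current_eq hN hre]
    have hint : Integrable fun u : ℝ => (cutDensity F u : ℂ) / ((ε : ℂ) + Complex.I + Complex.I * u) := by
      have := (hF.integrable_kernel hN hre 1).const_mul ((ε : ℂ) + Complex.I)⁻¹
      refine this.congr (ae_of_all _ fun u => ?_)
      have h0 : (ε : ℂ) + Complex.I ≠ 0 := by
        intro h; rw [h] at hre; simp at hre
      have := add_I_mul_ne_zero hre u
      simp only [Complex.ofReal_one, one_mul]
      field_simp
    have him := integral_im hint
    rw [RCLike.im_eq_complex_im] at him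
    rw [← him, hδ, ← integral_div, ← integral_neg]
    refine integral_mono_ae hint.im (hδint.div_const 5).neg (ae_of_all _ fun u => ?_)
    simp only
    by_cases hu : u ∈ Ioo (-1 : ℝ) 1
    · have hW := hF.cutDensity_nonneg hN u
      rw [div_eq_mul_inv, Complex.im_ofReal_mul, Complex.inv_im, Complex.normSq_apply]
      have e1 : ((ε : ℂ) + Complex.I + Complex.I * u).re = ε := by simp
      have e2 : ((ε : ℂ) + Complex.I + Complex.I * u).im = 1 + u := by simp
      rw [e1, e2, neg_div, mul_neg, neg_le_neg_iff, ← mul_div_assoc]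
      have hu1 : 0 < 1 + u := by linarith [hu.1]
      refine div_le_div_of_nonneg_left (mul_nonneg hW hu1.le) (by nlinarith [hε.1]) ?_
      nlinarith [hu.2, hε.1, hε.2]
    · simp [cutDensity_of_notMem F hu]
  have hcur : Tendsto (fun ε : ℝ => (current F ((ε : ℂ) + Complex.I)).im) (𝓝[>] 0)
      (𝓝 (current F Complex.I).im) := by
    have h1 := (hF.continuousOn_current hN) Complex.I (by simp)
    have h2 : Tendsto (fun ε : ℝ => (ε : ℂ) + Complex.I) (𝓝[>] 0)
        (𝓝[{p : ℂ | 0 ≤ p.re}] Complex.I) := by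
      refine tendsto_nhdsWithin_iff.2 ⟨?_, ?_⟩
      · have : Continuous fun ε : ℝ => (ε : ℂ) + Complex.I := by fun_prop
        have := this.tendsto 0
        simp only [Complex.ofReal_zero, zero_add] at this
        exact this.mono_left nhdsWithin_le_nhds
      · filter_upwards [self_mem_nhdsWithin] with ε hε
        simpa using le_of_lt hε
    exact (Complex.continuous_im.tendsto _).comp (h1.tendsto.comp h2)
  have := le_of_tendsto hcur hev
  linarith

/-- The quantitative absence of zeros with `|τ| ≤ κ`. Near `|σ| = 1` the density `W` degenerates,
but the real part is positive by `im_current_I_neg`. Away from `|σ| = 1` the imaginary part `πσW(σ)`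
controls `|σ|`, and the real part controls `κ²(1-σ²)` once that term dominates. -/
theorem IsAdmissible.exists_norm_dispExt_ge (hF : IsAdmissible F N₀) (hN : 11 ≤ N₀) :
    ∃ c : ℝ, 0 < c ∧ ∀ κ : ℝ, 0 < κ → ∀ σ ∈ Icc (-1 : ℝ) 1,
      c * (κ ^ 2 * (1 - σ ^ 2) + |σ|) ≤ ‖dispExt F κ (Complex.I * ((κ * σ : ℝ) : ℂ))‖ := by
  have hgc : Continuous fun σ : ℝ => (current F (Complex.I * σ)).im :=
    Complex.continuous_im.comp ((hF.continuousOn_current hN).comp_continuous (by fun_prop)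
      fun σ => by simp)
  -- Conjugation sends `iκσ` to `-iκσ` and preserves `|M|`.
  suffices h : ∃ c : ℝ, 0 < c ∧ ∀ κ : ℝ, 0 < κ → ∀ σ ∈ Icc (0 : ℝ) 1,
      c * (κ ^ 2 * (1 - σ ^ 2) + σ) ≤ ‖dispExt F κ (Complex.I * ((κ * σ : ℝ) : ℂ))‖ by
    obtain ⟨c, hc, h⟩ := h
    refine ⟨c, hc, fun κ hκ σ hσ => ?_⟩
    rcases le_total 0 σ with h0 | h0
    · rw [abs_of_nonneg h0]; exact h κ hκ σ ⟨h0, hσ.2⟩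
    · have := h κ hκ (-σ) ⟨by linarith, by linarith [hσ.1]⟩
      rw [abs_of_nonpos h0]
      rw [neg_sq] at this
      refine this.trans (le_of_eq ?_)
      rw [← Complex.norm_conj, conj_dispExt, conj_I_mul_ofReal, mul_neg, neg_neg]
  obtain ⟨G, hG⟩ := (isCompact_Icc (a := (0 : ℝ)) (b := 1)).exists_bound_of_continuousOn hgc.continuousOn
  have hG0 : 0 ≤ G := (norm_nonneg _).trans (hG 0 (by simp))
  have h1 : 0 < -(1 * (current F (Complex.I * (1 : ℝ))).im) := by
    have := hF.im_current_I_neg hN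
    simpa using this
  have hac : Continuous fun σ : ℝ => -(σ * (current F (Complex.I * σ)).im) := by fun_prop
  obtain ⟨δ, hδ0, hδ⟩ : ∃ δ > 0, ∀ᶠ σ : ℝ in 𝓝 1, δ < -(σ * (current F (Complex.I * σ)).im) := by
    refine ⟨-(1 * (current F (Complex.I * (1 : ℝ))).im) / 2, half_pos h1, ?_⟩
    exact hac.continuousAt.eventually_const_lt (half_lt_self h1)
  obtain ⟨η, hη0, hη⟩ := Metric.eventually_nhds_iff.1 hδ
  -- By compactness and positivity of `W`; the interval is empty when `η > 1`, and then any constant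
  -- will do.
  obtain ⟨w0, hw0, hw⟩ : ∃ w0 > 0, ∀ σ ∈ Icc (0 : ℝ) (1 - η), w0 ≤ Real.pi * cutDensity F σ := by
    rcases (Icc (0 : ℝ) (1 - η)).eq_empty_or_nonempty with he | hne
    · exact ⟨1, one_pos, fun σ hσ => by rw [he] at hσ; exact hσ.elim⟩
    · obtain ⟨σ0, hσ0, hmin⟩ := isCompact_Icc.exists_isMinOn hne
        ((hF.continuous_cutDensity hN).const_mul Real.pi).continuousOn
      refine ⟨Real.pi * cutDensity F σ0, mul_pos Real.pi_pos (hF.cutDensity_pos hN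
        ⟨by linarith [hσ0.1], by linarith [hσ0.2]⟩), fun σ hσ => hmin hσ⟩
  -- One group per case. Near `σ = 1`: `|M| ≥ X + δ`. If `X ≥ 2Gσ`: the average of `|M| ≥ X/2` and
  -- `|M| ≥ w0·σ`. Otherwise: `X + σ ≤ (2G+1)σ` together with `|M| ≥ w0·σ`.
  refine ⟨min (min 1 δ) (min (min (1 / 4) (w0 / 2)) (w0 / (2 * G + 1))), by positivity,
    fun κ hκ σ hσ => ?_⟩
  set X := κ ^ 2 * (1 - σ ^ 2) with hX
  have hX0 : 0 ≤ X := mul_nonneg (sq_nonneg _) (by nlinarith [hσ.1, hσ.2])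
  set c := min (min 1 δ) (min (min (1 / 4) (w0 / 2)) (w0 / (2 * G + 1)))
  have hre := re_dispExt F hκ σ
  have him := hF.im_dispExt hN hκ σ
  set M := dispExt F κ (Complex.I * ((κ * σ : ℝ) : ℂ))
  rw [← hX] at hre
  have hMre := Complex.re_le_norm M
  have hMim := (le_abs_self _).trans (Complex.abs_im_le_norm M)
  have hσ0 := hσ.1
  rcases lt_or_ge (1 - η) σ with hcase | hcase
  · have := hη (y := σ) (by rw [Real.dist_eq, abs_lt]; constructor <;> linarith [hσ.2])
    have hc1 : c ≤ 1 := (min_le_left _ _).trans (min_le_left _ _)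
    have hc2 : c ≤ δ := (min_le_left _ _).trans (min_le_right _ _)
    nlinarith [mul_le_mul_of_nonneg_right hc1 hX0, mul_le_mul_of_nonneg_right hc2 hσ0, hσ.2]
  · have hw' := hw σ ⟨hσ0, hcase⟩
    have hI : w0 * σ ≤ ‖M‖ := by nlinarith [mul_le_mul_of_nonneg_right hw' hσ0]
    have hGσ := hG σ hσ
    rw [Real.norm_eq_abs, abs_le] at hGσ
    have hR : X - G * σ ≤ ‖M‖ := by nlinarith [mul_le_mul_of_nonneg_right hGσ.2 hσ0]
    rcases le_or_gt (2 * G * σ) X with h2 | h2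
    · have hc1 : c ≤ 1 / 4 :=
        (min_le_right _ _).trans ((min_le_left _ _).trans (min_le_left _ _))
      have hc2 : c ≤ w0 / 2 :=
        (min_le_right _ _).trans ((min_le_left _ _).trans (min_le_right _ _))
      nlinarith [mul_le_mul_of_nonneg_right hc1 hX0, mul_le_mul_of_nonneg_right hc2 hσ0]
    · have hc3 : c ≤ w0 / (2 * G + 1) := (min_le_right _ _).trans (min_le_right _ _)
      have hs : 0 ≤ X + σ := by linarith
      calc c * (X + σ) ≤ w0 / (2 * G + 1) * (X + σ) := mul_le_mul_of_nonneg_right hc3 hs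
        _ ≤ w0 / (2 * G + 1) * ((2 * G + 1) * σ) := by gcongr; linarith
        _ = w0 * σ := by field_simp
        _ ≤ ‖M‖ := hI

end

/-! ### The undamped frequencies -/

section

variable {F : ℂ → ℂ} {N₀ : ℕ}

/-- `∫ W(u) u^{2a} (1 - s u²)^{-b} du`. -/
def specInt (F : ℂ → ℂ) (a b : ℕ) (s : ℝ) : ℝ :=
  ∫ u, cutDensity F u * (u ^ (2 * a) * ((1 - s * u ^ 2)⁻¹) ^ b)

/-- Negative `s` is admitted on purpose: the point `s = 0`, which corresponds to `k = 0`, has to be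
interior to the domain on which the spectral integrals are smooth. -/
theorem one_sub_mul_sq_ge {u s r : ℝ} (hu : u ∈ Ioo (-1 : ℝ) 1) (hr : r ≤ 1)
    (hs : s ≤ 1 - r) : r ≤ 1 - s * u ^ 2 := by
  have h1 := one_sub_sq_pos hu
  nlinarith [sq_nonneg u, mul_nonneg (sub_nonneg.2 hr) h1.le]

theorem pow_abs_le_one_of_mem {u : ℝ} (hu : u ∈ Ioo (-1 : ℝ) 1) (a : ℕ) : |u ^ a| ≤ 1 := by
  rw [abs_pow]; exact pow_le_one₀ (abs_nonneg _) (abs_lt_one_of_mem hu).le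

theorem IsAdmissible.specInt_bound (hF : IsAdmissible F N₀) (hN : 11 ≤ N₀) (a b : ℕ) {s r : ℝ}
    (hr : 0 < r) (hr1 : r ≤ 1) (hs : s ≤ 1 - r) (u : ℝ) :
    ‖cutDensity F u * (u ^ (2 * a) * ((1 - s * u ^ 2)⁻¹) ^ b)‖ ≤ cutDensity F u * (r⁻¹) ^ b := by
  by_cases hu : u ∈ Ioo (-1 : ℝ) 1
  · have h0 := hF.cutDensity_nonneg hN u
    rw [norm_mul, Real.norm_eq_abs, abs_of_nonneg h0]
    refine mul_le_mul_of_nonneg_left ?_ h0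
    rw [norm_mul, norm_pow (1 - s * u ^ 2)⁻¹, norm_inv, Real.norm_eq_abs, Real.norm_eq_abs]
    have h1 := one_sub_mul_sq_ge hu hr1 hs
    have hp : 0 < 1 - s * u ^ 2 := hr.trans_le h1
    rw [abs_of_pos hp]
    calc _ ≤ 1 * (r⁻¹) ^ b := by
          refine mul_le_mul (pow_abs_le_one_of_mem hu _) ?_ (by positivity) zero_le_one
          gcongr
      _ = _ := one_mul _
  · rw [cutDensity_of_notMem F hu]; simp

theorem IsAdmissible.integrable_specInt (hF : IsAdmissible F N₀) (hN : 11 ≤ N₀) (a b : ℕ) {s : ℝ}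
    (hs : s < 1) :
    Integrable fun u => cutDensity F u * (u ^ (2 * a) * ((1 - s * u ^ 2)⁻¹) ^ b) := by
  have hc := (hF.continuous_cutDensity hN).measurable
  exact ((hF.integrable_cutDensity hN).mul_const _).mono'
    (Measurable.aestronglyMeasurable (by fun_prop))
    (ae_of_all _ fun u => hF.specInt_bound hN a b (r := min 1 (1 - s)) (lt_min one_pos (by linarith))
      (min_le_left _ _) (by linarith [min_le_right 1 (1 - s)]) u)

/-- Differentiation in `s` raises both indices, so the family is closed under it and every member is
smooth for `s < 1`. -/
theorem IsAdmissible.hasDerivAt_specInt (hF : IsAdmissible F N₀) (hN : 11 ≤ N₀) (a b : ℕ) {s : ℝ}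
    (hs : s < 1) : HasDerivAt (specInt F a b) (b * specInt F (a + 1) (b + 1) s) s := by
  have hc := (hF.continuous_cutDensity hN).measurable
  set r := min 1 ((1 - s) / 2) with hr
  have hr0 : 0 < r := lt_min one_pos (by linarith)
  have hr1 : r ≤ 1 := min_le_left _ _
  have hr2 : r ≤ (1 - s) / 2 := min_le_right _ _
  have h := hasDerivAt_integral_of_dominated_loc_of_deriv_le (μ := volume) (𝕜 := ℝ)
    (F := fun s u => cutDensity F u * (u ^ (2 * a) * ((1 - s * u ^ 2)⁻¹) ^ b))
    (F' := fun s u => b * (cutDensity F u * (u ^ (2 * (a + 1)) * ((1 - s * u ^ 2)⁻¹) ^ (b + 1))))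
    (x₀ := s) (s := Metric.ball s r) (bound := fun u => b * (cutDensity F u * (r⁻¹) ^ (b + 1)))
    (Metric.ball_mem_nhds _ hr0) (Eventually.of_forall fun q =>
      Measurable.aestronglyMeasurable (by fun_prop)) (hF.integrable_specInt hN a b hs)
    (Measurable.aestronglyMeasurable (by fun_prop)) ?_
    (((hF.integrable_cutDensity hN).mul_const _).const_mul _) ?_
  · rw [specInt, ← integral_const_mul]; exact h.2
  · refine ae_of_all _ fun u q hq => ?_
    rw [norm_mul, Real.norm_natCast]
    refine mul_le_mul_of_nonneg_left (hF.specInt_bound hN (a + 1) (b + 1) hr0 hr1 ?_ u) (by positivity)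
    rw [Metric.mem_ball, Real.dist_eq, abs_lt] at hq
    linarith [hq.2]
  · refine ae_of_all _ fun u q hq => ?_
    by_cases hu : u ∈ Ioo (-1 : ℝ) 1
    · rw [Metric.mem_ball, Real.dist_eq, abs_lt] at hq
      have hne : 1 - q * u ^ 2 ≠ 0 :=
        (hr0.trans_le (one_sub_mul_sq_ge hu hr1 (by linarith [hq.2]))).ne'
      have h1 : HasDerivAt (fun q : ℝ => 1 - q * u ^ 2) (-(u ^ 2)) q := by
        simpa using ((hasDerivAt_id q).mul_const (u ^ 2)).const_sub 1
      have h2 := (((h1.fun_inv hne).fun_pow b).const_mul (u ^ (2 * a))).const_mul (cutDensity F u)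
      refine h2.congr_deriv ?_
      rcases b with _ | b
      · simp
      · simp only [Nat.add_sub_cancel]
        rw [div_eq_mul_inv, ← inv_pow]
        push_cast
        ring
    · simp only [cutDensity_of_notMem F hu, zero_mul, mul_zero]
      exact hasDerivAt_const _ _

theorem IsAdmissible.contDiffOn_specInt (hF : IsAdmissible F N₀) (hN : 11 ≤ N₀) (n : ℕ) :
    ∀ a b : ℕ, ContDiffOn ℝ n (specInt F a b) (Iio 1) := by
  induction n with
  | zero => exact fun a b => contDiffOn_zero.2 fun s hs =>
      (hF.hasDerivAt_specInt hN a b hs).continuousAt.continuousWithinAt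
  | succ n ih =>
    intro a b
    have : ContDiffOn ℝ ((n : WithTop ℕ∞) + 1) (specInt F a b) (Iio 1) := by
      refine (contDiffOn_succ_iff_deriv_of_isOpen isOpen_Iio).2 ⟨fun s hs =>
        (hF.hasDerivAt_specInt hN a b hs).differentiableAt.differentiableWithinAt, by simp, ?_⟩
      exact (contDiffOn_const.mul (ih (a + 1) (b + 1))).congr fun s hs =>
        (hF.hasDerivAt_specInt hN a b hs).deriv
    exact_mod_cast this

theorem IsAdmissible.contDiffAt_specInt (hF : IsAdmissible F N₀) (hN : 11 ≤ N₀) (a b : ℕ) {s : ℝ}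
    (hs : s < 1) : ContDiffAt ℝ ∞ (specInt F a b) s :=
  (contDiffOn_infty.2 fun n => hF.contDiffOn_specInt hN n a b).contDiffAt (Iio_mem_nhds hs)

theorem IsAdmissible.specInt_pos (hF : IsAdmissible F N₀) (hN : 11 ≤ N₀) (b : ℕ) {s : ℝ}
    (hs : s < 1) : 0 < specInt F 0 b s := by
  have hpos : ∀ u ∈ Ioo (-1 : ℝ) 1, 0 < 1 - s * u ^ 2 := fun u hu =>
    (lt_min one_pos (by linarith : 0 < 1 - s)).trans_le (one_sub_mul_sq_ge hu
      (min_le_left _ _)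
      (by linarith [min_le_right 1 (1 - s)]))
  have hnn : ∀ u, 0 ≤ cutDensity F u * (u ^ (2 * 0) * ((1 - s * u ^ 2)⁻¹) ^ b) := by
    intro u
    by_cases hu : u ∈ Ioo (-1 : ℝ) 1
    · have := hF.cutDensity_nonneg hN u
      have := hpos u hu
      simp only [mul_zero, pow_zero, one_mul]
      positivity
    · rw [cutDensity_of_notMem F hu, zero_mul]
  rw [specInt, integral_pos_iff_support_of_nonneg hnn (hF.integrable_specInt hN 0 b hs)]
  refine lt_of_lt_of_le ?_ (measure_mono (s := Ioo (-1 : ℝ) 1) fun u hu => ?_)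
  · simp
  · rw [Function.mem_support]
    have h1 := hF.cutDensity_pos hN hu
    have h2 := hpos u hu
    simp only [mul_zero, pow_zero, one_mul]
    positivity

theorem IsAdmissible.specInt_nonneg (hF : IsAdmissible F N₀) (hN : 11 ≤ N₀) (a b : ℕ) {s : ℝ}
    (hs : s < 1) : 0 ≤ specInt F a b s := by
  refine integral_nonneg fun u => ?_
  by_cases hu : u ∈ Ioo (-1 : ℝ) 1
  · have := hF.cutDensity_nonneg hN u
    have : 0 < 1 - s * u ^ 2 := (lt_min one_pos (by linarith : 0 < 1 - s)).trans_le
      (one_sub_mul_sq_ge hu (min_le_left _ _)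
      (by linarith [min_le_right 1 (1 - s)]))
    have h3 : 0 ≤ u ^ (2 * a) := by rw [pow_mul]; positivity
    simp only [Pi.zero_apply]
    positivity
  · simp [cutDensity_of_notMem F hu]

theorem IsAdmissible.specInt_zero_le (hF : IsAdmissible F N₀) (hN : 11 ≤ N₀) {s : ℝ}
    (hs0 : 0 ≤ s) (hs : s < 1) : specInt F 0 1 0 ≤ specInt F 0 1 s := by
  refine integral_mono (hF.integrable_specInt hN 0 1 zero_lt_one) (hF.integrable_specInt hN 0 1 hs)
    fun u => ?_
  by_cases hu : u ∈ Ioo (-1 : ℝ) 1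
  · refine mul_le_mul_of_nonneg_left ?_ (hF.cutDensity_nonneg hN u)
    have h1 := one_sub_mul_sq_ge hu (r := 1 - s) (s := s) (by linarith) (by linarith)
    have h2 : 1 - s * u ^ 2 ≤ 1 := by nlinarith [sq_nonneg u, mul_nonneg hs0 (sq_nonneg u)]
    simp only [mul_zero, pow_zero, one_mul, pow_one, zero_mul, sub_zero, inv_one]
    exact (one_le_inv₀ (by linarith)).2 h2
  · simp [cutDensity_of_notMem F hu]

/-- The squared wave number as a function of `s = κ² / ν²`. -/
def waveSq (F : ℂ → ℂ) (s : ℝ) : ℝ := s * specInt F 0 1 s / (1 - s)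

/-- The derivative of `waveSq`. -/
def waveSqDeriv (F : ℂ → ℂ) (s : ℝ) : ℝ :=
  (specInt F 0 1 s + s * (1 - s) * specInt F 1 2 s) / (1 - s) ^ 2

theorem IsAdmissible.hasDerivAt_waveSq (hF : IsAdmissible F N₀) (hN : 11 ≤ N₀) {s : ℝ}
    (hs : s < 1) : HasDerivAt (waveSq F) (waveSqDeriv F s) s := by
  have h1 := hF.hasDerivAt_specInt hN 0 1 hs
  have h2 : HasDerivAt (fun s : ℝ => 1 - s) (-1) s := by simpa using (hasDerivAt_id s).const_sub 1
  have hne : 1 - s ≠ 0 := by linarith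
  refine (((hasDerivAt_id s).mul h1).div h2 hne).congr_deriv ?_
  rw [waveSqDeriv]
  simp
  ring

theorem IsAdmissible.waveSqDeriv_pos (hF : IsAdmissible F N₀) (hN : 11 ≤ N₀) {s : ℝ}
    (hs : s ∈ Ico (0 : ℝ) 1) : 0 < waveSqDeriv F s := by
  have h1 := hF.specInt_pos hN 1 hs.2
  have h2 := hF.specInt_nonneg hN 1 2 hs.2
  have h3 : 0 < 1 - s := by linarith [hs.2]
  have h4 := hs.1
  unfold waveSqDeriv
  positivity

theorem IsAdmissible.strictMonoOn_waveSq (hF : IsAdmissible F N₀) (hN : 11 ≤ N₀) :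
    StrictMonoOn (waveSq F) (Ico 0 1) := by
  refine strictMonoOn_of_deriv_pos (convex_Ico 0 1) (fun s hs =>
    (hF.hasDerivAt_waveSq hN hs.2).continuousAt.continuousWithinAt) fun s hs => ?_
  rw [interior_Ico] at hs
  rw [(hF.hasDerivAt_waveSq hN hs.2).deriv]
  exact hF.waveSqDeriv_pos hN ⟨hs.1.le, hs.2⟩

theorem IsAdmissible.exists_waveSq_eq (hF : IsAdmissible F N₀) (hN : 11 ≤ N₀) {q : ℝ}
    (hq : 0 ≤ q) : ∃ s ∈ Ico (0 : ℝ) 1, waveSq F s = q := by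
  set J := specInt F 0 1 0
  have hJ : 0 < J := hF.specInt_pos hN 1 zero_lt_one
  -- Chosen so that `s₁J/(1-s₁) = q + 1`. Since `J(s₁) ≥ J(0)`, the wave number function exceeds `q`
  -- there and the intermediate value theorem applies.
  set s1 := (q + 1) / (q + 1 + J) with hs1
  have h0 : 0 ≤ s1 := by positivity
  have h1 : s1 < 1 := by rw [hs1, div_lt_one (by positivity)]; linarith
  have hle : q ≤ waveSq F s1 := by
    have h2 := hF.specInt_zero_le hN h0 h1
    have h3 : 0 < 1 - s1 := by linarith
    have h4 : 1 - s1 = J / (q + 1 + J) := by rw [hs1]; field_simp; ring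
    rw [waveSq, le_div_iff₀ h3]
    have h5 : s1 * J ≤ s1 * specInt F 0 1 s1 := mul_le_mul_of_nonneg_left h2 h0
    refine le_trans ?_ h5
    rw [h4, hs1, mul_div_assoc', div_mul_eq_mul_div]
    gcongr
    linarith
  have hcont : ContinuousOn (waveSq F) (Icc 0 s1) := fun s hs =>
    (hF.hasDerivAt_waveSq hN (hs.2.trans_lt h1)).continuousAt.continuousWithinAt
  obtain ⟨s, hs, hsq⟩ := intermediate_value_Icc h0 hcont (show q ∈ Icc (waveSq F 0) (waveSq F s1) from
    ⟨by simpa [waveSq] using hq, hle⟩)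
  exact ⟨s, ⟨hs.1, hs.2.trans_lt h1⟩, hsq⟩

open Classical in
/-- The ratio `κ² / ν²` as a function of `q = κ²`. -/
def specRatio (F : ℂ → ℂ) (q : ℝ) : ℝ :=
  if h : ∃ s ∈ Ico (0 : ℝ) 1, waveSq F s = q then h.choose else 0

theorem IsAdmissible.specRatio_spec (hF : IsAdmissible F N₀) (hN : 11 ≤ N₀) {q : ℝ} (hq : 0 ≤ q) :
    specRatio F q ∈ Ico (0 : ℝ) 1 ∧ waveSq F (specRatio F q) = q := by
  rw [specRatio, dif_pos (hF.exists_waveSq_eq hN hq)]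
  exact (hF.exists_waveSq_eq hN hq).choose_spec

theorem IsAdmissible.contDiffAt_waveSq (hF : IsAdmissible F N₀) (hN : 11 ≤ N₀) {s : ℝ}
    (hs : s < 1) : ContDiffAt ℝ ∞ (waveSq F) s :=
  (contDiffAt_id.mul (hF.contDiffAt_specInt hN 0 1 hs)).div (contDiffAt_const.sub contDiffAt_id)
    (sub_pos.2 hs).ne'

/-- `specRatio` inverts `waveSq` only for `q ≥ 0`. The inverse function theorem at the parameter of
`q₀` supplies a branch that is smooth on a full neighbourhood, even when `q₀ = 0`. -/
theorem IsAdmissible.exists_smooth_specRatio (hF : IsAdmissible F N₀) (hN : 11 ≤ N₀) {q₀ : ℝ}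
    (hq₀ : 0 ≤ q₀) : ∃ l : ℝ → ℝ, ContDiffAt ℝ ∞ l q₀ ∧ l q₀ = specRatio F q₀ ∧
      ∀ᶠ q in 𝓝 q₀, 0 ≤ q → specRatio F q = l q := by
  obtain ⟨hs, hsq⟩ := hF.specRatio_spec hN hq₀
  set s₀ := specRatio F q₀
  have hcd := hF.contDiffAt_waveSq hN hs.2
  have hpos := hF.waveSqDeriv_pos hN hs
  have hd : HasFDerivAt (waveSq F) ((ContinuousLinearEquiv.unitsEquivAut ℝ
      (Units.mk0 _ hpos.ne') : ℝ ≃L[ℝ] ℝ) : ℝ →L[ℝ] ℝ) s₀ := by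
    have := (hF.hasDerivAt_waveSq hN hs.2).hasFDerivAt
    exact this.congr_fderiv (by ext; simp)
  have hstrict := hcd.hasStrictFDerivAt' hd (by simp)
  let l := hcd.localInverse hd (by simp)
  have hl : ContDiffAt ℝ ∞ l (waveSq F s₀) := hcd.to_localInverse hd (by simp)
  have hl0 : l (waveSq F s₀) = s₀ := hcd.localInverse_apply_image hd (by simp)
  have hright : ∀ᶠ q in 𝓝 (waveSq F s₀), waveSq F (l q) = q :=
    hstrict.eventually_right_inverse
  rw [hsq] at hl hl0 hright
  refine ⟨l, hl, hl0, ?_⟩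
  have hlt : ∀ᶠ q in 𝓝 q₀, l q ∈ Iio (1 : ℝ) := by
    refine hl.continuousAt.eventually ?_
    rw [hl0]
    exact Iio_mem_nhds hs.2
  filter_upwards [hright, hlt] with q h1 h2 hq
  obtain ⟨h3, h4⟩ := hF.specRatio_spec hN hq
  -- `waveSq` is negative for negative arguments, so the smooth branch takes values in `[0,1)` over
  -- `q ≥ 0`, and injectivity there identifies it with `specRatio`.
  have h5 : 0 ≤ l q := by
    by_contra hneg
    have h6 := hF.specInt_pos hN 1 (h2 : l q < 1)
    have h7 : waveSq F (l q) < 0 := by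
      rw [waveSq]
      refine div_neg_of_neg_of_pos (mul_neg_of_neg_of_pos (not_le.1 hneg) h6) ?_
      have : l q < 1 := h2
      linarith
    rw [h1] at h7
    linarith
  exact (hF.strictMonoOn_waveSq hN).injOn h3 ⟨h5, h2⟩ (h4.trans h1.symm)

/-- Smoothness at `k = 0` holds because `|k|²`, unlike `|k|`, is smooth there. -/
theorem IsAdmissible.contDiff_comp_specRatio (hF : IsAdmissible F N₀) (hN : 11 ≤ N₀) {Φ : ℝ → ℝ}
    (hΦ : ∀ s ∈ Ico (0 : ℝ) 1, ContDiffAt ℝ ∞ Φ s) :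
    ContDiff ℝ ∞ fun k : R3 => Φ (specRatio F (‖k‖ ^ 2)) := by
  rw [contDiff_iff_contDiffAt]
  intro k
  obtain ⟨l, hl, hl0, hev⟩ := hF.exists_smooth_specRatio hN (sq_nonneg ‖k‖)
  have hmem := (hF.specRatio_spec hN (sq_nonneg ‖k‖)).1
  have hn : ContDiffAt ℝ ∞ (fun k : R3 => ‖k‖ ^ 2) k := (contDiff_norm_sq ℝ).contDiffAt
  have h1 : ContDiffAt ℝ ∞ (fun k : R3 => Φ (l (‖k‖ ^ 2))) k := by
    refine ContDiffAt.comp (g := Φ) (f := fun k : R3 => l (‖k‖ ^ 2)) k ?_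
      (ContDiffAt.comp (g := l) (f := fun k : R3 => ‖k‖ ^ 2) k hl hn)
    rw [hl0]
    exact hΦ _ hmem
  refine h1.congr_of_eventuallyEq ?_
  filter_upwards [hn.continuousAt.eventually hev] with k' hk'
  rw [hk' (sq_nonneg _)]

/-- The squared frequency `ν²` in terms of `s`. -/
def freqSq (F : ℂ → ℂ) (s : ℝ) : ℝ := specInt F 0 1 s / (1 - s)

/-- The frequency `ν(r)`. -/
def freq (F : ℂ → ℂ) (r : ℝ) : ℝ := √(freqSq F (specRatio F (r ^ 2)))

/-- The residue of `1 / M` at `λ² = -ν²`, as a function of `λ²` and with `s = κ² / ν²`. -/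
def residue (F : ℂ → ℂ) (s : ℝ) : ℝ :=
  specInt F 0 1 s / (specInt F 0 1 s + s * (1 - s) * specInt F 1 2 s)

/-- The modulus of the amplitudes. -/
def amplitude (F : ℂ → ℂ) (s : ℝ) : ℝ := residue F s / (2 * √(freqSq F s))

theorem IsAdmissible.freqSq_pos (hF : IsAdmissible F N₀) (hN : 11 ≤ N₀) {s : ℝ} (hs : s < 1) :
    0 < freqSq F s := div_pos (hF.specInt_pos hN 1 hs) (by linarith)

theorem IsAdmissible.freq_sq (hF : IsAdmissible F N₀) (hN : 11 ≤ N₀) (r : ℝ) :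
    freq F r ^ 2 = freqSq F (specRatio F (r ^ 2)) :=
  Real.sq_sqrt (hF.freqSq_pos hN (hF.specRatio_spec hN (sq_nonneg r)).1.2).le

theorem IsAdmissible.freq_pos (hF : IsAdmissible F N₀) (hN : 11 ≤ N₀) (r : ℝ) : 0 < freq F r :=
  Real.sqrt_pos.2 (hF.freqSq_pos hN (hF.specRatio_spec hN (sq_nonneg r)).1.2)

/-- `κ² = s ν²`. -/
theorem IsAdmissible.sq_eq_specRatio_mul (hF : IsAdmissible F N₀) (hN : 11 ≤ N₀) (r : ℝ) :
    r ^ 2 = specRatio F (r ^ 2) * freq F r ^ 2 := by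
  have h := (hF.specRatio_spec hN (sq_nonneg r)).2
  rw [hF.freq_sq hN, freqSq]
  nth_rewrite 1 [← h]
  rw [waveSq, mul_div_assoc]

/-- `ν² = κ² + J(s)`. -/
theorem IsAdmissible.freq_sq_eq_add (hF : IsAdmissible F N₀) (hN : 11 ≤ N₀) (r : ℝ) :
    freq F r ^ 2 = r ^ 2 + specInt F 0 1 (specRatio F (r ^ 2)) := by
  have h := hF.sq_eq_specRatio_mul hN r
  have h1 : 0 < 1 - specRatio F (r ^ 2) := by
    linarith [(hF.specRatio_spec hN (sq_nonneg r)).1.2]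
  have h2 : freq F r ^ 2 * (1 - specRatio F (r ^ 2)) = specInt F 0 1 (specRatio F (r ^ 2)) := by
    rw [hF.freq_sq hN, freqSq, div_mul_cancel₀ _ h1.ne']
  linarith

theorem IsAdmissible.lt_freq (hF : IsAdmissible F N₀) (hN : 11 ≤ N₀) (r : ℝ) : r < freq F r := by
  have h := hF.freq_sq_eq_add hN r
  have h2 := hF.specInt_pos hN 1 (hF.specRatio_spec hN (sq_nonneg r)).1.2
  exact lt_of_pow_lt_pow_left₀ 2 (hF.freq_pos hN r).le (by linarith)

theorem IsAdmissible.residue_mem (hF : IsAdmissible F N₀) (hN : 11 ≤ N₀) {s : ℝ}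
    (hs : s ∈ Ico (0 : ℝ) 1) : residue F s ∈ Ioc (0 : ℝ) 1 := by
  have h1 := hF.specInt_pos hN 1 hs.2
  have h2 := hF.specInt_nonneg hN 1 2 hs.2
  have h3 : 0 < 1 - s := by linarith [hs.2]
  have h4 := hs.1
  have h5 : 0 ≤ s * (1 - s) * specInt F 1 2 s := by positivity
  refine ⟨by unfold residue; positivity, ?_⟩
  rw [residue, div_le_one (by linarith)]
  linarith

theorem IsAdmissible.contDiffAt_amplitude (hF : IsAdmissible F N₀) (hN : 11 ≤ N₀) {s : ℝ}
    (hs : s ∈ Ico (0 : ℝ) 1) : ContDiffAt ℝ ∞ (amplitude F) s := by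
  have hJ := hF.contDiffAt_specInt hN 0 1 hs.2
  have hK := hF.contDiffAt_specInt hN 1 2 hs.2
  have h1 := hF.specInt_pos hN 1 hs.2
  have h2 := hF.specInt_nonneg hN 1 2 hs.2
  have h3 : 0 < 1 - s := by linarith [hs.2]
  have h4 := hs.1
  have h5 : 0 ≤ s * (1 - s) * specInt F 1 2 s := by positivity
  have hy := hF.freqSq_pos hN hs.2
  have hsub : ContDiffAt ℝ ∞ (fun s : ℝ => 1 - s) s := contDiffAt_const.sub contDiffAt_id
  have hfreq : ContDiffAt ℝ ∞ (freqSq F) s := hJ.div hsub h3.ne'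
  have hres : ContDiffAt ℝ ∞ (residue F) s :=
    hJ.div (hJ.add ((contDiffAt_id.mul hsub).mul hK)) 
      (by linarith : 0 < specInt F 0 1 s + s * (1 - s) * specInt F 1 2 s).ne'
  exact hres.div (contDiffAt_const.mul (hfreq.sqrt hy.ne')) (by positivity)

/-- The residue is at most `1`, and `ν² = κ² + J(s) ≥ κ² + J(0) ≥ min(1, J(0))⟨κ⟩²`. -/
theorem IsAdmissible.exists_amplitude_le (hF : IsAdmissible F N₀) (hN : 11 ≤ N₀) :
    ∃ C : ℝ, ∀ r : ℝ, |amplitude F (specRatio F (r ^ 2))| ≤ C * (jap r)⁻¹ := by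
  set J := specInt F 0 1 0
  have hJ : 0 < J := hF.specInt_pos hN 1 zero_lt_one
  set c := √(min 1 J) with hc
  have hc0 : 0 < c := Real.sqrt_pos.2 (lt_min one_pos hJ)
  refine ⟨(2 * c)⁻¹, fun r => ?_⟩
  obtain ⟨hs, -⟩ := hF.specRatio_spec hN (sq_nonneg r)
  have hB := hF.residue_mem hN hs
  have hν := hF.freq_pos hN r
  have hle : c * jap r ≤ freq F r := by
    rw [jap, hc, ← Real.sqrt_mul (lt_min one_pos hJ).le]
    refine Real.sqrt_le_sqrt ?_
    rw [← hF.freq_sq hN, hF.freq_sq_eq_add hN]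
    have h1 := hF.specInt_zero_le hN hs.1 hs.2
    have h2 := min_le_left 1 J
    have h3 := min_le_right 1 J
    nlinarith [sq_nonneg r]
  rw [amplitude, abs_of_nonneg (div_nonneg hB.1.le (by positivity)), ← mul_inv, mul_assoc]
  rw [show √(freqSq F (specRatio F (r ^ 2))) = freq F r from rfl]
  have := jap_pos r
  calc residue F (specRatio F (r ^ 2)) / (2 * freq F r) ≤ 1 / (2 * (c * jap r)) := by
        gcongr
        exact hB.2
    _ = _ := one_div _

end

/-! ### Factorisation of the dispersion function -/

theorem sq_add_sq_ne_zero {p : ℂ} (hp : 0 < p.re) (u : ℝ) : p ^ 2 + (u : ℂ) ^ 2 ≠ 0 := by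
  have h1 := add_I_mul_ne_zero hp u
  have h2 := add_I_mul_ne_zero hp (-u)
  have : p ^ 2 + (u : ℂ) ^ 2 = (p + Complex.I * u) * (p + Complex.I * ((-u : ℝ) : ℂ)) := by
    push_cast
    linear_combination ((u : ℂ) ^ 2) * Complex.I_sq
  rw [this]
  exact mul_ne_zero h1 h2

theorem integrable_div_add_I_mul {f : ℝ → ℂ} (hf : Integrable f) {p : ℂ} (hp : 0 < p.re) :
    Integrable fun u : ℝ => f u / (p + Complex.I * u) := by
  simp only [div_eq_mul_inv]
  refine hf.mul_bdd (c := p.re⁻¹) (Measurable.aestronglyMeasurable (by fun_prop))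
    (ae_of_all _ fun u => ?_)
  rw [norm_inv]
  refine inv_anti₀ hp (le_trans (le_of_eq ?_) (Complex.re_le_norm _))
  simp

/-- By evenness the kernel `p/(p+iu)` may be averaged over `±u`, which gives `p²/(p²+u²)`; the
difference to `1` is `u²/(p²+u²)`. -/
theorem integral_sub_cauchy_of_even {f : ℝ → ℂ} (hf : Integrable f) (he : ∀ u, f (-u) = f u)
    {p : ℂ} (hp : 0 < p.re) :
    (∫ u, f u) - p * ∫ u : ℝ, f u / (p + Complex.I * u)
      = ∫ u : ℝ, (u : ℂ) ^ 2 * f u / (p ^ 2 + (u : ℂ) ^ 2) ∧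
    Integrable fun u : ℝ => (u : ℂ) ^ 2 * f u / (p ^ 2 + (u : ℂ) ^ 2) := by
  have hi := integrable_div_add_I_mul hf hp
  have hneg : ∫ u : ℝ, f u / (p + Complex.I * u) = ∫ u : ℝ, f u / (p + Complex.I * ((-u : ℝ) : ℂ)) := by
    rw [← integral_neg_eq_self]
    simp_rw [he]
  have hi' : Integrable fun u : ℝ => f u / (p + Complex.I * ((-u : ℝ) : ℂ)) := by
    have := hi.comp_neg
    simpa only [he] using this
  have hpt : ∀ u : ℝ, f u - p * (1 / 2 * (f u / (p + Complex.I * u)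
      + f u / (p + Complex.I * ((-u : ℝ) : ℂ)))) = (u : ℂ) ^ 2 * f u / (p ^ 2 + (u : ℂ) ^ 2) := by
    intro u
    have h1 := add_I_mul_ne_zero hp u
    have h2 := add_I_mul_ne_zero hp (-u)
    have h3 := sq_add_sq_ne_zero hp u
    have h4 : p ^ 2 + (u : ℂ) ^ 2 = (p + Complex.I * u) * (p + Complex.I * ((-u : ℝ) : ℂ)) := by
      push_cast
      linear_combination ((u : ℂ) ^ 2) * Complex.I_sq
    have h5 : f u / (p + Complex.I * u) + f u / (p + Complex.I * ((-u : ℝ) : ℂ))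
        = 2 * p * f u / (p ^ 2 + (u : ℂ) ^ 2) := by
      rw [div_add_div _ _ h1 h2, h4]
      congr 1
      push_cast
      ring
    rw [h5]
    field_simp
    ring
  have hadd : Integrable fun u : ℝ => f u / (p + Complex.I * u)
      + f u / (p + Complex.I * ((-u : ℝ) : ℂ)) := hi.add hi'
  have hint := hf.sub ((hadd.const_mul (1 / 2)).const_mul p)
  refine ⟨?_, hint.congr (ae_of_all _ hpt)⟩
  rw [← integral_congr_ae (ae_of_all _ hpt), integral_sub hf
    ((hadd.const_mul (1 / 2)).const_mul p), integral_const_mul, integral_const_mul,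
    integral_add hi hi', ← hneg]
  ring

section

variable {F : ℂ → ℂ} {N₀ : ℕ}

/-- The density `W(u) (1 - s u²)^{-b}`. -/
def specDensity (F : ℂ → ℂ) (s : ℝ) (b : ℕ) (u : ℝ) : ℂ :=
  ((cutDensity F u * ((1 - s * u ^ 2)⁻¹) ^ b : ℝ) : ℂ)

/-- `∫ u² W(u) (1 - s u²)^{-b} / (p² + u²) du`, up to the imaginary axis. -/
def specTrans (F : ℂ → ℂ) (s : ℝ) (b : ℕ) (p : ℂ) : ℂ :=
  (∫ u, specDensity F s b u) - p * cauchyExt (specDensity F s b) p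

theorem specDensity_neg (F : ℂ → ℂ) (s : ℝ) (b : ℕ) (u : ℝ) :
    specDensity F s b (-u) = specDensity F s b u := by
  rw [specDensity, specDensity, cutDensity_neg, neg_sq]

theorem conj_specDensity (F : ℂ → ℂ) (s : ℝ) (b : ℕ) (u : ℝ) :
    (starRingEnd ℂ) (specDensity F s b u) = specDensity F s b u := Complex.conj_ofReal _

theorem hasCompactSupport_specDensity (F : ℂ → ℂ) (s : ℝ) (b : ℕ) :
    HasCompactSupport (specDensity F s b) :=
  hasCompactSupport_of_Ioo fun u hu => by
    rw [specDensity, cutDensity_of_notMem F hu, zero_mul, Complex.ofReal_zero]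

theorem IsAdmissible.contDiff_specDensity (hF : IsAdmissible F N₀) (hN : 11 ≤ N₀) {s : ℝ}
    (hs : s ∈ Ico (0 : ℝ) 1) (b : ℕ) : ContDiff ℝ 2 (specDensity F s b) := by
  rw [contDiff_iff_contDiffAt]
  intro u
  rcases le_or_gt |u| 1 with hu | hu
  · have hne : 1 - s * u ^ 2 ≠ 0 := by
      have : u ^ 2 ≤ 1 := (sq_le_one_iff_abs_le_one u).2 hu
      have h1 := hs.1
      have h2 := hs.2
      nlinarith [mul_le_mul_of_nonneg_left this h1]
    have h1 : ContDiffAt ℝ 2 (fun u : ℝ => 1 - s * u ^ 2) u := by fun_prop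
    have h2 : ContDiffAt ℝ 2 (fun u : ℝ => (((1 - s * u ^ 2)⁻¹) ^ b : ℝ)) u := (h1.inv hne).pow b
    have h3 : ContDiffAt ℝ 2 (fun u : ℝ => ((((1 - s * u ^ 2)⁻¹) ^ b : ℝ) : ℂ)) u :=
      Complex.ofRealCLM.contDiff.contDiffAt.comp u h2
    have := (hF.contDiff_two_cutDensity hN).contDiffAt.mul h3
    refine this.congr_of_eventuallyEq (Eventually.of_forall fun u => ?_)
    simp only [specDensity]
    push_cast; rfl
  · have : specDensity F s b =ᶠ[𝓝 u] fun _ => 0 := by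
      filter_upwards [(isOpen_lt continuous_const continuous_abs).mem_nhds hu] with v hv
      have hv' : v ∉ Ioo (-1 : ℝ) 1 := fun h => absurd (abs_lt_one_of_mem h) (not_lt.2 (le_of_lt hv))
      rw [specDensity, cutDensity_of_notMem F hv', zero_mul, Complex.ofReal_zero]
    exact contDiffAt_const.congr_of_eventuallyEq this

theorem IsAdmissible.integrable_specDensity (hF : IsAdmissible F N₀) (hN : 11 ≤ N₀) {s : ℝ}
    (hs : s ∈ Ico (0 : ℝ) 1) (b : ℕ) : Integrable (specDensity F s b) :=
  (hF.contDiff_specDensity hN hs b).continuous.integrable_of_hasCompactSupport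
    (hasCompactSupport_specDensity F s b)

theorem IsAdmissible.continuousOn_specTrans (hF : IsAdmissible F N₀) (hN : 11 ≤ N₀) {s : ℝ}
    (hs : s ∈ Ico (0 : ℝ) 1) (b : ℕ) : ContinuousOn (specTrans F s b) {p : ℂ | 0 ≤ p.re} :=
  continuousOn_const.sub (continuousOn_id.mul (continuousOn_cauchyExt
    (integrable_fourier (hF.contDiff_specDensity hN hs b) (hasCompactSupport_specDensity F s b))
    (continuous_fourier_of_integrable (hF.integrable_specDensity hN hs b))))

theorem IsAdmissible.differentiableOn_specTrans (hF : IsAdmissible F N₀) (hN : 11 ≤ N₀) {s : ℝ}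
    (hs : s ∈ Ico (0 : ℝ) 1) (b : ℕ) : DifferentiableOn ℂ (specTrans F s b) {p : ℂ | 0 < p.re} :=
  (differentiableOn_const _).sub (differentiableOn_id.mul
    ((differentiableOn_cauchyIntegral (hF.integrable_specDensity hN hs b)).congr fun _ hp =>
      cauchyExt_eq_integral (hF.integrable_specDensity hN hs b) hp))

theorem IsAdmissible.specTrans_eq (hF : IsAdmissible F N₀) (hN : 11 ≤ N₀) {s : ℝ}
    (hs : s ∈ Ico (0 : ℝ) 1) (b : ℕ) {p : ℂ} (hp : 0 < p.re) :
    specTrans F s b p = ∫ u : ℝ, (u : ℂ) ^ 2 * specDensity F s b u / (p ^ 2 + (u : ℂ) ^ 2) := by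
  rw [specTrans, cauchyExt_eq_integral (hF.integrable_specDensity hN hs b) hp]
  exact (integral_sub_cauchy_of_even (hF.integrable_specDensity hN hs b) (specDensity_neg F s b) hp).1

theorem conj_specTrans (F : ℂ → ℂ) (s : ℝ) (b : ℕ) (p : ℂ) :
    (starRingEnd ℂ) (specTrans F s b p) = specTrans F s b ((starRingEnd ℂ) p) := by
  simp only [specTrans, map_sub, map_mul, ← integral_conj, conj_specDensity,
    conj_cauchyExt (specDensity_neg F s b) (conj_specDensity F s b)]

/-- Pointwise this is `1 + sp² = (1 - su²) + s(p² + u²)`. As `1 + sp²` is proportional to `z² + ν²`,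
raising `b` by one amounts to dividing out the pole factor, with no quotient that is singular at the
pole. -/
theorem IsAdmissible.specTrans_succ (hF : IsAdmissible F N₀) (hN : 11 ≤ N₀) {s : ℝ}
    (hs : s ∈ Ico (0 : ℝ) 1) (b : ℕ) {p : ℂ} (hp : 0 < p.re) :
    (1 + s * p ^ 2) * specTrans F s (b + 1) p
      = specTrans F s b p + s * (specInt F 1 (b + 1) s : ℂ) := by
  have hi : Integrable fun u : ℝ => (s : ℂ) *
      ((cutDensity F u * (u ^ (2 * 1) * ((1 - s * u ^ 2)⁻¹) ^ (b + 1)) : ℝ) : ℂ) :=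
    Integrable.const_mul (hF.integrable_specInt hN 1 (b + 1) hs.2).ofReal _
  rw [hF.specTrans_eq hN hs _ hp, hF.specTrans_eq hN hs _ hp, specInt, ← integral_complex_ofReal,
    ← integral_const_mul, ← integral_const_mul, ← integral_add
    (integral_sub_cauchy_of_even (hF.integrable_specDensity hN hs b) (specDensity_neg F s b) hp).2 hi]
  refine integral_congr_ae (ae_of_all _ fun u => ?_)
  simp only [specDensity]
  by_cases hu : u ∈ Ioo (-1 : ℝ) 1
  · have h1 := sq_add_sq_ne_zero hp u
    have h2 : (1 - (s : ℂ) * (u : ℂ) ^ 2) ≠ 0 := by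
      have h3 := one_sub_mul_sq_ge hu (r := 1 - s) (s := s) (by linarith [hs.1]) (by linarith)
      have h4 : (1 - s * u ^ 2 : ℝ) ≠ 0 := by have := hs.2; intro h; linarith
      exact_mod_cast h4
    push_cast
    obtain ⟨v, hv⟩ : ∃ v, v = (1 - (s : ℂ) * (u : ℂ) ^ 2)⁻¹ := ⟨_, rfl⟩
    have hv1 : v * (1 - (s : ℂ) * (u : ℂ) ^ 2) = 1 := by rw [hv, inv_mul_cancel₀ h2]
    rw [← hv, pow_succ]
    field_simp
    linear_combination (u : ℂ) ^ 2 * cutDensity F u * v ^ b * hv1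
  · simp [cutDensity_of_notMem F hu]

/-- For `|p| ≥ 2` and `|u| < 1` one has `|p² + u²| ≥ |p|²/2`. This decay makes the remainder
integrable on vertical lines. -/
theorem IsAdmissible.norm_specTrans_le (hF : IsAdmissible F N₀) (hN : 11 ≤ N₀) {s : ℝ}
    (hs : s ∈ Ico (0 : ℝ) 1) (b : ℕ) {p : ℂ} (hp : 0 < p.re) (hp2 : 2 ≤ ‖p‖) :
    ‖specTrans F s b p‖ ≤ 2 * (∫ u, ‖specDensity F s b u‖) / ‖p‖ ^ 2 := by
  rw [hF.specTrans_eq hN hs b hp, mul_div_right_comm, ← integral_const_mul]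
  refine norm_integral_le_of_norm_le ((hF.integrable_specDensity hN hs b).norm.const_mul _)
    (ae_of_all _ fun u => ?_)
  by_cases hu : u ∈ Ioo (-1 : ℝ) 1
  · have hu1 : u ^ 2 ≤ 1 := by linarith [one_sub_sq_pos hu]
    have hlow : ‖p‖ ^ 2 / 2 ≤ ‖p ^ 2 + (u : ℂ) ^ 2‖ := by
      have := norm_sub_le_norm_add (p ^ 2) ((u : ℂ) ^ 2)
      rw [norm_pow, norm_pow, Complex.norm_real, Real.norm_eq_abs, sq_abs] at this
      nlinarith
    have hp0 : 0 < ‖p‖ := by linarith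
    rw [norm_div, norm_mul, norm_pow, Complex.norm_real, Real.norm_eq_abs, sq_abs]
    calc u ^ 2 * ‖specDensity F s b u‖ / ‖p ^ 2 + (u : ℂ) ^ 2‖
        ≤ 1 * ‖specDensity F s b u‖ / (‖p‖ ^ 2 / 2) := by gcongr
      _ = _ := by field_simp
  · have : specDensity F s b u = 0 := by simp [specDensity, cutDensity_of_notMem F hu]
    simp [this]

/-- `M(λ, k) / (λ² + ν²)` as a function of `p = λ / κ`. -/
def reduced (F : ℂ → ℂ) (κ : ℝ) (p : ℂ) : ℂ :=
  1 - ((freq F κ ^ 2 : ℝ) : ℂ)⁻¹ * specTrans F (specRatio F (κ ^ 2)) 1 p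

theorem IsAdmissible.specRatio_mem (hF : IsAdmissible F N₀) (hN : 11 ≤ N₀) (κ : ℝ) :
    specRatio F (κ ^ 2) ∈ Ico (0 : ℝ) 1 := (hF.specRatio_spec hN (sq_nonneg κ)).1

theorem closure_rightHalfPlane : {z : ℂ | 0 ≤ z.re} ⊆ closure {z : ℂ | 0 < z.re} := by
  rw [Complex.closure_setOfPred_lt_re]

theorem IsAdmissible.continuousOn_reduced (hF : IsAdmissible F N₀) (hN : 11 ≤ N₀) (κ : ℝ) :
    ContinuousOn (reduced F κ) {p : ℂ | 0 ≤ p.re} :=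
  continuousOn_const.sub (continuousOn_const.mul
    (hF.continuousOn_specTrans hN (hF.specRatio_mem hN κ) 1))

theorem continuousOn_div_ofReal {f : ℂ → ℂ} (hf : ContinuousOn f {p : ℂ | 0 ≤ p.re}) {κ : ℝ}
    (hκ : 0 < κ) : ContinuousOn (fun z : ℂ => f (z / κ)) {z : ℂ | 0 ≤ z.re} :=
  hf.comp (by fun_prop) fun z (hz : 0 ≤ z.re) => by
    simp only [mem_ofPred_eq, div_ofReal_re]; positivity

/-- For `Re z > 0` this is algebra: `z² + ν² = ν²(1 + sp²)`, and `specTrans_succ` with `b = 0`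
together with `ν² = κ² + J(s)` restores `z² + κ² + p·current(p)`. Both sides are continuous up to
the axis, where density extends the identity. -/
theorem IsAdmissible.dispExt_eq_mul (hF : IsAdmissible F N₀) (hN : 11 ≤ N₀) {κ : ℝ} (hκ : 0 < κ)
    {z : ℂ} (hz : 0 ≤ z.re) :
    dispExt F κ z = (z ^ 2 + ((freq F κ ^ 2 : ℝ) : ℂ)) * reduced F κ (z / κ) := by
  have hs := hF.specRatio_mem hN κ
  refine Set.EqOn.of_subset_closure (s := {z : ℂ | 0 < z.re}) (t := {z : ℂ | 0 ≤ z.re})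
    (f := dispExt F κ) (g := fun z => (z ^ 2 + ((freq F κ ^ 2 : ℝ) : ℂ)) * reduced F κ (z / κ)) ?_
    (hF.continuousOn_dispExt hN hκ) ?_ (fun z (h : 0 < z.re) => h.le) closure_rightHalfPlane hz
  · intro z hz
    have hp : 0 < (z / κ).re := by rw [div_ofReal_re]; exact div_pos hz hκ
    have hκ' : (κ : ℂ) ≠ 0 := by exact_mod_cast hκ.ne'
    have hν : ((freq F κ ^ 2 : ℝ) : ℂ) ≠ 0 := by
      exact_mod_cast (pow_pos (hF.freq_pos hN κ) 2).ne'
    have h0 : specTrans F (specRatio F (κ ^ 2)) 0 (z / κ)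
        = (specInt F 0 0 (specRatio F (κ ^ 2)) : ℂ) - z / κ * current F (z / κ) := by
      have e : specDensity F (specRatio F (κ ^ 2)) 0 = fun u => (cutDensity F u : ℂ) := by
        ext u; simp [specDensity]
      rw [specTrans, e, current, specInt, ← integral_complex_ofReal]
      simp
    have h1 := hF.specTrans_succ hN hs 0 hp
    have h2 : freq F κ ^ 2 = κ ^ 2 + specInt F 0 1 (specRatio F (κ ^ 2)) := hF.freq_sq_eq_add hN κ
    have h3 : κ ^ 2 = specRatio F (κ ^ 2) * freq F κ ^ 2 := hF.sq_eq_specRatio_mul hN κ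
    -- This integrates `(1-su²)⁻¹ = 1 + su²(1-su²)⁻¹` against `W`.
    have h4 : specInt F 0 1 (specRatio F (κ ^ 2)) = specInt F 0 0 (specRatio F (κ ^ 2))
        + specRatio F (κ ^ 2) * specInt F 1 1 (specRatio F (κ ^ 2)) := by
      rw [specInt, specInt, specInt, ← integral_const_mul, ← integral_add
        (hF.integrable_specInt hN 0 0 hs.2) ((hF.integrable_specInt hN 1 1 hs.2).const_mul _)]
      refine integral_congr_ae (ae_of_all _ fun u => ?_)
      by_cases hu : u ∈ Ioo (-1 : ℝ) 1
      · have h3 := one_sub_mul_sq_ge hu (r := 1 - specRatio F (κ ^ 2)) (s := specRatio F (κ ^ 2))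
          (by linarith [hs.1]) (by linarith)
        have : 1 - specRatio F (κ ^ 2) * u ^ 2 ≠ 0 := by have := hs.2; intro h; linarith
        simp only
        field_simp
        ring
      · simp [cutDensity_of_notMem F hu]
    simp only [dispExt, reduced]
    set s := specRatio F (κ ^ 2)
    set P := z / κ
    have hz2 : z ^ 2 = (s : ℂ) * ((freq F κ ^ 2 : ℝ) : ℂ) * P ^ 2 := by
      have : ((κ ^ 2 : ℝ) : ℂ) = ((s * freq F κ ^ 2 : ℝ) : ℂ) := by rw [← h3]
      push_cast at this ⊢
      rw [← this]
      simp only [P]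
      field_simp
    have h6 : ((freq F κ ^ 2 : ℝ) : ℂ) = ((κ ^ 2 + (specInt F 0 0 s + s * specInt F 1 1 s) : ℝ) : ℂ) := by
      rw [← h4, ← h2]
    rw [zero_add] at h1
    set V := ((freq F κ ^ 2 : ℝ) : ℂ)
    have h7 : (z ^ 2 + V) * (1 - V⁻¹ * specTrans F s 1 P)
        = z ^ 2 + V - (1 + s * P ^ 2) * specTrans F s 1 P := by
      rw [hz2]; field_simp; ring
    rw [h7, h1, h0, h6]
    push_cast
    ring
  · exact ContinuousOn.mul (by fun_prop) (continuousOn_div_ofReal (hF.continuousOn_reduced hN κ) hκ)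

/-- For `|σ| > 1` the denominator `p² + u²` tends to `u² - σ² < 0`, so the transform subtracted from
`1` has non-positive real part. The approach is from the right with `ε² ≤ σ² - 1`, which preserves
the sign. -/
theorem IsAdmissible.one_le_re_reduced (hF : IsAdmissible F N₀) (hN : 11 ≤ N₀) (κ : ℝ) {σ : ℝ}
    (hσ : 1 < |σ|) : 1 ≤ (reduced F κ (Complex.I * σ)).re := by
  have hs := hF.specRatio_mem hN κ
  have hσ2 : 1 < σ ^ 2 := (one_lt_sq_iff_one_lt_abs σ).2 hσ
  have hlim : Tendsto (fun ε : ℝ => (reduced F κ ((ε : ℂ) + Complex.I * σ)).re) (𝓝[>] 0)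
      (𝓝 (reduced F κ (Complex.I * σ)).re) := by
    have h1 := (hF.continuousOn_reduced hN κ) (Complex.I * σ) (by simp)
    have h2 : Tendsto (fun ε : ℝ => (ε : ℂ) + Complex.I * σ) (𝓝[>] 0)
        (𝓝[{p : ℂ | 0 ≤ p.re}] (Complex.I * σ)) := by
      refine tendsto_nhdsWithin_iff.2 ⟨?_, ?_⟩
      · have : Continuous fun ε : ℝ => (ε : ℂ) + Complex.I * σ := by fun_prop
        have := this.tendsto 0
        simp only [Complex.ofReal_zero, zero_add] at this
        exact this.mono_left nhdsWithin_le_nhds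
      · filter_upwards [self_mem_nhdsWithin] with ε hε
        simpa using le_of_lt hε
    exact (Complex.continuous_re.tendsto _).comp (h1.tendsto.comp h2)
  refine ge_of_tendsto hlim ?_
  filter_upwards [Ioo_mem_nhdsGT (Real.sqrt_pos.2 (sub_pos.2 hσ2))] with ε hε
  have hp : 0 < ((ε : ℂ) + Complex.I * σ).re := by simpa using hε.1
  have hε2 : ε ^ 2 ≤ σ ^ 2 - 1 := by
    rw [← Real.sq_sqrt (sub_pos.2 hσ2).le]
    exact pow_le_pow_left₀ hε.1.le hε.2.le 2
  rw [reduced, Complex.sub_re, Complex.one_re, ← Complex.ofReal_inv, Complex.re_ofReal_mul]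
  suffices h : (specTrans F (specRatio F (κ ^ 2)) 1 ((ε : ℂ) + Complex.I * σ)).re ≤ 0 by
    have := mul_nonpos_of_nonneg_of_nonpos (inv_nonneg.2 (sq_nonneg (freq F κ))) h
    linarith
  rw [hF.specTrans_eq hN hs 1 hp]
  have hre := integral_re (integral_sub_cauchy_of_even (hF.integrable_specDensity hN hs 1)
    (specDensity_neg F _ 1) hp).2
  rw [RCLike.re_eq_complex_re] at hre
  rw [← hre]
  refine integral_nonpos fun u => ?_
  by_cases hu : u ∈ Ioo (-1 : ℝ) 1
  · have hW := hF.cutDensity_nonneg hN u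
    have hpos : 0 < 1 - specRatio F (κ ^ 2) * u ^ 2 := (by linarith [hs.2] :
      0 < 1 - specRatio F (κ ^ 2)).trans_le (one_sub_mul_sq_ge hu (by linarith [hs.1]) (by linarith))
    have e : (u : ℂ) ^ 2 * specDensity F (specRatio F (κ ^ 2)) 1 u
        = ((u ^ 2 * (cutDensity F u * ((1 - specRatio F (κ ^ 2) * u ^ 2)⁻¹) ^ 1) : ℝ) : ℂ) := by
      rw [specDensity]; push_cast; rfl
    simp only [Pi.zero_apply]
    rw [e, div_eq_mul_inv, Complex.re_ofReal_mul, Complex.inv_re]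
    refine mul_nonpos_of_nonneg_of_nonpos (by positivity) (div_nonpos_of_nonpos_of_nonneg ?_
      (Complex.normSq_nonneg _))
    have e2 : (((ε : ℂ) + Complex.I * σ) ^ 2 + (u : ℂ) ^ 2).re = ε ^ 2 - σ ^ 2 + u ^ 2 := by
      simp [sq]
    rw [e2]
    linarith [one_sub_sq_pos hu]
  · simp [specDensity, cutDensity_of_notMem F hu]

/-- Three regions: for `Re p > 0` a zero would be one of `M`; on the axis with `|σ| ≤ 1` the lower
bound of `exists_norm_dispExt_ge` applies; for `|σ| > 1` the real part is at least `1`. -/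
theorem IsAdmissible.reduced_ne_zero (hF : IsAdmissible F N₀) (hN : 11 ≤ N₀) {κ : ℝ} (hκ : 0 < κ)
    {p : ℂ} (hp : 0 ≤ p.re) : reduced F κ p ≠ 0 := by
  have hκ' : (κ : ℂ) ≠ 0 := by exact_mod_cast hκ.ne'
  have hz : p = (κ * p) / κ := by field_simp
  have hre : ((κ : ℂ) * p).re = κ * p.re := by simp
  rcases hp.lt_or_eq with h | h
  · intro h0
    have h1 : 0 < ((κ : ℂ) * p).re := by rw [hre]; positivity
    have h2 := hF.dispExt_eq_mul hN hκ h1.le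
    rw [← hz, h0, mul_zero] at h2
    obtain ⟨e, he⟩ := exists_norm_eq (E := R3) hκ.le
    have hk : e ≠ 0 := by rw [← norm_pos_iff, he]; exact hκ
    have h3 := hF.magDispersion_eq_dispExt hN h1 hk
    rw [he, h2] at h3
    exact hF.magDispersion_ne_zero hN h1 e h3
  · have hpI : p = Complex.I * (p.im : ℂ) := by
      apply Complex.ext <;> simp [← h]
    rcases le_or_gt |p.im| 1 with h1 | h1
    · obtain ⟨c, hc, hlow⟩ := hF.exists_norm_dispExt_ge hN
      have h2 := hlow κ hκ p.im (abs_le.1 h1)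
      have hpos : 0 < κ ^ 2 * (1 - p.im ^ 2) + |p.im| := by
        rcases eq_or_ne p.im 0 with h3 | h3
        · rw [h3]; simp; positivity
        · have : 0 < |p.im| := abs_pos.2 h3
          have h4 : p.im ^ 2 ≤ 1 := (sq_le_one_iff_abs_le_one _).2 h1
          have : 0 ≤ κ ^ 2 * (1 - p.im ^ 2) := mul_nonneg (sq_nonneg _) (by linarith)
          linarith
      intro h0
      have h3 : (κ : ℂ) * p = Complex.I * ((κ * p.im : ℝ) : ℂ) := by
        rw [hpI]; push_cast; simp; ring
      have h4 := hF.dispExt_eq_mul hN hκ (z := κ * p) (by rw [hre]; positivity)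
      rw [← hz, h0, mul_zero, h3] at h4
      rw [h4, norm_zero] at h2
      nlinarith [mul_pos hc hpos]
    · intro h0
      have h2 := hF.one_le_re_reduced hN κ h1
      rw [← hpI, h0] at h2
      simp at h2
      linarith

/-- The regular part of `1 / M`. -/
def remainder (F : ℂ → ℂ) (κ : ℝ) (z : ℂ) : ℂ :=
  (residue F (specRatio F (κ ^ 2)) : ℂ) * (((freq F κ ^ 2 : ℝ) : ℂ)⁻¹) ^ 2
    * specTrans F (specRatio F (κ ^ 2)) 2 (z / κ) / reduced F κ (z / κ)

/-- A partial fraction identity: `specTrans_succ` with `b = 1` turns `(z²+ν²)ν⁻²T₂` into `T₁` plus a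
constant, where `T_b` is `specTrans` with index `b`. The `T₁` terms cancel, and the residue is the
number that makes the remaining constant equal to `1`. -/
theorem IsAdmissible.residue_identity (hF : IsAdmissible F N₀) (hN : 11 ≤ N₀) {κ : ℝ} (hκ : 0 < κ)
    {z : ℂ} (hz : 0 ≤ z.re) :
    (residue F (specRatio F (κ ^ 2)) : ℂ) * reduced F κ (z / κ)
      + (z ^ 2 + ((freq F κ ^ 2 : ℝ) : ℂ)) * ((residue F (specRatio F (κ ^ 2)) : ℂ)
        * (((freq F κ ^ 2 : ℝ) : ℂ)⁻¹) ^ 2 * specTrans F (specRatio F (κ ^ 2)) 2 (z / κ)) = 1 := by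
  have hs := hF.specRatio_mem hN κ
  refine Set.EqOn.of_subset_closure (s := {z : ℂ | 0 < z.re}) (t := {z : ℂ | 0 ≤ z.re})
    (f := fun z => (residue F (specRatio F (κ ^ 2)) : ℂ) * reduced F κ (z / κ)
      + (z ^ 2 + ((freq F κ ^ 2 : ℝ) : ℂ)) * ((residue F (specRatio F (κ ^ 2)) : ℂ)
        * (((freq F κ ^ 2 : ℝ) : ℂ)⁻¹) ^ 2 * specTrans F (specRatio F (κ ^ 2)) 2 (z / κ)))
    (g := fun _ => 1) ?_ ?_ continuousOn_const (fun z (h : 0 < z.re) => h.le)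
    closure_rightHalfPlane hz
  · intro z hz
    have hp : 0 < (z / κ).re := by rw [div_ofReal_re]; exact div_pos hz hκ
    have hκ' : (κ : ℂ) ≠ 0 := by exact_mod_cast hκ.ne'
    have hν0 := pow_pos (hF.freq_pos hN κ) 2
    have hν : ((freq F κ ^ 2 : ℝ) : ℂ) ≠ 0 := by exact_mod_cast hν0.ne'
    have h1 := hF.specTrans_succ hN hs 1 hp
    have h3 : κ ^ 2 = specRatio F (κ ^ 2) * freq F κ ^ 2 := hF.sq_eq_specRatio_mul hN κ
    have hB : residue F (specRatio F (κ ^ 2)) * (freq F κ ^ 2 + specRatio F (κ ^ 2)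
        * specInt F 1 2 (specRatio F (κ ^ 2))) = freq F κ ^ 2 := by
      have hJ := hF.specInt_pos hN 1 hs.2
      have hK := hF.specInt_nonneg hN 1 2 hs.2
      have h1s : 0 < 1 - specRatio F (κ ^ 2) := by linarith [hs.2]
      have hs0 := hs.1
      rw [hF.freq_sq hN, residue, freqSq]
      have : 0 < specInt F 0 1 (specRatio F (κ ^ 2)) + specRatio F (κ ^ 2) *
        (1 - specRatio F (κ ^ 2)) * specInt F 1 2 (specRatio F (κ ^ 2)) := by positivity
      field_simp
    have hBc : (residue F (specRatio F (κ ^ 2)) : ℂ) * (((freq F κ ^ 2 : ℝ) : ℂ)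
        + (specRatio F (κ ^ 2) : ℂ) * (specInt F 1 2 (specRatio F (κ ^ 2)) : ℂ))
        = ((freq F κ ^ 2 : ℝ) : ℂ) := by exact_mod_cast hB
    simp only [reduced]
    set s := specRatio F (κ ^ 2)
    set P := z / κ
    have hz2 : z ^ 2 = (s : ℂ) * ((freq F κ ^ 2 : ℝ) : ℂ) * P ^ 2 := by
      have : ((κ ^ 2 : ℝ) : ℂ) = ((s * freq F κ ^ 2 : ℝ) : ℂ) := by rw [← h3]
      push_cast at this ⊢
      rw [← this]
      simp only [P]
      field_simp
    norm_num at h1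
    set V := ((freq F κ ^ 2 : ℝ) : ℂ)
    set B := (residue F s : ℂ)
    have h7 : (z ^ 2 + V) * (B * V⁻¹ ^ 2 * specTrans F s 2 P)
        = B * V⁻¹ * ((1 + s * P ^ 2) * specTrans F s 2 P) := by
      rw [hz2]; field_simp; ring
    rw [h7, h1]
    have h8 : B * (1 - V⁻¹ * specTrans F s 1 P) + B * V⁻¹ * (specTrans F s 1 P
        + s * (specInt F 1 2 s : ℂ)) = V⁻¹ * (B * (V + s * (specInt F 1 2 s : ℂ))) := by
      field_simp; ring
    rw [h8, hBc, inv_mul_cancel₀ hν]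
  · exact (continuousOn_const.mul (continuousOn_div_ofReal (hF.continuousOn_reduced hN κ) hκ)).add
      (ContinuousOn.mul (by fun_prop) (continuousOn_const.mul
        (continuousOn_div_ofReal (hF.continuousOn_specTrans hN hs 2) hκ)))

theorem IsAdmissible.inv_dispExt_eq (hF : IsAdmissible F N₀) (hN : 11 ≤ N₀) {κ : ℝ} (hκ : 0 < κ)
    {z : ℂ} (hz : 0 ≤ z.re) (hne : z ^ 2 + ((freq F κ ^ 2 : ℝ) : ℂ) ≠ 0) :
    (dispExt F κ z)⁻¹ = (residue F (specRatio F (κ ^ 2)) : ℂ) / (z ^ 2 + ((freq F κ ^ 2 : ℝ) : ℂ))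
      + remainder F κ z := by
  have hp : 0 ≤ (z / κ).re := by rw [div_ofReal_re]; positivity
  have hE := hF.reduced_ne_zero hN hκ hp
  have h := hF.residue_identity hN hκ hz
  rw [hF.dispExt_eq_mul hN hκ hz, remainder, div_add_div _ _ hne hE, ← one_div]
  congr 1
  rw [← h]

theorem conj_remainder (F : ℂ → ℂ) (κ : ℝ) (z : ℂ) :
    (starRingEnd ℂ) (remainder F κ z) = remainder F κ ((starRingEnd ℂ) z) := by
  simp only [remainder, reduced, map_div₀, map_mul, map_pow, map_inv₀, map_sub, map_one,
    Complex.conj_ofReal, conj_specTrans]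

theorem IsAdmissible.continuousOn_remainder (hF : IsAdmissible F N₀) (hN : 11 ≤ N₀) {κ : ℝ}
    (hκ : 0 < κ) : ContinuousOn (remainder F κ) {z : ℂ | 0 ≤ z.re} := by
  refine ContinuousOn.div (continuousOn_const.mul (continuousOn_div_ofReal
    (hF.continuousOn_specTrans hN (hF.specRatio_mem hN κ) 2) hκ))
    (continuousOn_div_ofReal (hF.continuousOn_reduced hN κ) hκ) fun z (hz : 0 ≤ z.re) =>
    hF.reduced_ne_zero hN hκ ?_
  rw [div_ofReal_re]; positivity

theorem IsAdmissible.differentiableOn_remainder (hF : IsAdmissible F N₀) (hN : 11 ≤ N₀) {κ : ℝ}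
    (hκ : 0 < κ) : DifferentiableOn ℂ (remainder F κ) {z : ℂ | 0 < z.re} := by
  have hs := hF.specRatio_mem hN κ
  have hmap : MapsTo (fun z : ℂ => z / κ) {z : ℂ | 0 < z.re} {p : ℂ | 0 < p.re} := fun z
      (hz : 0 < z.re) => by simp only [mem_ofPred_eq, div_ofReal_re]; positivity
  have hlin : DifferentiableOn ℂ (fun z : ℂ => z / κ) {z : ℂ | 0 < z.re} := by fun_prop
  have h1 := (hF.differentiableOn_specTrans hN hs 1).comp hlin hmap
  have h2 := (hF.differentiableOn_specTrans hN hs 2).comp hlin hmap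
  refine DifferentiableOn.div ((differentiableOn_const _).mul h2)
    ((differentiableOn_const _).sub ((differentiableOn_const _).mul h1)) fun z (hz : 0 < z.re) =>
    hF.reduced_ne_zero hN hκ ?_
  rw [div_ofReal_re]; positivity

/-- The constant may depend on `κ`, since the bound serves only integrability and the contour shift;
uniform estimates come later from the spectral density. -/
theorem IsAdmissible.exists_norm_remainder_le (hF : IsAdmissible F N₀) (hN : 11 ≤ N₀) {κ : ℝ}
    (hκ : 0 < κ) : ∃ C : ℝ, ∀ z : ℂ, 0 ≤ z.re → ‖remainder F κ z‖ ≤ C * (1 + ‖z‖ ^ 2)⁻¹ := by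
  have hs := hF.specRatio_mem hN κ
  have hν0 := pow_pos (hF.freq_pos hN κ) 2
  set s := specRatio F (κ ^ 2)
  set V := freq F κ ^ 2 with hV
  set A1 := ∫ u, ‖specDensity F s 1 u‖
  set A2 := ∫ u, ‖specDensity F s 2 u‖
  have hA1 : 0 ≤ A1 := integral_nonneg fun _ => norm_nonneg _
  have hA2 : 0 ≤ A2 := integral_nonneg fun _ => norm_nonneg _
  have hB := hF.residue_mem hN hs
  -- For `|p| ≥ T` the correction in `reduced` is at most `1/2`, so the denominator of the remainder
  -- is at least `1/2`.
  set T := 2 + 4 * (V⁻¹ * A1) with hT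
  have hT0 : 0 ≤ V⁻¹ * A1 := by positivity
  set C1 := 4 * V⁻¹ ^ 2 * A2
  have hC1 : 0 ≤ C1 := by positivity
  have hin : ∀ z : ℂ, 0 < z.re → κ * T ≤ ‖z‖ → ‖remainder F κ z‖ ≤ C1 * (κ ^ 2 / ‖z‖ ^ 2) := by
    intro z hz hzT
    have hp : 0 < (z / κ).re := by rw [div_ofReal_re]; exact div_pos hz hκ
    have hpn : ‖z / κ‖ = ‖z‖ / κ := by
      rw [norm_div, Complex.norm_real, Real.norm_eq_abs, abs_of_pos hκ]
    have hpT : T ≤ ‖z / κ‖ := by rw [hpn, le_div_iff₀ hκ]; linarith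
    have hp2 : 2 ≤ ‖z / κ‖ := by linarith
    have h1 := hF.norm_specTrans_le hN hs 1 hp hp2
    have h2 := hF.norm_specTrans_le hN hs 2 hp hp2
    have hE : 1 / 2 ≤ ‖reduced F κ (z / κ)‖ := by
      rw [reduced]
      have h3 := norm_sub_norm_le (1 : ℂ) ((V : ℂ)⁻¹ * specTrans F s 1 (z / κ))
      rw [norm_one] at h3
      refine le_trans ?_ h3
      rw [norm_mul, norm_inv, Complex.norm_real, Real.norm_eq_abs, abs_of_pos hν0]
      have h4 : V⁻¹ * ‖specTrans F s 1 (z / κ)‖ ≤ V⁻¹ * (2 * A1 / ‖z / κ‖ ^ 2) := by gcongr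
      have h5 : V⁻¹ * (2 * A1 / ‖z / κ‖ ^ 2) ≤ 1 / 2 := by
        rw [mul_div_assoc', div_le_iff₀ (by positivity)]
        nlinarith
      linarith
    rw [remainder, norm_div, norm_mul, norm_mul, norm_pow, norm_inv, Complex.norm_real,
      Complex.norm_real, Real.norm_eq_abs, Real.norm_eq_abs, abs_of_pos hν0, abs_of_pos hB.1]
    have hz0 : 0 < ‖z‖ := norm_pos_iff.2 (by rintro rfl; simp at hz)
    calc residue F s * V⁻¹ ^ 2 * ‖specTrans F s 2 (z / κ)‖ / ‖reduced F κ (z / κ)‖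
        ≤ 1 * V⁻¹ ^ 2 * (2 * A2 / ‖z / κ‖ ^ 2) / (1 / 2) := by
          gcongr
          exact hB.2
      _ = _ := by rw [hpn]; simp only [C1]; field_simp; ring
  -- Boundary points are reached as limits of `z + ε`; for `Re z ≥ 0` this shift does not decrease
  -- `|z|`.
  have hbd : ∀ z : ℂ, 0 ≤ z.re → κ * T ≤ ‖z‖ → ‖remainder F κ z‖ ≤ C1 * (κ ^ 2 / ‖z‖ ^ 2) := by
    intro z hz hzT
    have hz0 : 0 < ‖z‖ := lt_of_lt_of_le (by positivity) hzT
    have hlim : Tendsto (fun ε : ℝ => ‖remainder F κ (z + ε)‖) (𝓝[>] 0) (𝓝 ‖remainder F κ z‖) := by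
      have h1 := (hF.continuousOn_remainder hN hκ) z hz
      have h2 : Tendsto (fun ε : ℝ => z + (ε : ℂ)) (𝓝[>] 0) (𝓝[{p : ℂ | 0 ≤ p.re}] z) := by
        refine tendsto_nhdsWithin_iff.2 ⟨?_, ?_⟩
        · have : Continuous fun ε : ℝ => z + (ε : ℂ) := by fun_prop
          have := this.tendsto 0
          simp only [Complex.ofReal_zero, add_zero] at this
          exact this.mono_left nhdsWithin_le_nhds
        · filter_upwards [self_mem_nhdsWithin] with ε hε
          have : 0 < ε := hε
          simp only [Complex.add_re, Complex.ofReal_re]; linarith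
      exact (h1.tendsto.comp h2).norm
    refine le_of_tendsto hlim ?_
    filter_upwards [self_mem_nhdsWithin] with ε hε
    have hε0 : 0 < ε := hε
    have hle : ‖z‖ ≤ ‖z + ε‖ := by
      rw [← abs_norm z, ← abs_norm (z + ε), ← sq_le_sq, ← Complex.normSq_eq_norm_sq,
        ← Complex.normSq_eq_norm_sq, Complex.normSq_apply, Complex.normSq_apply]
      simp only [Complex.add_re, Complex.ofReal_re, Complex.add_im, Complex.ofReal_im, add_zero]
      nlinarith
    refine (hin (z + ε) (by simp only [Complex.add_re, Complex.ofReal_re]; linarith)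
      (hzT.trans hle)).trans ?_
    gcongr
  have hcomp : IsCompact ({z : ℂ | 0 ≤ z.re} ∩ Metric.closedBall 0 (κ * T)) :=
    (isCompact_closedBall _ _).inter_left (isClosed_le continuous_const Complex.continuous_re)
  obtain ⟨C2, hC2⟩ := hcomp.exists_bound_of_continuousOn
    ((hF.continuousOn_remainder hN hκ).mono inter_subset_left)
  have hC20 : 0 ≤ C2 := (norm_nonneg _).trans (hC2 0 (by simp; positivity))
  refine ⟨C2 * (1 + (κ * T) ^ 2) + C1 * (κ ^ 2 + T⁻¹ ^ 2), fun z hz => ?_⟩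
  rw [← div_eq_mul_inv, le_div_iff₀ (by positivity)]
  rcases le_or_gt (κ * T) ‖z‖ with h | h
  · have hz0 : 0 < ‖z‖ := lt_of_lt_of_le (by positivity) h
    have hTpos : 0 < T := by positivity
    have h1 := hbd z hz h
    have h2 : C1 * (κ ^ 2 / ‖z‖ ^ 2) * (1 + ‖z‖ ^ 2) ≤ C1 * (κ ^ 2 + T⁻¹ ^ 2) := by
      have h3 : κ ^ 2 / ‖z‖ ^ 2 ≤ T⁻¹ ^ 2 := by
        rw [← div_pow]
        refine pow_le_pow_left₀ (by positivity) ?_ 2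
        rw [div_le_iff₀ hz0, inv_mul_eq_div, le_div_iff₀ hTpos]
        exact h
      rw [mul_assoc]
      refine mul_le_mul_of_nonneg_left ?_ hC1
      rw [mul_add, mul_one, div_mul_cancel₀ _ (by positivity)]
      linarith
    calc _ ≤ C1 * (κ ^ 2 / ‖z‖ ^ 2) * (1 + ‖z‖ ^ 2) := by gcongr
      _ ≤ C1 * (κ ^ 2 + T⁻¹ ^ 2) := h2
      _ ≤ _ := by linarith [(by positivity : 0 ≤ C2 * (1 + (κ * T) ^ 2))]
  · have h1 := hC2 z ⟨hz, by simpa using h.le⟩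
    have : 0 ≤ C1 * (κ ^ 2 + T⁻¹ ^ 2) := by positivity
    calc _ ≤ C2 * (1 + (κ * T) ^ 2) := by gcongr
      _ ≤ _ := by linarith

/-! ### The imaginary zeros -/

theorem IsAdmissible.specRatio_zero (hF : IsAdmissible F N₀) (hN : 11 ≤ N₀) :
    specRatio F 0 = 0 := by
  have h := hF.sq_eq_specRatio_mul hN 0
  have h2 := pow_pos (hF.freq_pos hN 0) 2
  norm_num at h
  rcases h with h | h
  · exact h
  · rw [h] at h2; norm_num at h2

/-- At `k = 0` the integral drops out and `s = 0`, so `ν(0)² = J(0) = ∫ W = τ₀²`. -/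
theorem IsAdmissible.magDispersion_zero_eq (hF : IsAdmissible F N₀) (hN : 11 ≤ N₀) (z : ℂ) :
    magDispersion F z 0 = z ^ 2 + ((freq F 0 ^ 2 : ℝ) : ℂ) := by
  have h1 : freq F 0 ^ 2 = tauZeroSq F := by
    have h := hF.freq_sq_eq_add hN 0
    rw [zero_pow two_ne_zero, hF.specRatio_zero hN, zero_add] at h
    rw [h, hF.tauZeroSq_eq hN, specInt]
    simp
  rw [h1, magDispersion]
  simp

/-- The limit defining a zero is the boundary value of `M`, which factors as `(ν² - τ²)` times the
nonvanishing `reduced`; at `k = 0` the second factor is absent. -/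
theorem IsAdmissible.isMagneticZero_iff (hF : IsAdmissible F N₀) (hN : 11 ≤ N₀) (k : R3) (τ : ℝ) :
    IsMagneticZero F k τ ↔ τ = freq F ‖k‖ ∨ τ = -freq F ‖k‖ := by
  have hbot : (𝓝[{z : ℂ | 0 < z.re}] (Complex.I * (τ : ℂ))).NeBot :=
    mem_closure_iff_nhdsWithin_neBot.1 (closure_rightHalfPlane (by simp))
  have hsq : ∀ V : ℝ, (Complex.I * (τ : ℂ)) ^ 2 + (V : ℂ) = ((V - τ ^ 2 : ℝ) : ℂ) := fun V => by
    push_cast; rw [mul_pow, Complex.I_sq]; ring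
  have hiff : (Complex.I * (τ : ℂ)) ^ 2 + ((freq F ‖k‖ ^ 2 : ℝ) : ℂ) = 0 ↔
      τ = freq F ‖k‖ ∨ τ = -freq F ‖k‖ := by
    rw [hsq, Complex.ofReal_eq_zero, sub_eq_zero, eq_comm, sq_eq_sq_iff_eq_or_eq_neg]
  rw [← hiff]
  rcases eq_or_ne k 0 with rfl | hk
  · have hlim : Tendsto (fun z : ℂ => magDispersion F z 0) (𝓝[{z : ℂ | 0 < z.re}] (Complex.I * (τ : ℂ)))
        (𝓝 ((Complex.I * (τ : ℂ)) ^ 2 + ((freq F 0 ^ 2 : ℝ) : ℂ))) := by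
      simp_rw [hF.magDispersion_zero_eq hN]
      have : Continuous fun z : ℂ => z ^ 2 + ((freq F 0 ^ 2 : ℝ) : ℂ) := by fun_prop
      exact (this.tendsto _).mono_left nhdsWithin_le_nhds
    rw [norm_zero]
    exact ⟨fun h => tendsto_nhds_unique hlim h, fun h => by rw [h] at hlim; exact hlim⟩
  · have hκ : 0 < ‖k‖ := norm_pos_iff.2 hk
    have hre : (0 : ℝ) ≤ (Complex.I * (τ : ℂ)).re := by simp
    have hlim : Tendsto (fun z : ℂ => magDispersion F z k) (𝓝[{z : ℂ | 0 < z.re}] (Complex.I * (τ : ℂ)))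
        (𝓝 (dispExt F ‖k‖ (Complex.I * (τ : ℂ)))) := by
      have h1 := (hF.continuousOn_dispExt hN hκ) _ hre
      refine (h1.tendsto.mono_left (nhdsWithin_mono _ fun z (hz : 0 < z.re) => hz.le)).congr' ?_
      filter_upwards [self_mem_nhdsWithin] with z hz
      exact (hF.magDispersion_eq_dispExt hN hz hk).symm
    have hE := hF.reduced_ne_zero hN hκ (p := Complex.I * (τ : ℂ) / ‖k‖)
      (by rw [div_ofReal_re]; simp)
    have h2 := hF.dispExt_eq_mul hN hκ hre
    constructor
    · intro h
      have h3 := tendsto_nhds_unique hlim h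
      rw [h2] at h3
      exact (mul_eq_zero.1 h3).resolve_right hE
    · intro h
      rw [h2, h, zero_mul] at hlim
      exact hlim

end

open scoped FourierTransform

/-! ### Contour shift -/

section Contour

open scoped Interval

variable {G : ℂ → ℂ} {C : ℝ}

theorem norm_exp_line (γ τ t : ℝ) :
    ‖Complex.exp (((γ : ℂ) + Complex.I * (τ : ℂ)) * (t : ℂ))‖ = Real.exp (γ * t) := by
  rw [Complex.norm_exp]
  simp

theorem continuous_line (hc : ContinuousOn G {z : ℂ | 0 ≤ z.re}) {γ : ℝ} (hγ : 0 ≤ γ) (t : ℝ) :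
    Continuous fun τ : ℝ => Complex.exp (((γ : ℂ) + Complex.I * (τ : ℂ)) * (t : ℂ))
      * G ((γ : ℂ) + Complex.I * (τ : ℂ)) :=
  Continuous.mul (by fun_prop) (hc.comp_continuous (by fun_prop) fun τ => by simpa using hγ)

theorem norm_line_le (hb : ∀ z : ℂ, 0 ≤ z.re → ‖G z‖ ≤ C * (1 + ‖z‖ ^ 2)⁻¹) {γ : ℝ} (hγ : 0 ≤ γ)
    (t τ : ℝ) : ‖Complex.exp (((γ : ℂ) + Complex.I * (τ : ℂ)) * (t : ℂ))
      * G ((γ : ℂ) + Complex.I * (τ : ℂ))‖ ≤ Real.exp (γ * t) * (C * (1 + (γ ^ 2 + τ ^ 2))⁻¹) := by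
  rw [norm_mul, norm_exp_line, ← norm_sq_add_I_mul]
  exact mul_le_mul_of_nonneg_left (hb _ (by simpa using hγ)) (Real.exp_pos _).le

theorem nonneg_of_decay (hb : ∀ z : ℂ, 0 ≤ z.re → ‖G z‖ ≤ C * (1 + ‖z‖ ^ 2)⁻¹) : 0 ≤ C := by
  have := (norm_nonneg _).trans (hb 0 (by simp))
  simpa using this

theorem inv_one_add_sq_add_sq_le (γ τ : ℝ) : (1 + (γ ^ 2 + τ ^ 2))⁻¹ ≤ (1 + τ ^ 2)⁻¹ :=
  inv_anti₀ (by positivity) (by nlinarith [sq_nonneg γ])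

theorem integrable_line (hc : ContinuousOn G {z : ℂ | 0 ≤ z.re})
    (hb : ∀ z : ℂ, 0 ≤ z.re → ‖G z‖ ≤ C * (1 + ‖z‖ ^ 2)⁻¹) {γ : ℝ} (hγ : 0 ≤ γ) (t : ℝ) :
    Integrable fun τ : ℝ => Complex.exp (((γ : ℂ) + Complex.I * (τ : ℂ)) * (t : ℂ))
      * G ((γ : ℂ) + Complex.I * (τ : ℂ)) := by
  have hC := nonneg_of_decay hb
  refine ((integrable_inv_one_add_sq.const_mul C).const_mul (Real.exp (γ * t))).mono'
    (continuous_line hc hγ t).aestronglyMeasurable (ae_of_all _ fun τ => ?_)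
  refine (norm_line_le hb hγ t τ).trans ?_
  gcongr
  nlinarith [sq_nonneg γ]

/-- The integral over `Re z = γ` does not depend on `γ ≥ 0`. -/
theorem integral_line_eq (hc : ContinuousOn G {z : ℂ | 0 ≤ z.re})
    (hd : DifferentiableOn ℂ G {z : ℂ | 0 < z.re})
    (hb : ∀ z : ℂ, 0 ≤ z.re → ‖G z‖ ≤ C * (1 + ‖z‖ ^ 2)⁻¹) {γ : ℝ} (hγ : 0 ≤ γ) (t : ℝ) :
    ∫ τ : ℝ, Complex.exp (((γ : ℂ) + Complex.I * (τ : ℂ)) * (t : ℂ))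
      * G ((γ : ℂ) + Complex.I * (τ : ℂ))
    = ∫ τ : ℝ, Complex.exp (Complex.I * (τ : ℂ) * (t : ℂ)) * G (Complex.I * (τ : ℂ)) := by
  have hC := nonneg_of_decay hb
  set H : ℂ → ℂ := fun z => Complex.exp (z * t) * G z with hH
  have hHc : ContinuousOn H {z : ℂ | 0 ≤ z.re} := ContinuousOn.mul (by fun_prop) hc
  have hHd : DifferentiableOn ℂ H {z : ℂ | 0 < z.re} := DifferentiableOn.mul (by fun_prop) hd
  have hlim : ∀ γ' : ℝ, 0 ≤ γ' → Tendsto (fun T : ℝ => ∫ τ in (-T)..T, H ((γ' : ℂ) + Complex.I * τ)) atTop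
      (𝓝 (∫ τ : ℝ, H ((γ' : ℂ) + Complex.I * τ))) := fun γ' hγ' =>
    intervalIntegral_tendsto_integral (integrable_line hc hb hγ' t) tendsto_neg_atTop_atBot tendsto_id
  -- The horizontal sides at heights `±T` have fixed length `γ` and integrand `O(T⁻²)`.
  have hhor : ∀ s : ℝ, (s = 1 ∨ s = -1) →
      Tendsto (fun T : ℝ => ∫ x in (0 : ℝ)..γ, H ((x : ℂ) + ((s * T : ℝ) : ℂ) * Complex.I)) atTop (𝓝 0) := by
    intro s hs
    have hs2 : s ^ 2 = 1 := by rcases hs with rfl | rfl <;> norm_num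
    have hbound : ∀ T : ℝ, ‖∫ x in (0 : ℝ)..γ, H ((x : ℂ) + ((s * T : ℝ) : ℂ) * Complex.I)‖
        ≤ Real.exp (γ * |t|) * (C * (1 + T ^ 2)⁻¹) * |γ - 0| := by
      intro T
      refine intervalIntegral.norm_integral_le_of_norm_le_const fun x hx => ?_
      rw [uIoc_of_le hγ] at hx
      rw [mul_comm _ Complex.I]
      refine (norm_line_le hb hx.1.le t (s * T)).trans ?_
      have h1 := (inv_one_add_sq_add_sq_le x (s * T))
      rw [mul_pow, hs2, one_mul] at h1
      rw [mul_pow, hs2, one_mul]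
      have h2 : x * t ≤ γ * |t| := (mul_le_mul_of_nonneg_left (le_abs_self t) hx.1.le).trans
        (mul_le_mul_of_nonneg_right hx.2 (abs_nonneg t))
      gcongr
    refine squeeze_zero_norm hbound ?_
    have h1 : Tendsto (fun T : ℝ => 1 + T ^ 2) atTop atTop :=
      tendsto_atTop_add_const_left _ _ (tendsto_pow_atTop two_ne_zero)
    have h2 := (((tendsto_inv_atTop_zero.comp h1).const_mul C).const_mul (Real.exp (γ * |t|))).mul_const |γ - 0|
    simpa using h2
  have hrect : ∀ T : ℝ, (∫ x in (0 : ℝ)..γ, H ((x : ℂ) + (((-1) * T : ℝ) : ℂ) * Complex.I))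
      - (∫ x in (0 : ℝ)..γ, H ((x : ℂ) + ((1 * T : ℝ) : ℂ) * Complex.I))
      + Complex.I * (∫ τ in (-T)..T, H ((γ : ℂ) + Complex.I * τ))
      - Complex.I * (∫ τ in (-T)..T, H (((0 : ℝ) : ℂ) + Complex.I * τ)) = 0 := by
    intro T
    have h := Complex.integral_boundary_rect_eq_zero_of_continuousOn_of_differentiableOn H
      ⟨0, -T⟩ ⟨γ, T⟩ (hHc.mono fun z hz => ?_) (hHd.mono fun z hz => ?_)
    · simp only [smul_eq_mul] at h
      simp only [neg_one_mul, one_mul]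
      simpa only [mul_comm Complex.I] using h
    · have := hz.1
      rw [mem_preimage, uIcc_of_le hγ] at this
      exact this.1
    · have := hz.1
      rw [mem_preimage, min_eq_left hγ] at this
      exact this.1
  have hl := ((((hhor (-1) (Or.inr rfl)).sub (hhor 1 (Or.inl rfl))).add ((hlim γ hγ).const_mul Complex.I)).sub
    ((hlim 0 le_rfl).const_mul Complex.I))
  have h0 := tendsto_nhds_unique (hl.congr hrect) tendsto_const_nhds
  rw [sub_zero, zero_add, sub_eq_zero] at h0
  have h1 := mul_left_cancel₀ Complex.I_ne_zero h0
  simp only [hH, Complex.ofReal_zero, zero_add] at h1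
  exact h1

/-- For `t ≤ 0` the exponential is bounded on the right half-plane, so the line can be pushed to `γ
→ ∞`, where the integrand tends to `0` under the majorant `C(1+τ²)⁻¹`. -/
theorem integral_line_eq_zero (hc : ContinuousOn G {z : ℂ | 0 ≤ z.re})
    (hd : DifferentiableOn ℂ G {z : ℂ | 0 < z.re})
    (hb : ∀ z : ℂ, 0 ≤ z.re → ‖G z‖ ≤ C * (1 + ‖z‖ ^ 2)⁻¹) {t : ℝ} (ht : t ≤ 0) :
    ∫ τ : ℝ, Complex.exp (Complex.I * (τ : ℂ) * (t : ℂ)) * G (Complex.I * (τ : ℂ)) = 0 := by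
  have hC := nonneg_of_decay hb
  have hle : ∀ γ : ℝ, 0 ≤ γ → ∀ τ : ℝ, ‖Complex.exp (((γ : ℂ) + Complex.I * (τ : ℂ)) * (t : ℂ))
      * G ((γ : ℂ) + Complex.I * (τ : ℂ))‖ ≤ C * (1 + (γ ^ 2 + τ ^ 2))⁻¹ := fun γ hγ (τ : ℝ) =>
    (norm_line_le hb hγ t τ).trans (mul_le_of_le_one_left (by positivity)
      (Real.exp_le_one_iff.2 (mul_nonpos_of_nonneg_of_nonpos hγ ht)))
  have hlim : Tendsto (fun γ : ℝ => ∫ τ : ℝ, Complex.exp (((γ : ℂ) + Complex.I * (τ : ℂ)) * (t : ℂ))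
      * G ((γ : ℂ) + Complex.I * (τ : ℂ))) atTop (𝓝 (∫ _ : ℝ, (0 : ℂ))) := by
    refine tendsto_integral_filter_of_dominated_convergence (fun τ => C * (1 + τ ^ 2)⁻¹) ?_ ?_
      (integrable_inv_one_add_sq.const_mul C) (ae_of_all _ fun τ => ?_)
    · filter_upwards [eventually_ge_atTop 0] with γ hγ
      exact (continuous_line hc hγ t).aestronglyMeasurable
    · filter_upwards [eventually_ge_atTop 0] with γ hγ
      exact ae_of_all _ fun τ => (hle γ hγ τ).trans (mul_le_mul_of_nonneg_left
        (inv_one_add_sq_add_sq_le γ τ) hC)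
    · rw [← tendsto_zero_iff_norm_tendsto_zero.symm.trans Iff.rfl]
      have h1 : Tendsto (fun γ : ℝ => 1 + (γ ^ 2 + τ ^ 2)) atTop atTop :=
        tendsto_atTop_add_const_left _ _ (tendsto_atTop_add_const_right _ _ (tendsto_pow_atTop two_ne_zero))
      have h2 := (tendsto_inv_atTop_zero.comp h1).const_mul C
      rw [mul_zero] at h2
      refine squeeze_zero' (Eventually.of_forall fun _ => norm_nonneg _) ?_ h2
      filter_upwards [eventually_ge_atTop 0] with γ hγ
      exact hle γ hγ τ
  rw [integral_zero] at hlim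
  refine tendsto_nhds_unique (tendsto_const_nhds.congr' ?_) hlim
  filter_upwards [eventually_ge_atTop 0] with γ hγ
  exact (integral_line_eq hc hd hb hγ t).symm

/-- The inverse Laplace integral of a function which is real on the real axis, as a Fourier integral
of the jump of its extension across the imaginary axis. -/
theorem integral_line_eq_im (hc : ContinuousOn G {z : ℂ | 0 ≤ z.re})
    (hd : DifferentiableOn ℂ G {z : ℂ | 0 < z.re})
    (hb : ∀ z : ℂ, 0 ≤ z.re → ‖G z‖ ≤ C * (1 + ‖z‖ ^ 2)⁻¹)
    (hconj : ∀ z, (starRingEnd ℂ) (G z) = G ((starRingEnd ℂ) z)) {γ : ℝ} (hγ : 0 ≤ γ) {t : ℝ}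
    (ht : 0 ≤ t) :
    ∫ τ : ℝ, Complex.exp (((γ : ℂ) + Complex.I * (τ : ℂ)) * (t : ℂ))
      * G ((γ : ℂ) + Complex.I * (τ : ℂ))
    = ∫ τ : ℝ, Complex.exp (Complex.I * (τ : ℂ) * (t : ℂ))
      * (2 * Complex.I * ((G (Complex.I * (τ : ℂ))).im : ℂ)) := by
  -- Since the conjugate of `G(iτ)` is `G(-iτ)`, the substitution `τ ↦ -τ` turns this into the axis
  -- integral at time `-t ≤ 0`, which vanishes. Subtracting it leaves the jump `2i Im G`.
  have h0 : ∫ τ : ℝ, Complex.exp (Complex.I * (τ : ℂ) * (t : ℂ))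
      * (starRingEnd ℂ) (G (Complex.I * (τ : ℂ))) = 0 := by
    have h := integral_line_eq_zero hc hd hb (t := -t) (by linarith)
    rw [← integral_neg_eq_self] at h
    rw [← h]
    refine integral_congr_ae (ae_of_all _ fun τ => ?_)
    simp only [hconj, conj_I_mul_ofReal]
    push_cast
    ring_nf
  have hi := integrable_line hc hb le_rfl t
  simp only [Complex.ofReal_zero, zero_add] at hi
  have hi' : Integrable fun τ : ℝ => Complex.exp (Complex.I * (τ : ℂ) * (t : ℂ))
      * (starRingEnd ℂ) (G (Complex.I * (τ : ℂ))) := by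
    refine hi.norm.mono' ?_ (ae_of_all _ fun τ => ?_)
    · have h1 := continuous_line hc le_rfl 0
      simp only [Complex.ofReal_zero, zero_add, mul_zero, Complex.exp_zero, one_mul] at h1
      exact ((by fun_prop : Continuous fun τ : ℝ => Complex.exp (Complex.I * (τ : ℂ) * (t : ℂ))).mul
        (Complex.continuous_conj.comp h1)).aestronglyMeasurable
    · rw [norm_mul, norm_mul, RCLike.norm_conj]
  rw [integral_line_eq hc hd hb hγ t, ← sub_zero (∫ τ : ℝ, _ * G _), ← h0, ← integral_sub hi hi']
  refine integral_congr_ae (ae_of_all _ fun τ => ?_)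
  simp only
  rw [← mul_sub, Complex.sub_conj]
  push_cast
  ring

end Contour

/-! ### The contribution of a pair of imaginary poles -/

theorem integrableOn_exp_Ioi {a : ℂ} (ha : a.re < 0) :
    IntegrableOn (fun s : ℝ => Complex.exp (a * s)) (Ioi 0) := integrableOn_exp_mul_complex_Ioi ha 0

/-- The response of an undamped oscillator, with a convergence factor. -/
def dampedSine (γ ν s : ℝ) : ℂ :=
  (Ici (0 : ℝ)).indicator (fun s : ℝ => ((Real.exp (-(γ * s)) * (Real.sin (ν * s) / ν) : ℝ) : ℂ)) s

/-- The sine vanishes at `0`, so the cut at `s = 0` keeps the function continuous. This permits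
pointwise Fourier inversion for every `t ≥ 0`, including `t = 0`. -/
theorem continuous_dampedSine (γ ν : ℝ) : Continuous (dampedSine γ ν) := by
  have h : Continuous fun s : ℝ => ((Real.exp (-(γ * s)) * (Real.sin (ν * s) / ν) : ℝ) : ℂ) := by fun_prop
  refine h.indicator fun s hs => ?_
  rw [frontier_Ici] at hs
  rw [mem_singleton_iff.1 hs]
  simp

theorem dampedSine_of_pos {γ ν s : ℝ} (hν : 0 < ν) (hs : 0 < s) : dampedSine γ ν s =
    (Complex.exp ((-(γ : ℂ) + Complex.I * ν) * s) - Complex.exp ((-(γ : ℂ) - Complex.I * ν) * s))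
      / (2 * Complex.I * ν) := by
  have hν' : (ν : ℂ) ≠ 0 := by exact_mod_cast hν.ne'
  rw [dampedSine, indicator_of_mem (mem_Ici.2 hs.le)]
  push_cast
  have e1 : (-(γ : ℂ) + Complex.I * ν) * s = -(γ * s) + (ν * s) * Complex.I := by ring
  have e2 : (-(γ : ℂ) - Complex.I * ν) * s = -(γ * s) + (-(ν * s)) * Complex.I := by ring
  rw [e1, e2, Complex.exp_add, Complex.exp_add, Complex.sin]
  have hI := Complex.I_ne_zero
  field_simp
  rw [Complex.I_sq]
  ring

theorem integral_eq_setIntegral_dampedSine (γ ν : ℝ) (g : ℝ → ℂ) :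
    ∫ s, g s * dampedSine γ ν s = ∫ s in Ioi (0 : ℝ), g s * dampedSine γ ν s := by
  rw [← integral_Ici_eq_integral_Ioi, ← integral_indicator measurableSet_Ici]
  refine integral_congr_ae (ae_of_all _ fun s => ?_)
  by_cases hs : s ∈ Ici (0 : ℝ)
  · simp only [indicator_of_mem hs]
  · simp only [indicator_of_notMem hs, dampedSine, mul_zero]

theorem integrable_dampedSine {γ ν : ℝ} (hγ : 0 < γ) (hν : 0 < ν) : Integrable (dampedSine γ ν) := by
  have h1 : IntegrableOn (dampedSine γ ν) (Ioi 0) := by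
    have := (((integrableOn_exp_Ioi (a := -(γ : ℂ) + Complex.I * ν) (by simpa using hγ)).sub
      (integrableOn_exp_Ioi (a := -(γ : ℂ) - Complex.I * ν) (by simpa using hγ)))).div_const (2 * Complex.I * ν)
    refine IntegrableOn.congr_fun this (fun s hs => ?_) measurableSet_Ioi
    exact (dampedSine_of_pos hν hs).symm
  have h2 : IntegrableOn (dampedSine γ ν) (Iic 0) := by
    refine (integrableOn_zero).congr_fun (fun s (hs : s ≤ 0) => ?_) measurableSet_Iic
    rcases hs.lt_or_eq with h | rfl
    · rw [dampedSine, indicator_of_notMem (by simpa using h)]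
    · simp [dampedSine]
  have := h2.union h1
  rwa [Iic_union_Ioi, integrableOn_univ] at this

theorem sq_add_sq_eq_mul (γ τ ν : ℝ) : ((γ : ℂ) + Complex.I * τ) ^ 2 + ((ν ^ 2 : ℝ) : ℂ)
    = ((γ : ℂ) + Complex.I * τ - Complex.I * ν) * ((γ : ℂ) + Complex.I * τ + Complex.I * ν) := by
  push_cast
  linear_combination ((ν : ℂ) ^ 2) * Complex.I_sq

theorem line_sq_add_sq_ne_zero {γ : ℝ} (hγ : 0 < γ) (τ ν : ℝ) :
    ((γ : ℂ) + Complex.I * τ) ^ 2 + ((ν ^ 2 : ℝ) : ℂ) ≠ 0 := by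
  have := sq_add_sq_ne_zero (p := (γ : ℂ) + Complex.I * τ) (by simpa using hγ) ν
  push_cast
  exact this

theorem fourier_dampedSine {γ ν : ℝ} (hγ : 0 < γ) (hν : 0 < ν) (ξ : ℝ) :
    𝓕 (dampedSine γ ν) ξ
      = 1 / (((γ : ℂ) + Complex.I * ((2 * Real.pi * ξ : ℝ) : ℂ)) ^ 2 + ((ν ^ 2 : ℝ) : ℂ)) := by
  set τ := 2 * Real.pi * ξ with hτ
  have hν' : (ν : ℂ) ≠ 0 := by exact_mod_cast hν.ne'
  have hne := line_sq_add_sq_ne_zero hγ τ ν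
  rw [sq_add_sq_eq_mul] at hne
  obtain ⟨hn1, hn2⟩ := mul_ne_zero_iff.1 hne
  have hr1 : (-((γ : ℂ) + Complex.I * τ - Complex.I * ν)).re < 0 := by simpa using hγ
  have hr2 : (-((γ : ℂ) + Complex.I * τ + Complex.I * ν)).re < 0 := by simpa using hγ
  rw [Real.fourier_real_eq_integral_exp_smul]
  simp only [smul_eq_mul]
  rw [integral_eq_setIntegral_dampedSine]
  have hpt : ∀ s ∈ Ioi (0 : ℝ), Complex.exp (((-2 * Real.pi * s * ξ : ℝ) : ℂ) * Complex.I) * dampedSine γ ν s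
      = (Complex.exp (-((γ : ℂ) + Complex.I * τ - Complex.I * ν) * s)
        - Complex.exp (-((γ : ℂ) + Complex.I * τ + Complex.I * ν) * s)) / (2 * Complex.I * ν) := by
    intro s hs
    rw [dampedSine_of_pos hν hs, mul_div_assoc', mul_sub, ← Complex.exp_add, ← Complex.exp_add, hτ]
    push_cast
    ring_nf
  rw [setIntegral_congr_fun measurableSet_Ioi hpt, integral_div, integral_sub
    (integrableOn_exp_Ioi hr1) (integrableOn_exp_Ioi hr2), integral_exp_mul_complex_Ioi hr1,
    integral_exp_mul_complex_Ioi hr2, sq_add_sq_eq_mul]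
  have hI := Complex.I_ne_zero
  simp only [Complex.ofReal_zero, mul_zero, Complex.exp_zero, neg_div_neg_eq]
  rw [div_sub_div _ _ hn1 hn2, div_div]
  rw [div_eq_div_iff (by simp [hn1, hn2, hν']) hne]
  ring

/-- Fourier inversion for the damped sine; its factor `e^{-γt}` cancels the `e^{γt}` coming from the
line `Re z = γ`. -/
theorem integral_exp_div_sq_add_sq {γ ν : ℝ} (hγ : 0 < γ) (hν : 0 < ν) {t : ℝ} (ht : 0 ≤ t) :
    ∫ τ : ℝ, Complex.exp (((γ : ℂ) + Complex.I * (τ : ℂ)) * (t : ℂ))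
      / (((γ : ℂ) + Complex.I * (τ : ℂ)) ^ 2 + ((ν ^ 2 : ℝ) : ℂ))
    = 2 * Real.pi * ((Real.sin (ν * t) / ν : ℝ) : ℂ) := by
  have hpi := Real.pi_pos
  have hcont : Continuous fun τ : ℝ => 1 / (((γ : ℂ) + Complex.I * (τ : ℂ)) ^ 2 + ((ν ^ 2 : ℝ) : ℂ)) :=
    Continuous.div continuous_const (by fun_prop) fun τ => line_sq_add_sq_ne_zero hγ τ ν
  have hint : Integrable fun τ : ℝ => 1 / (((γ : ℂ) + Complex.I * (τ : ℂ)) ^ 2 + ((ν ^ 2 : ℝ) : ℂ)) := by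
    refine integrable_of_continuous_of_decay hcont (C := 4) (T := 1 + 2 * ν) fun τ hτ => ?_
    have h1 : 1 ≤ |τ| := by linarith
    have h2 : 2 * ν ≤ |τ| := by linarith
    have h3 : (2 * ν) ^ 2 ≤ τ ^ 2 := by rw [← sq_abs τ]; gcongr
    have h4 : 1 ≤ τ ^ 2 := by rw [← sq_abs τ]; nlinarith
    have h5 := norm_sub_le_norm_add (((γ : ℂ) + Complex.I * (τ : ℂ)) ^ 2) ((ν ^ 2 : ℝ) : ℂ)
    rw [norm_pow, norm_sq_add_I_mul, Complex.norm_real, Real.norm_eq_abs, abs_of_nonneg (sq_nonneg ν)] at h5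
    rw [norm_div, norm_one, ← div_eq_mul_inv]
    have h6 : (1 + τ ^ 2) / 4 ≤ ‖((γ : ℂ) + Complex.I * (τ : ℂ)) ^ 2 + ((ν ^ 2 : ℝ) : ℂ)‖ := by
      nlinarith [sq_nonneg γ]
    calc _ ≤ 1 / ((1 + τ ^ 2) / 4) := by gcongr
      _ = _ := by field_simp
  have hint' : Integrable (𝓕 (dampedSine γ ν)) := by
    have := hint.comp_mul_left' (R := 2 * Real.pi) (by positivity)
    exact this.congr (ae_of_all _ fun ξ => (fourier_dampedSine hγ hν ξ).symm)
  have hinv := congrFun ((continuous_dampedSine γ ν).fourierInv_fourier_eq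
    (integrable_dampedSine hγ hν) hint') t
  rw [Real.fourierInv_eq'] at hinv
  have hsub := Measure.integral_comp_mul_left (fun τ : ℝ => Complex.exp (Complex.I * (τ : ℂ) * (t : ℂ))
      / (((γ : ℂ) + Complex.I * (τ : ℂ)) ^ 2 + ((ν ^ 2 : ℝ) : ℂ))) (2 * Real.pi)
  have h1 : ∫ ξ : ℝ, Complex.exp (((2 * Real.pi * inner ℝ ξ t : ℝ) : ℂ) * Complex.I) • 𝓕 (dampedSine γ ν) ξ
      = ∫ ξ : ℝ, Complex.exp (Complex.I * ((2 * Real.pi * ξ : ℝ) : ℂ) * (t : ℂ))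
      / (((γ : ℂ) + Complex.I * ((2 * Real.pi * ξ : ℝ) : ℂ)) ^ 2 + ((ν ^ 2 : ℝ) : ℂ)) := by
    refine integral_congr_ae (ae_of_all _ fun ξ => ?_)
    simp only
    rw [fourier_dampedSine hγ hν, smul_eq_mul, mul_one_div]
    simp only [RCLike.inner_apply, conj_trivial]
    push_cast
    ring_nf
  rw [h1, hsub, dampedSine, indicator_of_mem (mem_Ici.2 ht), abs_of_pos (by positivity)] at hinv
  have h2 : ∀ τ : ℝ, Complex.exp (((γ : ℂ) + Complex.I * (τ : ℂ)) * (t : ℂ))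
      / (((γ : ℂ) + Complex.I * (τ : ℂ)) ^ 2 + ((ν ^ 2 : ℝ) : ℂ))
      = Complex.exp (γ * t) * (Complex.exp (Complex.I * (τ : ℂ) * (t : ℂ))
      / (((γ : ℂ) + Complex.I * (τ : ℂ)) ^ 2 + ((ν ^ 2 : ℝ) : ℂ))) := fun τ => by
    rw [add_mul, Complex.exp_add, mul_div_assoc]
  simp_rw [h2]
  rw [integral_const_mul]
  rw [Complex.real_smul] at hinv
  have h3 : ((2 * Real.pi : ℝ) : ℂ) ≠ 0 := by exact_mod_cast (by positivity : 2 * Real.pi ≠ 0)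
  rw [Complex.ofReal_inv, inv_mul_eq_iff_eq_mul₀ h3] at hinv
  rw [hinv]
  push_cast
  have h4 : Complex.exp (γ * t) * Complex.exp (-(γ * t)) = 1 := by
    rw [← Complex.exp_add, add_neg_cancel, Complex.exp_zero]
  linear_combination (2 * Real.pi * (Complex.sin (ν * t) / ν)) * h4

/-! ### Decomposition of the Green function -/

/-- The boundary value `M(iκσ, k)`, `κ = |k|`, of the dispersion function. -/
def dispAxis (F : ℂ → ℂ) (κ σ : ℝ) : ℂ :=
  ((κ ^ 2 * (1 - σ ^ 2) : ℝ) : ℂ) + Complex.I * σ * current F (Complex.I * σ)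

/-- The spectral density of the regular part at `τ = κσ`. -/
def regDensity (F : ℂ → ℂ) (κ σ : ℝ) : ℂ :=
  -(Complex.I * σ * (cutDensity F σ : ℂ)) * ((dispAxis F κ σ)⁻¹ * (starRingEnd ℂ) (dispAxis F κ σ)⁻¹)

/-- The spectral density of the regular part. -/
def specMeasure (F : ℂ → ℂ) (k : R3) (τ : ℝ) : ℂ :=
  if k = 0 then 0 else regDensity F ‖k‖ (τ / ‖k‖)

section

variable {F : ℂ → ℂ} {N₀ : ℕ}

/-- Off `±ν` the pole term is real on the axis, so the remainder and `1/M` have the same imaginary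
part there, namely `-πσW/|M|²`. -/
theorem IsAdmissible.im_remainder (hF : IsAdmissible F N₀) (hN : 11 ≤ N₀) {κ : ℝ} (hκ : 0 < κ)
    {τ : ℝ} (h1 : τ ≠ freq F κ) (h2 : τ ≠ -freq F κ) :
    ((2 * Real.pi : ℝ) : ℂ)⁻¹ * (2 * Complex.I * ((remainder F κ (Complex.I * (τ : ℂ))).im : ℂ))
      = regDensity F κ (τ / κ) := by
  obtain ⟨σ, hσ⟩ : ∃ σ, σ = τ / κ := ⟨_, rfl⟩
  have hτ : τ = κ * σ := by rw [hσ]; field_simp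
  have hV : (Complex.I * (τ : ℂ)) ^ 2 + ((freq F κ ^ 2 : ℝ) : ℂ) = ((freq F κ ^ 2 - τ ^ 2 : ℝ) : ℂ) := by
    push_cast; rw [mul_pow, Complex.I_sq]; ring
  have hne : (Complex.I * (τ : ℂ)) ^ 2 + ((freq F κ ^ 2 : ℝ) : ℂ) ≠ 0 := by
    rw [hV, Ne, Complex.ofReal_eq_zero, sub_eq_zero, eq_comm, sq_eq_sq_iff_eq_or_eq_neg]
    tauto
  have hinv := hF.inv_dispExt_eq hN hκ (z := Complex.I * (τ : ℂ)) (by simp) hne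
  have him : (remainder F κ (Complex.I * (τ : ℂ))).im = ((dispExt F κ (Complex.I * (τ : ℂ)))⁻¹).im := by
    rw [hinv, hV, ← Complex.ofReal_div, Complex.add_im, Complex.ofReal_im, zero_add]
  rw [him, Complex.inv_im, hτ, hF.im_dispExt hN hκ, dispExt_I_mul F hκ, ← hτ, ← hσ, regDensity,
    ← dispAxis, map_inv₀, ← mul_inv, Complex.mul_conj]
  have hpi : (Real.pi : ℂ) ≠ 0 := by exact_mod_cast Real.pi_ne_zero
  push_cast
  field_simp

theorem IsAdmissible.ae_im_remainder (hF : IsAdmissible F N₀) (hN : 11 ≤ N₀) {κ : ℝ} (hκ : 0 < κ) :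
    ∀ᵐ τ : ℝ, ((2 * Real.pi : ℝ) : ℂ)⁻¹ * (2 * Complex.I * ((remainder F κ (Complex.I * (τ : ℂ))).im : ℂ))
      = regDensity F κ (τ / κ) := by
  have h : ∀ a : ℝ, ∀ᵐ τ : ℝ, τ ≠ a := fun a => by
    rw [ae_iff]; simp
  filter_upwards [h (freq F κ), h (-freq F κ)] with τ h1 h2
  exact hF.im_remainder hN hκ h1 h2

theorem IsAdmissible.integrable_specMeasure (hF : IsAdmissible F N₀) (hN : 11 ≤ N₀) (k : R3) :
    Integrable (specMeasure F k) := by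
  rcases eq_or_ne k 0 with rfl | hk
  · have : specMeasure F 0 = fun _ => 0 := by ext τ; simp [specMeasure]
    rw [this]; exact integrable_zero _ _ _
  · have hκ : 0 < ‖k‖ := norm_pos_iff.2 hk
    obtain ⟨C, hC⟩ := hF.exists_norm_remainder_le hN hκ
    have h := integrable_line (hF.continuousOn_remainder hN hκ) hC le_rfl 0
    simp only [Complex.ofReal_zero, zero_add, mul_zero, Complex.exp_zero, one_mul] at h
    have h2 := ((h.im.ofReal (𝕜 := ℂ)).const_mul (2 * Complex.I)).const_mul ((2 * Real.pi : ℝ) : ℂ)⁻¹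
    refine h2.congr ?_
    filter_upwards [hF.ae_im_remainder hN hκ] with τ hτ
    simp only [specMeasure, if_neg hk]
    rw [← hτ]
    rfl

theorem residue_zero (hJ : 0 < specInt F 0 1 0) : residue F 0 = 1 := by
  rw [residue]
  simp [hJ.ne']

theorem oscillation_eq (a ν t : ℝ) (hν : 0 < ν) :
    (a : ℂ) * ((Real.sin (ν * t) / ν : ℝ) : ℂ) = Complex.exp (Complex.I * (ν : ℂ) * (t : ℂ))
      * (-Complex.I * ((a / (2 * ν) : ℝ) : ℂ)) + Complex.exp (-(Complex.I * (ν : ℂ) * (t : ℂ)))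
      * (Complex.I * ((a / (2 * ν) : ℝ) : ℂ)) := by
  have hν' : (ν : ℂ) ≠ 0 := by exact_mod_cast hν.ne'
  push_cast
  have e1 : Complex.I * (ν : ℂ) * t = (ν * t) * Complex.I := by ring
  have e2 : -((ν * t : ℂ) * Complex.I) = -(ν * t) * Complex.I := by ring
  rw [e1, e2, Complex.sin]
  field_simp
  ring

theorem IsAdmissible.magGreen_eq (hF : IsAdmissible F N₀) (hN : 11 ≤ N₀) {γ : ℝ} (hγ : 0 < γ) (k : R3)
    {t : ℝ} (ht : 0 ≤ t) :
    magGreen F γ k t = Complex.exp (Complex.I * (freq F ‖k‖ : ℂ) * (t : ℂ))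
        * (-Complex.I * (amplitude F (specRatio F (‖k‖ ^ 2)) : ℂ))
      + Complex.exp (-(Complex.I * (freq F ‖k‖ : ℂ) * (t : ℂ)))
        * (Complex.I * (amplitude F (specRatio F (‖k‖ ^ 2)) : ℂ))
      + synth (specMeasure F) k t := by
  have hν := hF.freq_pos hN ‖k‖
  have hpi : ((2 * Real.pi : ℝ) : ℂ) ≠ 0 := by exact_mod_cast (by positivity : 2 * Real.pi ≠ 0)
  have hosc := oscillation_eq (residue F (specRatio F (‖k‖ ^ 2))) (freq F ‖k‖) t hν
  have hamp : amplitude F (specRatio F (‖k‖ ^ 2))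
      = residue F (specRatio F (‖k‖ ^ 2)) / (2 * freq F ‖k‖) := rfl
  rw [hamp, ← hosc, magGreen]
  have hpole : ∫ τ : ℝ, (residue F (specRatio F (‖k‖ ^ 2)) : ℂ)
      * (Complex.exp (((γ : ℂ) + Complex.I * (τ : ℂ)) * (t : ℂ))
        / (((γ : ℂ) + Complex.I * (τ : ℂ)) ^ 2 + ((freq F ‖k‖ ^ 2 : ℝ) : ℂ)))
      = ((2 * Real.pi : ℝ) : ℂ) * ((residue F (specRatio F (‖k‖ ^ 2)) : ℂ)
        * ((Real.sin (freq F ‖k‖ * t) / freq F ‖k‖ : ℝ) : ℂ)) := by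
    rw [integral_const_mul, integral_exp_div_sq_add_sq hγ hν ht]
    push_cast
    ring
  -- At `k = 0` the residue is `1` and the pole term is all of `1/M`; otherwise the remainder
  -- contributes its jump across the axis.
  rcases eq_or_ne k 0 with rfl | hk
  · have hs : synth (specMeasure F) 0 t = 0 := by simp [synth, specMeasure]
    have hres : residue F (specRatio F (‖(0 : R3)‖ ^ 2)) = 1 := by
      rw [norm_zero, zero_pow two_ne_zero, hF.specRatio_zero hN]
      exact residue_zero (hF.specInt_pos hN 1 zero_lt_one)
    rw [hs, add_zero, ← inv_mul_cancel_left₀ hpi ((residue F (specRatio F (‖(0 : R3)‖ ^ 2)) : ℂ) * _),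
      ← hpole]
    congr 1
    refine integral_congr_ae (ae_of_all _ fun τ => ?_)
    simp only [hres, greenIntegrand, hF.magDispersion_zero_eq hN, Complex.ofReal_one, one_mul]
    rw [norm_zero]
  · have hκ : 0 < ‖k‖ := norm_pos_iff.2 hk
    obtain ⟨C, hC⟩ := hF.exists_norm_remainder_le hN hκ
    have hcont := hF.continuousOn_remainder hN hκ
    have hline := integral_line_eq_im hcont (hF.differentiableOn_remainder hN hκ) hC
      (conj_remainder F ‖k‖) hγ.le ht
    have hi := integrable_line hcont hC hγ.le t
    have hpt : ∀ τ : ℝ, greenIntegrand F γ k t τ = (residue F (specRatio F (‖k‖ ^ 2)) : ℂ)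
      * (Complex.exp (((γ : ℂ) + Complex.I * (τ : ℂ)) * (t : ℂ))
        / (((γ : ℂ) + Complex.I * (τ : ℂ)) ^ 2 + ((freq F ‖k‖ ^ 2 : ℝ) : ℂ)))
      + Complex.exp (((γ : ℂ) + Complex.I * (τ : ℂ)) * (t : ℂ))
        * remainder F ‖k‖ ((γ : ℂ) + Complex.I * (τ : ℂ)) := by
      intro τ
      have hre : 0 < ((γ : ℂ) + Complex.I * (τ : ℂ)).re := by simpa using hγ
      rw [greenIntegrand, hF.magDispersion_eq_dispExt hN hre hk, div_eq_mul_inv,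
        hF.inv_dispExt_eq hN hκ hre.le (line_sq_add_sq_ne_zero hγ τ _)]
      ring
    have hip : Integrable fun τ : ℝ => (residue F (specRatio F (‖k‖ ^ 2)) : ℂ)
      * (Complex.exp (((γ : ℂ) + Complex.I * (τ : ℂ)) * (t : ℂ))
        / (((γ : ℂ) + Complex.I * (τ : ℂ)) ^ 2 + ((freq F ‖k‖ ^ 2 : ℝ) : ℂ))) := by
      refine ((hF.integrable_greenIntegrand hN hγ k t).sub hi).congr (ae_of_all _ fun τ => ?_)
      simp only [Pi.sub_apply, hpt τ, add_sub_cancel_right]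
    simp_rw [hpt]
    rw [integral_add hip hi, hpole, hline, mul_add, inv_mul_cancel_left₀ hpi, ← integral_const_mul]
    congr 1
    refine integral_congr_ae ?_
    filter_upwards [hF.ae_im_remainder hN hκ] with τ hτ
    simp only [specMeasure, if_neg hk]
    rw [← hτ]
    ring

end

/-! ### The spectral density as a symbol -/

/-- The weight `(1 + κ²)⁻¹`, `κ = eˣ`. -/
def highWeight (x : ℝ) : ℝ := (1 + Real.exp (2 * x))⁻¹

theorem highWeight_pos (x : ℝ) : 0 < highWeight x := by unfold highWeight; positivity

theorem highWeight_le_one (x : ℝ) : highWeight x ≤ 1 :=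
  inv_le_one_of_one_le₀ (by linarith [Real.exp_pos (2 * x)])

theorem lowWeight_eq (x σ : ℝ) : lowWeight x σ = (Real.exp (2 * x) + |σ|) * highWeight x :=
  div_eq_mul_inv _ _

theorem lowWeight_le_axisWeight (x : ℝ) {σ : ℝ} (hσ : σ ∈ Ioo (-1 : ℝ) 1) :
    lowWeight x σ ≤ Real.exp (2 * x) * (1 - σ ^ 2) + |σ| := by
  have h1 := abs_lt_one_of_mem hσ
  have h2 := abs_nonneg σ
  have h3 : 0 ≤ Real.exp (2 * x) := (Real.exp_pos _).le
  have h4 : σ ^ 2 ≤ |σ| := by rw [← sq_abs]; nlinarith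
  have h5 := one_sub_sq_pos hσ
  rw [lowWeight, div_le_iff₀ (by positivity)]
  nlinarith [mul_le_mul_of_nonneg_left h4 h3, mul_nonneg (mul_nonneg h3 h3) h5.le, mul_nonneg h3 h2]

theorem mul_lowWeight_le_axisWeight (x σ : ℝ) :
    (1 - σ ^ 2) * lowWeight x σ / highWeight x ≤ Real.exp (2 * x) * (1 - σ ^ 2) + |σ| := by
  have h := (highWeight_pos x).ne'
  rw [lowWeight_eq, ← mul_assoc, mul_div_cancel_right₀ _ h]
  nlinarith [abs_nonneg σ, one_sub_sq_le_one σ]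

theorem axisWeight_pos (x : ℝ) {σ : ℝ} (hσ : σ ∈ Ioo (-1 : ℝ) 1) :
    0 < Real.exp (2 * x) * (1 - σ ^ 2) + |σ| := by
  have := one_sub_sq_pos hσ
  positivity

section

variable {F : ℂ → ℂ} {N₀ : ℕ}

theorem IsAdmissible.sym_dispAxis (hF : IsAdmissible F N₀) (hN : 11 ≤ N₀) {n : ℕ}
    (hn : 2 * (n + 3) ≤ N₀) : Sym n (fun x σ => Real.exp (2 * x) * (1 - σ ^ 2) + |σ|)
      (fun x σ => dispAxis F (Real.exp x) σ) := by
  have h1 : Sym n (fun x σ => Real.exp (2 * x) * (1 - σ ^ 2) + |σ|)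
      (fun x σ => (Real.exp (2 * x) : ℂ) * ((1 - σ ^ 2 : ℝ) : ℂ)) :=
    ((Sym.exp n).mul (Sym.one_sub_sq n)).mono' fun x σ _ => le_add_of_nonneg_right (abs_nonneg σ)
  have h2 := Sym.of_contDiff (hF.contDiff_current_I_mul hN hn) 1 0 one_pos (fun h => absurd rfl h)
  have h3 : Sym n (fun x σ => Real.exp (2 * x) * (1 - σ ^ 2) + |σ|)
      (fun _ σ => Complex.I * ((σ : ℂ) * current F (Complex.I * σ))) :=
    (Sym.const_mul Complex.I ((Sym.snd n).mul h2)).mono' fun x σ hσ => by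
      rw [pow_zero, mul_one]; exact lowWeight_le_axisWeight x hσ
  refine (h1.add h3).congr fun x σ _ => ?_
  rw [dispAxis, two_mul, Real.exp_add]
  push_cast
  ring

/-- `W` supplies `(1-σ²)^{n+4}` and `σ` one factor `lowWeight`; each of the two inverses of `M`
costs `(1-σ²)·lowWeight` and gains `(1+κ²)⁻¹`. Of the remaining exponent `n + 2`, up to `n` are
spent on derivatives and two are kept to suppress boundary terms. -/
theorem IsAdmissible.sym_regDensity (hF : IsAdmissible F N₀) (hN : 11 ≤ N₀) {n : ℕ}
    (hn : 2 * (n + 4) ≤ N₀) :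
    Sym n (fun x σ => (1 - σ ^ 2) ^ (n + 2) * (lowWeight x σ)⁻¹ * highWeight x ^ 2)
      (fun x σ => regDensity F (Real.exp x) σ) := by
  obtain ⟨c, hc, hlow⟩ := hF.exists_norm_dispExt_ge hN
  have hinv := (hF.sym_dispAxis hN (n := n) (by omega)).inv hc (fun x σ hσ => axisWeight_pos x hσ)
    fun x σ hσ => by
      have h := hlow (Real.exp x) (Real.exp_pos x) σ (Ioo_subset_Icc_self hσ)
      rw [dispExt_I_mul F (Real.exp_pos x), ← dispAxis, ← Real.exp_nat_mul] at h
      exact_mod_cast h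
  have hW := hF.sym_cutDensity hN (K := n + 4) (by omega) hn n
  refine ((Sym.const_mul (-Complex.I) ((Sym.snd n).mul hW)).mul (hinv.mul hinv.conj)).congr
    (fun x σ _ => ?_) |>.mono' fun x σ hσ => ?_
  · rw [regDensity]; ring
  · have hp := one_sub_sq_pos hσ
    have hl := lowWeight_pos x σ
    have hA := highWeight_pos x
    have h1 : (Real.exp (2 * x) * (1 - σ ^ 2) + |σ|)⁻¹ ≤ ((1 - σ ^ 2) * lowWeight x σ / highWeight x)⁻¹ :=
      inv_anti₀ (by positivity) (mul_lowWeight_le_axisWeight x σ)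
    have h0 := inv_pos.2 (axisWeight_pos x hσ)
    calc _ ≤ lowWeight x σ * (1 - σ ^ 2) ^ (n + 4) * (((1 - σ ^ 2) * lowWeight x σ / highWeight x)⁻¹
          * ((1 - σ ^ 2) * lowWeight x σ / highWeight x)⁻¹) := by
          have := mul_le_mul h1 h1 h0.le (h0.le.trans h1)
          exact mul_le_mul_of_nonneg_left this (by positivity)
      _ = _ := by field_simp; ring

theorem dispAxis_neg (F : ℂ → ℂ) (κ σ : ℝ) : dispAxis F κ (-σ) = (starRingEnd ℂ) (dispAxis F κ σ) := by
  rw [dispAxis, dispAxis, map_add, map_mul, map_mul, conj_current, conj_I_mul_ofReal, Complex.conj_ofReal,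
    Complex.conj_I, Complex.conj_ofReal]
  push_cast
  ring

theorem regDensity_neg (F : ℂ → ℂ) (κ σ : ℝ) : regDensity F κ (-σ) = -regDensity F κ σ := by
  rw [regDensity, regDensity, dispAxis_neg, cutDensity_neg, map_inv₀, map_inv₀, Complex.conj_conj]
  push_cast
  ring

theorem regDensity_of_notMem (F : ℂ → ℂ) (κ : ℝ) {σ : ℝ} (hσ : σ ∉ Ioo (-1 : ℝ) 1) :
    regDensity F κ σ = 0 := by
  rw [regDensity, cutDensity_of_notMem F hσ]; simp

end

/-! ### The low frequency cutoff -/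

/-- A function of `log |k|` which is `1` for small and `0` for large arguments. -/
def lowCut (c x : ℝ) : ℝ := Real.smoothTransition (c - x)

/-- A function of `τ / |k|` supported in `[-ε, ε]`, equal to `1` close to `0`. -/
def slowCut (ε σ : ℝ) : ℝ := Real.smoothTransition (2 - 2 * σ ^ 2 / ε ^ 2)

/-- The low frequency cutoff. -/
def cutoff (ε : ℝ) (k : R3) (τ : ℝ) : ℝ :=
  if k = 0 then 0 else slowCut ε (τ / ‖k‖) * lowCut (Real.log ε) (Real.log ‖k‖)

theorem contDiff_lowCut (c : ℝ) : ContDiff ℝ ∞ (lowCut c) :=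
  Real.smoothTransition.contDiff.comp (by fun_prop)

theorem contDiff_slowCut (ε : ℝ) : ContDiff ℝ ∞ (slowCut ε) :=
  Real.smoothTransition.contDiff.comp (by fun_prop)

theorem lowCut_of_ge {c x : ℝ} (h : c ≤ x) : lowCut c x = 0 :=
  Real.smoothTransition.zero_of_nonpos (by linarith)

theorem lowCut_of_le {c x : ℝ} (h : x ≤ c - 1) : lowCut c x = 1 :=
  Real.smoothTransition.one_of_one_le (by linarith)

theorem slowCut_of_abs_ge {ε σ : ℝ} (hε : 0 < ε) (h : ε ≤ |σ|) : slowCut ε σ = 0 := by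
  refine Real.smoothTransition.zero_of_nonpos ?_
  have : ε ^ 2 ≤ σ ^ 2 := by rw [← sq_abs σ]; gcongr
  have h2 : 1 ≤ σ ^ 2 / ε ^ 2 := (one_le_div (by positivity)).2 this
  rw [mul_div_assoc]; linarith

theorem slowCut_of_abs_le {ε σ : ℝ} (hε : 0 < ε) (h : |σ| < ε / 2) : slowCut ε σ = 1 := by
  refine Real.smoothTransition.one_of_one_le ?_
  have : σ ^ 2 ≤ (ε / 2) ^ 2 := by rw [← sq_abs σ]; gcongr
  have h2 : σ ^ 2 / ε ^ 2 ≤ 1 / 4 := by rw [div_le_iff₀ (by positivity)]; linarith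
  rw [mul_div_assoc]; linarith

theorem slowCut_neg (ε σ : ℝ) : slowCut ε (-σ) = slowCut ε σ := by rw [slowCut, slowCut, neg_sq]

theorem isLowFrequencyCutoff_cutoff {ε : ℝ} (hε : 0 < ε) : IsLowFrequencyCutoff ε (cutoff ε) where
  smooth := by
    have h : ContDiffOn ℝ ∞ (fun p : R3 × ℝ => slowCut ε (p.2 / ‖p.1‖) * lowCut (Real.log ε) (Real.log ‖p.1‖))
        {p : R3 × ℝ | p.1 ≠ 0} := by
      intro p hp
      have hp' : p.1 ≠ 0 := hp
      have h1 : ContDiffAt ℝ ∞ (fun p : R3 × ℝ => ‖p.1‖) p := contDiffAt_fst.norm ℝ hp'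
      have h2 : ContDiffAt ℝ ∞ (fun p : R3 × ℝ => p.2 / ‖p.1‖) p :=
        contDiffAt_snd.div h1 (norm_ne_zero_iff.2 hp')
      have h3 : ContDiffAt ℝ ∞ (fun p : R3 × ℝ => Real.log ‖p.1‖) p := h1.log (norm_ne_zero_iff.2 hp')
      exact (((contDiff_slowCut ε).contDiffAt.comp p h2).mul
        ((contDiff_lowCut _).contDiffAt.comp p h3)).contDiffWithinAt
    exact h.congr fun p hp => if_neg hp
  range k τ := by
    unfold cutoff
    split_ifs
    · simp
    · have h1 := Real.smoothTransition.nonneg (2 - 2 * (τ / ‖k‖) ^ 2 / ε ^ 2)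
      have h2 := Real.smoothTransition.le_one (2 - 2 * (τ / ‖k‖) ^ 2 / ε ^ 2)
      have h3 := Real.smoothTransition.nonneg (Real.log ε - Real.log ‖k‖)
      have h4 := Real.smoothTransition.le_one (Real.log ε - Real.log ‖k‖)
      exact ⟨mul_nonneg h1 h3, mul_le_one₀ h2 h3 h4⟩
  support k τ h := by
    unfold cutoff at h
    split_ifs at h with hk
    · exact absurd rfl h
    · have hκ : 0 < ‖k‖ := norm_pos_iff.2 hk
      constructor
      · by_contra! hlt
        refine h ?_
        rw [slowCut_of_abs_ge hε, zero_mul]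
        rw [abs_div, abs_norm, le_div_iff₀ hκ]
        exact hlt.le
      · by_contra! hlt
        refine h ?_
        rw [lowCut_of_ge (Real.log_le_log hε hlt.le), mul_zero]

theorem hasDerivAt_iteratedDeriv {f : ℝ → ℝ} (hf : ContDiff ℝ ∞ f) (j : ℕ) (x : ℝ) :
    HasDerivAt (iteratedDeriv j f) (iteratedDeriv (j + 1) f x) x := by
  rw [iteratedDeriv_succ]
  exact ((hf.differentiable_iteratedDeriv j (by exact_mod_cast WithTop.coe_lt_top _)) x).hasDerivAt

theorem exists_abs_iteratedDeriv_lowCut_le (c : ℝ) (j : ℕ) :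
    ∃ C : ℝ, 0 ≤ C ∧ ∀ x, |iteratedDeriv j (lowCut c) x| ≤ C ∧
      (c < x → iteratedDeriv j (lowCut c) x = 0) ∧
      (x < c - 1 → iteratedDeriv j (fun x => 1 - lowCut c x) x = 0) := by
  have hcont : Continuous (iteratedDeriv j (lowCut c)) :=
    (contDiff_lowCut c).continuous_iteratedDeriv j (by exact_mod_cast le_top)
  obtain ⟨C, hC⟩ := (isCompact_Icc (a := c - 1) (b := c)).exists_bound_of_continuousOn hcont.continuousOn
  have hC0 : 0 ≤ C := (norm_nonneg _).trans (hC c (by simp))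
  have hconst : ∀ (f : ℝ → ℝ) (a : ℝ) (x : ℝ), f =ᶠ[𝓝 x] (fun _ => a) →
      iteratedDeriv j f x = iteratedDeriv j (fun _ => a) x := fun f a x h => h.iteratedDeriv_eq j
  have hr : ∀ x, c < x → iteratedDeriv j (lowCut c) x = 0 := fun x hx => by
    rw [hconst _ 0 x]
    · rw [iteratedDeriv_const]; simp
    · filter_upwards [lt_mem_nhds hx] with y hy using lowCut_of_ge hy.le
  refine ⟨C + 1, by linarith, fun x => ⟨?_, hr x, fun hx => ?_⟩⟩
  · rcases lt_or_ge c x with h | h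
    · rw [hr x h, abs_zero]; linarith
    rcases lt_or_ge x (c - 1) with h' | h'
    · rw [hconst _ 1 x]
      · rw [iteratedDeriv_const]; split_ifs <;> simp <;> linarith
      · filter_upwards [gt_mem_nhds h'] with y hy using lowCut_of_le (le_of_lt hy)
    · exact (hC x ⟨h', h⟩).trans (by linarith)
  · rw [hconst _ 0 x]
    · rw [iteratedDeriv_const]; simp
    · filter_upwards [gt_mem_nhds hx] with y hy
      rw [lowCut_of_le (le_of_lt hy), sub_self]

/-- The cutoff lives on `x ≤ c`, where `highWeight` is bounded below; any power of it may be
inserted. -/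
theorem sym_lowCut (c : ℝ) (L m : ℕ) :
    Sym m (fun x _ => highWeight x ^ L) (fun x _ => (lowCut c x : ℂ)) := by
  refine (Sym.of_fst (m := m) (w := fun x _ => highWeight x ^ L)
    (h := fun j x => ((iteratedDeriv j (lowCut c) x : ℝ) : ℂ)) (fun j x =>
    (hasDerivAt_iteratedDeriv (contDiff_lowCut c) j x).ofReal_comp) fun j => ?_).congr
    fun x σ _ => by rw [iteratedDeriv_zero]
  obtain ⟨C, hC, h⟩ := exists_abs_iteratedDeriv_lowCut_le c j
  refine ⟨C * (1 + Real.exp (2 * c)) ^ L, by positivity, fun x σ _ => ?_⟩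
  rw [Complex.norm_real, Real.norm_eq_abs]
  have hA := highWeight_pos x
  rcases lt_or_ge c x with hx | hx
  · rw [(h x).2.1 hx, abs_zero]; positivity
  · refine (h x).1.trans ?_
    rw [mul_assoc, ← mul_pow]
    refine le_mul_of_one_le_right hC (one_le_pow₀ ?_)
    rw [highWeight, ← div_eq_mul_inv, one_le_div (by positivity)]
    gcongr

/-- The complementary cutoff lives on `x ≥ c - 1`, where `κ²`, and therefore `lowWeight`, is bounded
below. -/
theorem sym_one_sub_lowCut (c : ℝ) (L m : ℕ) :
    Sym m (fun x σ => lowWeight x σ ^ L) (fun x _ => ((1 - lowCut c x : ℝ) : ℂ)) := by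
  have hsm : ContDiff ℝ ∞ fun x => 1 - lowCut c x := contDiff_const.sub (contDiff_lowCut c)
  refine (Sym.of_fst (m := m) (w := fun x σ => lowWeight x σ ^ L)
    (h := fun j x => ((iteratedDeriv j (fun x => 1 - lowCut c x) x : ℝ) : ℂ)) (fun j x =>
    (hasDerivAt_iteratedDeriv hsm j x).ofReal_comp) fun j => ?_).congr
    fun x σ _ => by rw [iteratedDeriv_zero]
  obtain ⟨C, hC, h⟩ := exists_abs_iteratedDeriv_lowCut_le c j
  set q := Real.exp (2 * (c - 1)) / (1 + Real.exp (2 * (c - 1)))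
  have hq : 0 < q := by positivity
  refine ⟨(C + 1) * (q⁻¹) ^ L, by positivity, fun x σ _ => ?_⟩
  have hl := lowWeight_pos x σ
  rw [Complex.norm_real, Real.norm_eq_abs]
  rcases lt_or_ge x (c - 1) with hx | hx
  · rw [(h x).2.2 hx, abs_zero]; positivity
  · have hb : |iteratedDeriv j (fun x => 1 - lowCut c x) x| ≤ C + 1 := by
      rcases Nat.eq_zero_or_pos j with rfl | hj
      · have h0 := Real.smoothTransition.nonneg (c - x)
        have h1 := Real.smoothTransition.le_one (c - x)
        rw [iteratedDeriv_zero, lowCut, abs_le]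
        constructor <;> linarith
      · have e : iteratedDeriv j (fun x => 1 - lowCut c x) x = -iteratedDeriv j (lowCut c) x := by
          rw [iteratedDeriv_const_sub hj, iteratedDeriv_neg]
        rw [e, abs_neg]
        linarith [(h x).1]
    refine hb.trans ?_
    rw [mul_assoc, ← mul_pow]
    refine le_mul_of_one_le_right (by linarith) (one_le_pow₀ ?_)
    rw [inv_mul_eq_div, one_le_div hq]
    have hmono : Real.exp (2 * (c - 1)) ≤ Real.exp (2 * x) := by gcongr
    simp only [q, lowWeight]
    rw [div_le_div_iff₀ (by positivity) (by positivity)]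
    nlinarith [abs_nonneg σ, Real.exp_pos (2 * (c - 1)), mul_nonneg (abs_nonneg σ) (Real.exp_pos (2 * (c - 1))).le]

theorem sym_slowCut (ε : ℝ) (m : ℕ) : Sym m (fun _ _ => 1) (fun _ σ => (slowCut ε σ : ℂ)) := by
  have h : ContDiff ℝ m fun σ => (slowCut ε σ : ℂ) :=
    Complex.ofRealCLM.contDiff.comp ((contDiff_slowCut ε).of_le (by exact_mod_cast le_top))
  exact (Sym.of_contDiff h 1 0 one_pos fun h => absurd rfl h).mono' fun x σ _ => by rw [pow_zero]

theorem sym_one_sub_slowCut {ε : ℝ} (hε : 0 < ε) (L m : ℕ) :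
    Sym m (fun x σ => lowWeight x σ ^ L) (fun _ σ => ((1 - slowCut ε σ : ℝ) : ℂ)) := by
  have h : ContDiff ℝ m fun σ => ((1 - slowCut ε σ : ℝ) : ℂ) :=
    Complex.ofRealCLM.contDiff.comp
      ((contDiff_const.sub (contDiff_slowCut ε)).of_le (by exact_mod_cast le_top))
  refine Sym.of_contDiff h (ε / 2) L (by positivity) fun _ σ hσ => ?_
  rw [slowCut_of_abs_le hε hσ, sub_self, Complex.ofReal_zero]

section

variable {F : ℂ → ℂ} {N₀ : ℕ}

/-- The low frequency part of the spectral density. -/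
def lowDensity (F : ℂ → ℂ) (ε x σ : ℝ) : ℂ :=
  ((slowCut ε σ * lowCut (Real.log ε) x : ℝ) : ℂ) * regDensity F (Real.exp x) σ

/-- The remaining part of the spectral density. -/
def highDensity (F : ℂ → ℂ) (ε x σ : ℝ) : ℂ :=
  ((1 - slowCut ε σ * lowCut (Real.log ε) x : ℝ) : ℂ) * regDensity F (Real.exp x) σ

theorem IsAdmissible.sym_lowDensity (hF : IsAdmissible F N₀) (hN : 11 ≤ N₀) {n : ℕ}
    (hn : 2 * (n + 4) ≤ N₀) (ε : ℝ) :
    Sym n (fun x σ => (1 - σ ^ 2) ^ (n + 2) * ((lowWeight x σ)⁻¹ * highWeight x ^ (n + 2)))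
      (lowDensity F ε) := by
  refine (((sym_slowCut ε n).mul (sym_lowCut (Real.log ε) n n)).mul (hF.sym_regDensity hN hn)).congr
    (fun x σ _ => ?_) |>.mono' fun x σ _ => le_of_eq (by ring)
  rw [lowDensity]; push_cast; rfl

theorem IsAdmissible.sym_highDensity (hF : IsAdmissible F N₀) (hN : 11 ≤ N₀) {n : ℕ}
    (hn : 2 * (n + 4) ≤ N₀) {ε : ℝ} (hε : 0 < ε) :
    Sym n (fun x σ => (1 - σ ^ 2) ^ (n + 2) * (lowWeight x σ ^ n * highWeight x))
      (highDensity F ε) := by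
  -- Uses `1 - ab = (1 - a) + a(1 - b)`: each summand lives where `|σ|` or `κ` is bounded below, so
  -- `n + 1` powers of `lowWeight` can be inserted; one of them cancels the singular factor of the
  -- density.
  have h := (sym_one_sub_slowCut hε (n + 1) n).add
    (((sym_slowCut ε n).mul (sym_one_sub_lowCut (Real.log ε) (n + 1) n)).mono' fun x σ _ =>
      le_of_eq (one_mul _))
  refine (h.mul (hF.sym_regDensity hN hn)).congr (fun x σ _ => ?_) |>.mono' fun x σ hσ => ?_
  · rw [highDensity]; push_cast; ring
  · have hl := lowWeight_pos x σ
    have hA := highWeight_pos x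
    have hA1 := highWeight_le_one x
    have hp := one_sub_sq_pos hσ
    calc _ = (1 - σ ^ 2) ^ (n + 2) * (lowWeight x σ ^ n * (highWeight x * highWeight x)) := by
          rw [pow_succ]; field_simp
      _ ≤ _ := by
          gcongr
          exact mul_le_of_le_one_left hA.le hA1

theorem lowDensity_neg (F : ℂ → ℂ) (ε x σ : ℝ) : lowDensity F ε x (-σ) = -lowDensity F ε x σ := by
  rw [lowDensity, lowDensity, slowCut_neg, regDensity_neg, mul_neg]

end

/-! ### Oscillatory integrals -/

/-- `∫_{-1}^{1} e^{iσT} f(σ) dσ`. -/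
def oscInt (f : ℝ → ℂ) (T : ℝ) : ℂ :=
  ∫ σ in Ioo (-1 : ℝ) 1, Complex.exp (Complex.I * (σ : ℂ) * (T : ℂ)) * f σ

theorem norm_exp_I_mul (σ T : ℝ) : ‖Complex.exp (Complex.I * (σ : ℂ) * (T : ℂ))‖ = 1 := by
  rw [Complex.norm_exp]; simp

theorem hasDerivAt_exp_I_mul (T σ : ℝ) :
    HasDerivAt (fun σ : ℝ => Complex.exp (Complex.I * (σ : ℂ) * (T : ℂ)))
      (Complex.I * T * Complex.exp (Complex.I * (σ : ℂ) * (T : ℂ))) σ := by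
  have h : HasDerivAt (fun σ : ℝ => Complex.I * (σ : ℂ) * (T : ℂ)) (Complex.I * 1 * T) σ :=
    ((hasDerivAt_id σ).ofReal_comp.const_mul Complex.I).mul_const _
  refine h.cexp.congr_deriv ?_
  ring

theorem integrableOn_of_continuousOn_of_bound {f : ℝ → ℂ} (hf : ContinuousOn f (Ioo (-1 : ℝ) 1)) {u : ℝ → ℝ}
    (hu : IntegrableOn u (Ioo (-1 : ℝ) 1)) (hb : ∀ σ ∈ Ioo (-1 : ℝ) 1, ‖f σ‖ ≤ u σ) :
    IntegrableOn f (Ioo (-1 : ℝ) 1) :=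
  hu.mono' (hf.aestronglyMeasurable measurableSet_Ioo)
    ((ae_restrict_iff' measurableSet_Ioo).2 (ae_of_all _ hb))

theorem integrableOn_Ioo_const (C : ℝ) : IntegrableOn (fun _ : ℝ => C) (Ioo (-1 : ℝ) 1) :=
  integrableOn_const (by simp)

theorem IntegrableOn.exp_mul {f : ℝ → ℂ} (hf : IntegrableOn f (Ioo (-1 : ℝ) 1)) (T : ℝ) :
    IntegrableOn (fun σ : ℝ => Complex.exp (Complex.I * (σ : ℂ) * (T : ℂ)) * f σ) (Ioo (-1 : ℝ) 1) :=
  Integrable.bdd_mul (c := 1) hf (Continuous.aestronglyMeasurable (by fun_prop))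
    (ae_of_all _ fun σ => (norm_exp_I_mul σ T).le)

theorem norm_oscInt_le {f : ℝ → ℂ} {u : ℝ → ℝ} (hu : IntegrableOn u (Ioo (-1 : ℝ) 1))
    (hb : ∀ σ ∈ Ioo (-1 : ℝ) 1, ‖f σ‖ ≤ u σ) (T : ℝ) :
    ‖oscInt f T‖ ≤ ∫ σ in Ioo (-1 : ℝ) 1, u σ :=
  norm_integral_le_of_norm_le hu ((ae_restrict_iff' measurableSet_Ioo).2 (ae_of_all _ fun σ hσ => by
    rw [norm_mul, norm_exp_I_mul, one_mul]; exact hb σ hσ))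

/-- Quadratic vanishing of `g` at `±1` lets it be extended by zero as a differentiable function on
the line, so no boundary terms arise. -/
theorem setIntegral_deriv_mul {φ φ' g g' : ℝ → ℂ} {B C : ℝ} (hφ : ∀ σ, HasDerivAt φ (φ' σ) σ)
    (hφ' : Continuous φ') (hB : ∀ σ, ‖φ σ‖ ≤ B)
    (hd : ∀ σ ∈ Ioo (-1 : ℝ) 1, HasDerivAt g (g' σ) σ)
    (hb : ∀ σ ∈ Ioo (-1 : ℝ) 1, ‖g σ‖ ≤ C * (1 - σ ^ 2) ^ 2)
    (hg' : IntegrableOn g' (Ioo (-1 : ℝ) 1)) :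
    ∫ σ in Ioo (-1 : ℝ) 1, φ' σ * g σ = -∫ σ in Ioo (-1 : ℝ) 1, φ σ * g' σ := by
  have hG := hasDerivAt_indicator_Ioo hd hb
  have hGc : Continuous ((Ioo (-1 : ℝ) 1).indicator g) :=
    continuous_iff_continuousAt.2 fun σ => (hG σ).continuousAt
  have hGs : HasCompactSupport ((Ioo (-1 : ℝ) 1).indicator g) :=
    hasCompactSupport_of_Ioo fun σ hσ => indicator_of_notMem hσ g
  have hφc : Continuous φ := continuous_iff_continuousAt.2 fun σ => (hφ σ).continuousAt
  have hG'i : Integrable ((Ioo (-1 : ℝ) 1).indicator g') := (integrable_indicator_iff measurableSet_Ioo).2 hg'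
  have h := integral_mul_deriv_eq_deriv_mul_of_integrable (u := φ) (u' := φ')
    (v := (Ioo (-1 : ℝ) 1).indicator g) (v' := (Ioo (-1 : ℝ) 1).indicator g') (fun σ _ => hφ σ)
    (fun σ _ => hG σ) (hG'i.bdd_mul (c := B) hφc.aestronglyMeasurable (ae_of_all _ hB))
    ((hφ'.mul hGc).integrable_of_hasCompactSupport hGs.mul_left)
    ((hφc.mul hGc).integrable_of_hasCompactSupport hGs.mul_left)
  have e : ∀ a b : ℝ → ℂ, ∫ σ, a σ * (Ioo (-1 : ℝ) 1).indicator b σ = ∫ σ in Ioo (-1 : ℝ) 1, a σ * b σ := by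
    intro a b
    rw [← integral_indicator measurableSet_Ioo]
    refine integral_congr_ae (ae_of_all _ fun σ => ?_)
    by_cases hσ : σ ∈ Ioo (-1 : ℝ) 1
    · simp only [indicator_of_mem hσ]
    · simp only [indicator_of_notMem hσ, mul_zero]
  rw [e, e] at h
  rw [h, neg_neg]

theorem oscInt_deriv {g g' : ℝ → ℂ} {C : ℝ} (hd : ∀ σ ∈ Ioo (-1 : ℝ) 1, HasDerivAt g (g' σ) σ)
    (hb : ∀ σ ∈ Ioo (-1 : ℝ) 1, ‖g σ‖ ≤ C * (1 - σ ^ 2) ^ 2)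
    (hg' : IntegrableOn g' (Ioo (-1 : ℝ) 1)) (T : ℝ) :
    Complex.I * T * oscInt g T = -oscInt g' T := by
  have h := setIntegral_deriv_mul (hasDerivAt_exp_I_mul T) (by fun_prop) (fun σ => (norm_exp_I_mul σ T).le)
    hd hb hg'
  rw [oscInt, oscInt, ← h, ← integral_const_mul]
  simp_rw [mul_assoc]

theorem integral_Ioo_eq_zero_of_odd {h : ℝ → ℂ} (ho : ∀ σ ∈ Ioo (-1 : ℝ) 1, h (-σ) = -h σ) :
    ∫ σ in Ioo (-1 : ℝ) 1, h σ = 0 := by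
  rw [← integral_indicator measurableSet_Ioo]
  have e : ∫ σ, (Ioo (-1 : ℝ) 1).indicator h σ = -∫ σ, (Ioo (-1 : ℝ) 1).indicator h σ := by
    conv_lhs => rw [← integral_neg_eq_self]
    rw [← integral_neg]
    refine integral_congr_ae (ae_of_all _ fun σ => ?_)
    have hiff : -σ ∈ Ioo (-1 : ℝ) 1 ↔ σ ∈ Ioo (-1 : ℝ) 1 := by
      constructor <;> rintro ⟨h1, h2⟩ <;> constructor <;> linarith
    by_cases hσ : σ ∈ Ioo (-1 : ℝ) 1
    · simp only [indicator_of_mem hσ, indicator_of_mem (hiff.2 hσ), ho σ hσ]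
    · simp only [indicator_of_notMem hσ, indicator_of_notMem (mt hiff.1 hσ), neg_zero]
  exact self_eq_neg.1 e

/-! ### Decay by repeated integration by parts -/

/-- Each integration by parts trades one factor `T` for `1/scaleWeight`, so the majorant `u` is
`w/scaleWeight^L`. The bound `u ≤ B(1-σ²)` only removes boundary terms; hence `B` may depend on `x`
while `C` does not. -/
theorem Sym.exists_decay : ∀ (L : ℕ) {m : ℕ} {w : ℝ → ℝ → ℝ} {f : ℝ → ℝ → ℂ}, Sym m w f → L ≤ m →
    ∀ {u : ℝ → ℝ → ℝ}, (∀ x, ∀ σ ∈ Ioo (-1 : ℝ) 1, 0 ≤ u x σ) →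
    (∀ x, ∀ σ ∈ Ioo (-1 : ℝ) 1, w x σ ≤ u x σ * scaleWeight x σ ^ L) →
    (∀ x, IntegrableOn (u x) (Ioo (-1 : ℝ) 1)) →
    (∀ x, ∃ B, 0 ≤ B ∧ ∀ σ ∈ Ioo (-1 : ℝ) 1, u x σ ≤ B * (1 - σ ^ 2)) →
    ∃ C : ℝ, 0 ≤ C ∧ ∀ x T : ℝ, |T| ^ L * ‖oscInt (f x) T‖ ≤ C * ∫ σ in Ioo (-1 : ℝ) 1, u x σ
  | 0, m, w, f, hf, _, u, hu0, hu, hui, _ => by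
    obtain ⟨C, hC, hb⟩ := hf.bound
    refine ⟨C, hC, fun x T => ?_⟩
    rw [pow_zero, one_mul, ← integral_const_mul]
    refine norm_oscInt_le ((hui x).const_mul C) (fun σ hσ => (hb x σ hσ).trans ?_) T
    have := hu x σ hσ
    rw [pow_zero, mul_one] at this
    exact mul_le_mul_of_nonneg_left this hC
  | L + 1, 0, _, _, _, h, _, _, _, _, _ => absurd h (by omega)
  | L + 1, m + 1, w, f, ⟨⟨C, hC, hb⟩, fx, fσ, hd, _, hs⟩, h, u, hu0, hu, hui, hut => by
    have hws : ∀ x, ∀ σ ∈ Ioo (-1 : ℝ) 1, w x σ / scaleWeight x σ ≤ u x σ * scaleWeight x σ ^ L := by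
      intro x σ hσ
      rw [div_le_iff₀ (scaleWeight_pos x hσ), mul_assoc, ← pow_succ]
      exact hu x σ hσ
    obtain ⟨C', hC', hdec⟩ := Sym.exists_decay L hs (by omega) hu0 hws hui hut
    refine ⟨C', hC', fun x T => ?_⟩
    obtain ⟨B, hB, hBu⟩ := hut x
    obtain ⟨C2, hC2, hb2⟩ := hs.bound
    have hpow : ∀ k : ℕ, ∀ σ ∈ Ioo (-1 : ℝ) 1, scaleWeight x σ ^ k ≤ 1 := fun k σ hσ =>
      pow_le_one₀ (scaleWeight_pos x hσ).le (scaleWeight_le_one x hσ)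
    have hsp : ∀ σ ∈ Ioo (-1 : ℝ) 1, scaleWeight x σ ≤ 1 - σ ^ 2 := fun σ hσ =>
      mul_le_of_le_one_right (one_sub_sq_pos hσ).le (lowWeight_le_one x hσ)
    have hibp := oscInt_deriv (C := C * B) (fun σ hσ => (hd x σ hσ).2) (fun σ hσ => by
      refine (hb x σ hσ).trans ?_
      rw [mul_assoc]
      refine mul_le_mul_of_nonneg_left ((hu x σ hσ).trans ?_) hC
      have hp := one_sub_sq_pos hσ
      have hs0 := scaleWeight_pos x hσ
      calc u x σ * scaleWeight x σ ^ (L + 1) ≤ B * (1 - σ ^ 2) * (1 * (1 - σ ^ 2)) := by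
            rw [pow_succ]
            gcongr
            · exact hBu σ hσ
            · exact hpow L σ hσ
            · exact hsp σ hσ
        _ = _ := by ring) (integrableOn_of_continuousOn_of_bound (hs.continuousOn x)
        ((hui x).const_mul C2) (fun σ hσ => (hb2 x σ hσ).trans (mul_le_mul_of_nonneg_left
          ((hws x σ hσ).trans (mul_le_of_le_one_right (hu0 x σ hσ) (hpow L σ hσ))) hC2))) T
    have hn : |T| * ‖oscInt (f x) T‖ = ‖oscInt (fσ x) T‖ := by
      have := congrArg norm hibp
      rwa [norm_mul, norm_mul, Complex.norm_I, one_mul, Complex.norm_real, Real.norm_eq_abs, norm_neg] at this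
    rw [pow_succ, mul_assoc, hn]
    exact hdec x T

/-! ### Differentiation in `log |k|` -/

/-- Bounded by a power of `1 - σ²`, locally uniformly in `x`. -/
def Tame (a : ℕ) (w : ℝ → ℝ → ℝ) : Prop :=
  ∀ x₀ : ℝ, ∃ B : ℝ, 0 ≤ B ∧ ∀ x ∈ Ioo (x₀ - 1) (x₀ + 1), ∀ σ ∈ Ioo (-1 : ℝ) 1,
    w x σ ≤ B * (1 - σ ^ 2) ^ a

/-- The function `κ ∫_{-1}^{1} e^{iσκt} f(x,σ) dσ`, `κ = eˣ`. -/
def flow (f : ℝ → ℝ → ℂ) (t x : ℝ) : ℂ := (Real.exp x : ℂ) * oscInt (f x) (Real.exp x * t)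

/-- `f` is odd in `σ`. -/
def OddSnd (f : ℝ → ℝ → ℂ) : Prop := ∀ x, ∀ σ ∈ Ioo (-1 : ℝ) 1, f x (-σ) = -f x σ

theorem lowWeight_ge (x σ : ℝ) : Real.exp (2 * x) * highWeight x ≤ lowWeight x σ := by
  rw [lowWeight_eq]
  exact mul_le_mul_of_nonneg_right (le_add_of_nonneg_right (abs_nonneg σ)) (highWeight_pos x).le

theorem neg_mem_Ioo {σ : ℝ} (h : σ ∈ Ioo (-1 : ℝ) 1) : -σ ∈ Ioo (-1 : ℝ) 1 :=
  ⟨by linarith [h.2], by linarith [h.1]⟩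

/-- The `x`-derivative of `e^{iσκt}` equals `σ∂_σ` of it. Moving `∂_σ` onto the symbol produces `-f
- σ∂_σf`, and the derivative of the prefactor `κ` cancels `-f`. No power of `t` remains, and the
gain of `lowWeight` from `σ` reduces the cost of `∂_σ` to one factor `1-σ²`. -/
theorem Sym.exists_flow {m : ℕ} {w : ℝ → ℝ → ℝ} {f : ℝ → ℝ → ℂ} (hf : Sym (m + 1) w f)
    (hw : ∀ x, ∀ σ ∈ Ioo (-1 : ℝ) 1, 0 ≤ w x σ) (ht : Tame 2 w) :
    ∃ g : ℝ → ℝ → ℂ, Sym m (fun x σ => w x σ / (1 - σ ^ 2)) g ∧ (OddSnd f → OddSnd g) ∧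
      ∀ t x, HasDerivAt (flow f t) (flow g t x) x := by
  have hcont := hf.continuousOn
  obtain ⟨⟨C, hC, hb⟩, fx, fσ, hd, hx, hs⟩ := hf
  -- The new symbol is `∂ₓf - σ∂_σf`, which is again odd in `σ` when `f` is.
  refine ⟨fun x σ => fx x σ + -1 * ((σ : ℂ) * fσ x σ), ?_, ?_, ?_⟩
  · refine Sym.add (hx.mono' fun x σ hσ => le_div_self (hw x σ hσ) (one_sub_sq_pos hσ) (one_sub_sq_le_one σ))
      ((Sym.const_mul (-1) ((Sym.snd m).mul hs)).mono' fun x σ hσ => le_of_eq ?_)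
    have := lowWeight_pos x σ
    have := one_sub_sq_pos hσ
    rw [scaleWeight]
    field_simp
  · intro ho x σ hσ
    have hσ' := neg_mem_Ioo hσ
    have h1 : fx x (-σ) = -fx x σ := by
      have e : (fun y => f y (-σ)) = fun y => -f y σ := funext fun y => ho y σ hσ
      have := (hd x (-σ) hσ').1
      rw [e] at this
      exact this.unique (hd x σ hσ).1.neg
    have h2 : fσ x (-σ) = fσ x σ := by
      have e : f x =ᶠ[𝓝 σ] fun s => -f x (-s) := by
        filter_upwards [isOpen_Ioo.mem_nhds hσ] with s hs'
        rw [ho x s hs', neg_neg]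
      have h3 : HasDerivAt (fun s => -f x (-s)) (fσ x (-σ)) σ := by
        have := (HasDerivAt.scomp σ (hd x (-σ) hσ').2 (hasDerivAt_neg σ)).fun_neg
        simpa using this
      exact (h3.congr_of_eventuallyEq e).unique (hd x σ hσ).2
    simp only [h1, h2]
    push_cast
    ring
  · intro t x₀
    obtain ⟨B, hB, hBw⟩ := ht x₀
    obtain ⟨C1, hC1, hb1⟩ := hx.bound
    obtain ⟨C2, hC2, hb2⟩ := hs.bound
    have hx₀ : x₀ ∈ Ioo (x₀ - 1) (x₀ + 1) := ⟨by linarith, by linarith⟩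
    have hwB : ∀ x ∈ Ioo (x₀ - 1) (x₀ + 1), ∀ σ ∈ Ioo (-1 : ℝ) 1, w x σ ≤ B := fun x hx' σ hσ =>
      (hBw x hx' σ hσ).trans (mul_le_of_le_one_right hB
        (pow_le_one₀ (one_sub_sq_pos hσ).le (one_sub_sq_le_one σ)))
    have hfi : ∀ x ∈ Ioo (x₀ - 1) (x₀ + 1), IntegrableOn (f x) (Ioo (-1 : ℝ) 1) := fun x hx' =>
      integrableOn_of_continuousOn_of_bound (hcont x) (integrableOn_Ioo_const (C * B))
        fun σ hσ => (hb x σ hσ).trans (mul_le_mul_of_nonneg_left (hwB x hx' σ hσ) hC)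
    have hfxi : IntegrableOn (fx x₀) (Ioo (-1 : ℝ) 1) :=
      integrableOn_of_continuousOn_of_bound (hx.continuousOn x₀) (integrableOn_Ioo_const (C1 * B))
        fun σ hσ => (hb1 x₀ σ hσ).trans (mul_le_mul_of_nonneg_left (hwB x₀ hx₀ σ hσ) hC1)
    have hcl : 0 < Real.exp (2 * x₀) * highWeight x₀ := mul_pos (Real.exp_pos _) (highWeight_pos _)
    have hfσi : IntegrableOn (fσ x₀) (Ioo (-1 : ℝ) 1) :=
      integrableOn_of_continuousOn_of_bound (hs.continuousOn x₀)
        (integrableOn_Ioo_const (C2 * (B / (Real.exp (2 * x₀) * highWeight x₀)))) fun σ hσ => by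
        refine (hb2 x₀ σ hσ).trans (mul_le_mul_of_nonneg_left ?_ hC2)
        have hp := one_sub_sq_pos hσ
        have hl := lowWeight_ge x₀ σ
        simp only [scaleWeight]
        rw [div_le_div_iff₀ (mul_pos hp (lowWeight_pos x₀ σ)) hcl]
        have h1 := hBw x₀ hx₀ σ hσ
        have h2 : B * (1 - σ ^ 2) ^ 2 ≤ B * (1 - σ ^ 2) := mul_le_mul_of_nonneg_left
          (pow_le_of_le_one hp.le (one_sub_sq_le_one σ) two_ne_zero) hB
        calc w x₀ σ * (Real.exp (2 * x₀) * highWeight x₀) ≤ (B * (1 - σ ^ 2)) * lowWeight x₀ σ := by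
              gcongr; exact h1.trans h2
          _ = _ := by ring
    -- differentiation under the integral sign
    have hexp : ∀ (x σ : ℝ), HasDerivAt
        (fun x : ℝ => Complex.exp (Complex.I * (σ : ℂ) * ((Real.exp x * t : ℝ) : ℂ)))
        (Complex.exp (Complex.I * (σ : ℂ) * ((Real.exp x * t : ℝ) : ℂ))
          * (Complex.I * (σ : ℂ) * ((Real.exp x * t : ℝ) : ℂ))) x := fun x σ =>
      ((((Real.hasDerivAt_exp x).mul_const t).ofReal_comp).const_mul (Complex.I * (σ : ℂ))).cexp
    have hder := (hasDerivAt_integral_of_dominated_loc_of_deriv_le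
      (μ := volume.restrict (Ioo (-1 : ℝ) 1)) (s := Ioo (x₀ - 1) (x₀ + 1)) (x₀ := x₀)
      (F := fun x σ => Complex.exp (Complex.I * (σ : ℂ) * ((Real.exp x * t : ℝ) : ℂ)) * f x σ)
      (F' := fun x σ => Complex.exp (Complex.I * (σ : ℂ) * ((Real.exp x * t : ℝ) : ℂ))
          * (Complex.I * (σ : ℂ) * ((Real.exp x * t : ℝ) : ℂ)) * f x σ
        + Complex.exp (Complex.I * (σ : ℂ) * ((Real.exp x * t : ℝ) : ℂ)) * fx x σ)
      (bound := fun _ => Real.exp (x₀ + 1) * |t| * (C * B) + C1 * B)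
      (Ioo_mem_nhds hx₀.1 hx₀.2) ?_ ?_ ?_ ?_ ?_ ?_)
    rotate_left
    · filter_upwards [Ioo_mem_nhds hx₀.1 hx₀.2] with x hx'
      exact (IntegrableOn.exp_mul (hfi x hx') _).aestronglyMeasurable
    · exact IntegrableOn.exp_mul (hfi x₀ hx₀) _
    · refine AEStronglyMeasurable.add ?_ (IntegrableOn.exp_mul hfxi _).aestronglyMeasurable
      exact (Continuous.aestronglyMeasurable (by fun_prop)).mul (hfi x₀ hx₀).aestronglyMeasurable
    · refine (ae_restrict_iff' measurableSet_Ioo).2 (ae_of_all _ fun σ hσ x hx' => ?_)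
      refine (norm_add_le _ _).trans (add_le_add ?_ ?_)
      · rw [norm_mul, norm_mul, norm_exp_I_mul, one_mul, norm_mul, norm_mul, Complex.norm_I, one_mul,
          Complex.norm_real, Complex.norm_real, Real.norm_eq_abs, Real.norm_eq_abs, abs_mul, Real.abs_exp]
        have h1 := (abs_lt_one_of_mem hσ).le
        have h2 := (hb x σ hσ).trans (mul_le_mul_of_nonneg_left (hwB x hx' σ hσ) hC)
        have h3 : Real.exp x ≤ Real.exp (x₀ + 1) := Real.exp_le_exp.2 hx'.2.le
        calc _ ≤ 1 * (Real.exp (x₀ + 1) * |t|) * (C * B) := by gcongr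
          _ = _ := by ring
      · rw [norm_mul, norm_exp_I_mul, one_mul]
        exact (hb1 x σ hσ).trans (mul_le_mul_of_nonneg_left (hwB x hx' σ hσ) hC1)
    · exact integrableOn_Ioo_const _
    · refine (ae_restrict_iff' measurableSet_Ioo).2 (ae_of_all _ fun σ hσ x hx' => ?_)
      exact (hexp x σ).mul (hd x σ hσ).1
    have hprod := (Real.hasDerivAt_exp x₀).ofReal_comp.mul hder.2
    refine hprod.congr_deriv ?_
    -- integration by parts
    set T := Real.exp x₀ * t with hT
    have hσfσ : IntegrableOn (fun σ : ℝ => (σ : ℂ) * fσ x₀ σ) (Ioo (-1 : ℝ) 1) :=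
      Integrable.bdd_mul (c := 1) hfσi (Continuous.aestronglyMeasurable (by fun_prop))
        ((ae_restrict_iff' measurableSet_Ioo).2 (ae_of_all _ fun σ hσ => by
          rw [Complex.norm_real]; exact (abs_lt_one_of_mem hσ).le))
    have hibp := oscInt_deriv (g := fun σ => (σ : ℂ) * f x₀ σ)
      (g' := fun σ => 1 * f x₀ σ + (σ : ℂ) * fσ x₀ σ) (C := C * B)
      (fun σ hσ => (hasDerivAt_id σ).ofReal_comp.mul (hd x₀ σ hσ).2) (fun σ hσ => by
        rw [norm_mul, Complex.norm_real, Real.norm_eq_abs, mul_assoc]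
        have h1 := (abs_lt_one_of_mem hσ).le
        have h2 := (hb x₀ σ hσ).trans (mul_le_mul_of_nonneg_left (hBw x₀ hx₀ σ hσ) hC)
        calc _ ≤ 1 * (C * (B * (1 - σ ^ 2) ^ 2)) := by gcongr
          _ = _ := one_mul _) (by simp only [one_mul]; exact (hfi x₀ hx₀).add hσfσ) T
    have hσf : IntegrableOn (fun σ : ℝ => (σ : ℂ) * f x₀ σ) (Ioo (-1 : ℝ) 1) :=
      Integrable.bdd_mul (c := 1) (hfi x₀ hx₀) (Continuous.aestronglyMeasurable (by fun_prop))
        ((ae_restrict_iff' measurableSet_Ioo).2 (ae_of_all _ fun σ hσ => by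
          rw [Complex.norm_real]; exact (abs_lt_one_of_mem hσ).le))
    have e1 : ∫ σ in Ioo (-1 : ℝ) 1, (Complex.exp (Complex.I * (σ : ℂ) * (T : ℂ))
          * (Complex.I * (σ : ℂ) * (T : ℂ)) * f x₀ σ
        + Complex.exp (Complex.I * (σ : ℂ) * (T : ℂ)) * fx x₀ σ)
        = Complex.I * T * oscInt (fun σ => (σ : ℂ) * f x₀ σ) T + oscInt (fx x₀) T := by
      rw [oscInt, oscInt, ← integral_const_mul, ← integral_add ((IntegrableOn.exp_mul hσf T).const_mul _)
        (IntegrableOn.exp_mul hfxi T)]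
      refine integral_congr_ae (ae_of_all _ fun σ => ?_)
      simp only
      ring
    have e2 : oscInt (fun σ => 1 * f x₀ σ + (σ : ℂ) * fσ x₀ σ) T
        = oscInt (f x₀) T + oscInt (fun σ => (σ : ℂ) * fσ x₀ σ) T := by
      rw [oscInt, oscInt, oscInt, ← integral_add (IntegrableOn.exp_mul (hfi x₀ hx₀) T)
        (IntegrableOn.exp_mul hσfσ T)]
      refine integral_congr_ae (ae_of_all _ fun σ => ?_)
      simp only
      ring
    have e3 : oscInt (fun σ => fx x₀ σ + -1 * ((σ : ℂ) * fσ x₀ σ)) T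
        = oscInt (fx x₀) T - oscInt (fun σ => (σ : ℂ) * fσ x₀ σ) T := by
      rw [oscInt, oscInt, oscInt, ← integral_sub (IntegrableOn.exp_mul hfxi T)
        (IntegrableOn.exp_mul hσfσ T)]
      refine integral_congr_ae (ae_of_all _ fun σ => ?_)
      simp only
      ring
    rw [e1, hibp, e2, flow, e3]
    change (Real.exp x₀ : ℂ) * oscInt (f x₀) T + _ = _
    ring

theorem Tame.mono_left {a b : ℕ} (h : a ≤ b) {w : ℝ → ℝ → ℝ} (hw : Tame b w) : Tame a w := fun x₀ => by
  obtain ⟨B, hB, hb⟩ := hw x₀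
  exact ⟨B, hB, fun x hx σ hσ => (hb x hx σ hσ).trans (mul_le_mul_of_nonneg_left
    (pow_le_pow_of_le_one (one_sub_sq_pos hσ).le (one_sub_sq_le_one σ) h) hB)⟩

theorem Tame.pow_mul {v : ℝ → ℝ → ℝ} (hv : Tame 0 v) (a : ℕ) : Tame a fun x σ => (1 - σ ^ 2) ^ a * v x σ :=
  fun x₀ => by
    obtain ⟨B, hB, hb⟩ := hv x₀
    refine ⟨B, hB, fun x hx σ hσ => ?_⟩
    have := hb x hx σ hσ
    rw [pow_zero, mul_one] at this
    rw [mul_comm B]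
    exact mul_le_mul_of_nonneg_left this (pow_nonneg (one_sub_sq_pos hσ).le _)

/-- Iterating `exists_flow`: the `j`-th derivative in `log κ` is the flow of a symbol with `n - j`
derivatives left and endpoint exponent `n - j + 2`, two above the number of remaining integrations
by parts. -/
theorem Sym.exists_chain : ∀ (n : ℕ) {v : ℝ → ℝ → ℝ} {f : ℝ → ℝ → ℂ},
    (∀ x, ∀ σ ∈ Ioo (-1 : ℝ) 1, 0 ≤ v x σ) → Tame 0 v →
    Sym n (fun x σ => (1 - σ ^ 2) ^ (n + 2) * v x σ) f →
    ∃ g : ℕ → ℝ → ℝ → ℂ, g 0 = f ∧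
      (∀ j ≤ n, Sym (n - j) (fun x σ => (1 - σ ^ 2) ^ (n - j + 2) * v x σ) (g j)) ∧
      (OddSnd f → ∀ j ≤ n, OddSnd (g j)) ∧
      ∀ j < n, ∀ t x, HasDerivAt (flow (g j) t) (flow (g (j + 1)) t x) x
  | 0, v, f, _, _, hf => ⟨fun _ => f, rfl, fun j hj => by
      obtain rfl : j = 0 := by omega
      exact hf, fun h _ _ => h, fun j hj => absurd hj (by omega)⟩
  | n + 1, v, f, hv, ht, hf => by
    obtain ⟨g₁, hg₁, ho, hd⟩ := hf.exists_flow
      (fun x σ hσ => mul_nonneg (pow_nonneg (one_sub_sq_pos hσ).le _) (hv x σ hσ))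
      ((ht.pow_mul (n + 1 + 2)).mono_left (by omega))
    obtain ⟨g, hg0, hgs, hgo, hgd⟩ := Sym.exists_chain n (f := g₁) hv ht (hg₁.mono' fun x σ hσ => le_of_eq (by
      have := (one_sub_sq_pos hσ).ne'
      rw [show n + 1 + 2 = n + 2 + 1 from rfl, pow_succ]
      field_simp))
    refine ⟨fun j => Nat.casesOn j f g, rfl, fun j hj => ?_, fun hof j hj => ?_, fun j hj t x => ?_⟩
    · cases j with
      | zero => exact hf
      | succ j =>
        rw [show n + 1 - (j + 1) = n - j by omega]
        exact hgs j (by omega)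
    · cases j with
      | zero => exact hof
      | succ j => exact hgo (ho hof) j (by omega)
    · cases j with
      | zero =>
        simp only
        rw [hg0]
        exact hd t x
      | succ j => exact hgd j (by omega) t x

/-! ### Bounds on the two parts -/

theorem jap_le_one_add_abs (x : ℝ) : jap x ≤ 1 + |x| := by
  rw [jap, Real.sqrt_le_left (by positivity), ← sq_abs]
  nlinarith [abs_nonneg x]

theorem jap_pow_mul_le {y C₁ C₂ T : ℝ} {L : ℕ} (hy : 0 ≤ y) (h₁ : y ≤ C₁) (h₂ : |T| ^ L * y ≤ C₂) :
    jap T ^ L * y ≤ 2 ^ L * (C₁ + C₂) := by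
  have h : jap T ^ L ≤ 2 ^ L * (1 + |T| ^ L) := by
    calc jap T ^ L ≤ (1 + |T|) ^ L := by
          have := (jap_pos T).le
          gcongr
          exact jap_le_one_add_abs T
      _ ≤ 2 ^ (L - 1) * (1 ^ L + |T| ^ L) := add_pow_le zero_le_one (abs_nonneg T) L
      _ ≤ 2 ^ L * (1 + |T| ^ L) := by
          rw [one_pow]
          gcongr
          · norm_num
          · omega
  calc jap T ^ L * y ≤ 2 ^ L * (1 + |T| ^ L) * y := by gcongr
    _ = 2 ^ L * (y + |T| ^ L * y) := by ring
    _ ≤ _ := by gcongr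

/-- The `n ≥ L` powers of `lowWeight` pay for all `L` integrations by parts, leaving an integrand
bounded by `highWeight`. The bounds of orders `0` and `L` combine to the bracket. -/
theorem Sym.exists_flow_high {L n : ℕ} (hL : L ≤ n) {g : ℝ → ℝ → ℂ}
    (hg : Sym L (fun x σ => (1 - σ ^ 2) ^ (L + 2) * (lowWeight x σ ^ n * highWeight x)) g) :
    ∃ C : ℝ, 0 ≤ C ∧ ∀ x t : ℝ,
      jap (Real.exp x * t) ^ L * ‖flow g t x‖ ≤ C * (Real.exp x * highWeight x) := by
  set u : ℝ → ℝ → ℝ := fun x σ => (1 - σ ^ 2) * highWeight x with hu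
  have hu0 : ∀ x, ∀ σ ∈ Ioo (-1 : ℝ) 1, 0 ≤ u x σ := fun x σ hσ =>
    mul_nonneg (one_sub_sq_pos hσ).le (highWeight_pos x).le
  have hwu : ∀ x, ∀ σ ∈ Ioo (-1 : ℝ) 1, (1 - σ ^ 2) ^ (L + 2) * (lowWeight x σ ^ n * highWeight x)
      ≤ u x σ * scaleWeight x σ ^ L := by
    intro x σ hσ
    have hp := one_sub_sq_pos hσ
    have hp1 := one_sub_sq_le_one σ
    have hl := lowWeight_pos x σ
    have hA := highWeight_pos x
    calc (1 - σ ^ 2) ^ (L + 2) * (lowWeight x σ ^ n * highWeight x)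
        ≤ (1 - σ ^ 2) ^ (L + 1) * (lowWeight x σ ^ L * highWeight x) := by
          gcongr ?_ * (?_ * _)
          · exact pow_le_pow_of_le_one hp.le hp1 (by omega)
          · exact pow_le_pow_of_le_one hl.le (lowWeight_le_one x hσ) hL
      _ = _ := by rw [hu, scaleWeight, mul_pow]; ring
  have hui : ∀ x, IntegrableOn (u x) (Ioo (-1 : ℝ) 1) := fun x =>
    ((by fun_prop : Continuous (u x)).continuousOn.integrableOn_compact isCompact_Icc).mono_set
      Ioo_subset_Icc_self
  have hut : ∀ x, ∃ B, 0 ≤ B ∧ ∀ σ ∈ Ioo (-1 : ℝ) 1, u x σ ≤ B * (1 - σ ^ 2) := fun x =>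
    ⟨highWeight x, (highWeight_pos x).le, fun σ _ => (mul_comm _ _).le⟩
  obtain ⟨C₁, hC₁, h₁⟩ := hg.exists_decay 0 (Nat.zero_le L) hu0 (fun x σ hσ => by
    refine (hwu x σ hσ).trans ?_
    rw [pow_zero, mul_one]
    exact mul_le_of_le_one_right (hu0 x σ hσ) (pow_le_one₀ (scaleWeight_pos x hσ).le
      (scaleWeight_le_one x hσ))) hui hut
  obtain ⟨C₂, hC₂, h₂⟩ := hg.exists_decay L le_rfl hu0 hwu hui hut
  have hint : ∀ x, ∫ σ in Ioo (-1 : ℝ) 1, u x σ ≤ 2 * highWeight x := by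
    intro x
    calc ∫ σ in Ioo (-1 : ℝ) 1, u x σ ≤ ∫ _ in Ioo (-1 : ℝ) 1, highWeight x :=
          setIntegral_mono_on (hui x) (integrableOn_Ioo_const _) measurableSet_Ioo fun σ _ =>
            mul_le_of_le_one_left (highWeight_pos x).le (one_sub_sq_le_one σ)
      _ = 2 * highWeight x := by rw [setIntegral_const]; simp; norm_num
  refine ⟨2 ^ L * (C₁ * 2 + C₂ * 2), by positivity, fun x t => ?_⟩
  have hA := highWeight_pos x
  have h := jap_pow_mul_le (y := ‖oscInt (g x) (Real.exp x * t)‖) (C₁ := C₁ * (2 * highWeight x))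
    (C₂ := C₂ * (2 * highWeight x)) (T := Real.exp x * t) (L := L) (norm_nonneg _)
    (by simpa using (h₁ x (Real.exp x * t)).trans (mul_le_mul_of_nonneg_left (hint x) hC₁))
    ((h₂ x (Real.exp x * t)).trans (mul_le_mul_of_nonneg_left (hint x) hC₂))
  rw [flow, norm_mul, Complex.norm_real, Real.norm_eq_abs, Real.abs_exp]
  calc _ = Real.exp x * (jap (Real.exp x * t) ^ L * ‖oscInt (g x) (Real.exp x * t)‖) := by ring
    _ ≤ Real.exp x * (2 ^ L * (C₁ * (2 * highWeight x) + C₂ * (2 * highWeight x))) := by gcongr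
    _ = _ := by ring

theorem one_sub_cos_le (y : ℝ) : 1 - Real.cos y ≤ 4 * y ^ 2 / (1 + y ^ 2) := by
  rw [le_div_iff₀ (by positivity)]
  have h1 := Real.one_sub_sq_div_two_le_cos (x := y)
  have h2 := Real.neg_one_le_cos y
  rcases le_or_gt (y ^ 2) 1 with h | h <;> nlinarith [sq_nonneg y]

/-- Oddness leaves only the sine. Integrating by parts with the primitive `(1 - cos σT)/T`, which
vanishes quadratically at `σ = 0`, requires only `σ²|f'| ≤ C`. The majorant `4C|T|/(1+T²σ²)` has
integral `4πC` for every `T ≠ 0`. -/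
theorem norm_oscInt_le_of_odd {f f' : ℝ → ℂ} {B C : ℝ} (hC : 0 ≤ C)
    (hd : ∀ σ ∈ Ioo (-1 : ℝ) 1, HasDerivAt f (f' σ) σ) (ho : ∀ σ ∈ Ioo (-1 : ℝ) 1, f (-σ) = -f σ)
    (hb : ∀ σ ∈ Ioo (-1 : ℝ) 1, ‖f σ‖ ≤ B * (1 - σ ^ 2) ^ 2) (hf' : IntegrableOn f' (Ioo (-1 : ℝ) 1))
    (hC' : ∀ σ ∈ Ioo (-1 : ℝ) 1, σ ^ 2 * ‖f' σ‖ ≤ C) (T : ℝ) : ‖oscInt f T‖ ≤ 4 * Real.pi * C := by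
  have hfc : ContinuousOn f (Ioo (-1 : ℝ) 1) := fun σ hσ => (hd σ hσ).continuousAt.continuousWithinAt
  have hfi : IntegrableOn f (Ioo (-1 : ℝ) 1) := by
    refine integrableOn_of_continuousOn_of_bound hfc (u := fun σ => B * (1 - σ ^ 2) ^ 2) ?_ hb
    exact ((by fun_prop : Continuous fun σ : ℝ => B * (1 - σ ^ 2) ^ 2).continuousOn.integrableOn_compact
      isCompact_Icc).mono_set Ioo_subset_Icc_self
  rcases eq_or_ne T 0 with rfl | hT
  · have : oscInt f 0 = 0 := by
      rw [oscInt]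
      refine integral_Ioo_eq_zero_of_odd fun σ hσ => ?_
      simp [ho σ hσ]
    rw [this, norm_zero]; positivity
  have hmul : ∀ a : ℝ → ℝ, Continuous a → (∀ σ, |a σ| ≤ 1) →
      IntegrableOn (fun σ => (a σ : ℂ) * f σ) (Ioo (-1 : ℝ) 1) := fun a ha hb =>
    Integrable.bdd_mul (c := 1) hfi (Complex.continuous_ofReal.comp ha).aestronglyMeasurable
      (ae_of_all _ fun σ => by rw [Complex.norm_real]; exact hb σ)
  have hcos0 : ∫ σ in Ioo (-1 : ℝ) 1, ((Real.cos (σ * T) : ℝ) : ℂ) * f σ = 0 := by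
    refine integral_Ioo_eq_zero_of_odd fun σ hσ => ?_
    rw [ho σ hσ, neg_mul, Real.cos_neg, mul_neg]
  have hsin : oscInt f T = Complex.I * ∫ σ in Ioo (-1 : ℝ) 1, ((Real.sin (σ * T) : ℝ) : ℂ) * f σ := by
    rw [← zero_add (Complex.I * _), ← hcos0, ← integral_const_mul, oscInt, ← integral_add
      (hmul _ (by fun_prop) fun σ => Real.abs_cos_le_one _)
      ((hmul _ (by fun_prop) fun σ => Real.abs_sin_le_one _).const_mul _)]
    refine integral_congr_ae (ae_of_all _ fun σ => ?_)
    simp only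
    have e : Complex.I * (σ : ℂ) * (T : ℂ) = ((σ * T : ℝ) : ℂ) * Complex.I := by push_cast; ring
    rw [e, Complex.exp_mul_I]
    push_cast
    ring
  have hφ : ∀ σ : ℝ, HasDerivAt (fun σ : ℝ => (((1 - Real.cos (σ * T)) / T : ℝ) : ℂ))
      ((Real.sin (σ * T) : ℝ) : ℂ) σ := by
    intro σ
    have h1 : HasDerivAt (fun σ : ℝ => (1 - Real.cos (σ * T)) / T) (Real.sin (σ * T)) σ := by
      have := (((hasDerivAt_id σ).mul_const T).cos.const_sub 1).div_const T
      refine this.congr_deriv ?_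
      simp only [id, one_mul, neg_mul, neg_neg]
      field_simp
    exact h1.ofReal_comp
  have hφb : ∀ σ : ℝ, ‖(((1 - Real.cos (σ * T)) / T : ℝ) : ℂ)‖ ≤ 2 / |T| := by
    intro σ
    rw [Complex.norm_real, Real.norm_eq_abs, abs_div]
    gcongr
    rw [abs_le]
    constructor <;> linarith [Real.neg_one_le_cos (σ * T), Real.cos_le_one (σ * T)]
  have hibp := setIntegral_deriv_mul hφ (by fun_prop) hφb hd hb hf'
  rw [hsin, norm_mul, Complex.norm_I, one_mul, hibp, norm_neg]
  have hscale : Integrable fun σ : ℝ => (1 + (T * σ) ^ 2)⁻¹ :=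
    integrable_inv_one_add_sq.comp_mul_left' hT
  have hbound : ∀ σ ∈ Ioo (-1 : ℝ) 1, ‖(((1 - Real.cos (σ * T)) / T : ℝ) : ℂ) * f' σ‖
      ≤ 4 * C * |T| * (1 + (T * σ) ^ 2)⁻¹ := by
    intro σ hσ
    have h1 : 0 ≤ 1 - Real.cos (σ * T) := by linarith [Real.cos_le_one (σ * T)]
    have hT0 : 0 < |T| := abs_pos.2 hT
    rw [norm_mul, Complex.norm_real, Real.norm_eq_abs, abs_div, abs_of_nonneg h1]
    calc (1 - Real.cos (σ * T)) / |T| * ‖f' σ‖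
        ≤ (4 * (σ * T) ^ 2 / (1 + (σ * T) ^ 2)) / |T| * ‖f' σ‖ := by
          gcongr; exact one_sub_cos_le _
      _ = 4 * |T| * (1 + (T * σ) ^ 2)⁻¹ * (σ ^ 2 * ‖f' σ‖) := by
          rw [mul_pow, ← sq_abs T, mul_comm T σ]
          field_simp
          rw [sq_abs]
          ring
      _ ≤ 4 * |T| * (1 + (T * σ) ^ 2)⁻¹ * C := by gcongr; exact hC' σ hσ
      _ = _ := by ring
  calc _ ≤ ∫ σ in Ioo (-1 : ℝ) 1, 4 * C * |T| * (1 + (T * σ) ^ 2)⁻¹ :=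
        norm_integral_le_of_norm_le (hscale.const_mul _).integrableOn
          ((ae_restrict_iff' measurableSet_Ioo).2 (ae_of_all _ hbound))
    _ ≤ ∫ σ : ℝ, 4 * C * |T| * (1 + (T * σ) ^ 2)⁻¹ :=
        setIntegral_le_integral (hscale.const_mul _) (ae_of_all _ fun σ => by positivity)
    _ = 4 * Real.pi * C := by
        rw [integral_const_mul, Measure.integral_comp_mul_left (fun σ : ℝ => (1 + σ ^ 2)⁻¹),
          integral_univ_inv_one_add_sq, smul_eq_mul, abs_inv]
        have : |T| ≠ 0 := abs_ne_zero.2 hT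
        field_simp

theorem integral_inv_sq_add_sq {a : ℝ} (ha : 0 < a) :
    Integrable (fun σ : ℝ => (a ^ 2 + σ ^ 2)⁻¹) ∧ ∫ σ : ℝ, (a ^ 2 + σ ^ 2)⁻¹ = Real.pi / a := by
  have e : (fun σ : ℝ => (a ^ 2 + σ ^ 2)⁻¹) = fun σ : ℝ => (a ^ 2)⁻¹ * (1 + (a⁻¹ * σ) ^ 2)⁻¹ := by
    ext σ
    field_simp
  rw [e]
  refine ⟨(integrable_inv_one_add_sq.comp_mul_left' (inv_ne_zero ha.ne')).const_mul _, ?_⟩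
  rw [integral_const_mul, Measure.integral_comp_mul_left (fun σ : ℝ => (1 + σ ^ 2)⁻¹),
    integral_univ_inv_one_add_sq, smul_eq_mul, inv_inv, abs_of_pos ha]
  field_simp

/-- With `l + 1` integrations by parts the integrand is of size `(κ²+|σ|)^{-(l+2)}`, whose integral
is `O(κ^{-2(l+1)})`, so the effective time is `κ²·κt = κ³t`. Short times rely on oddness and need
one `σ`-derivative, which is why the order is `l + 1` and not `l`. -/
theorem Sym.exists_flow_low {l n : ℕ} (hl : l + 1 ≤ n) {g : ℝ → ℝ → ℂ} (ho : OddSnd g)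
    (hg : Sym (l + 1) (fun x σ => (1 - σ ^ 2) ^ (l + 1 + 2) * ((lowWeight x σ)⁻¹ * highWeight x ^ (n + 2))) g) :
    ∃ C : ℝ, 0 ≤ C ∧ ∀ x t : ℝ,
      jap (Real.exp x ^ 3 * t) ^ (l + 1) * ‖flow g t x‖ ≤ C * Real.exp x := by
  set e : ℝ → ℝ := fun x => Real.exp (2 * x) with he
  have he0 : ∀ x, 0 < e x := fun x => Real.exp_pos _
  -- long times
  set u : ℝ → ℝ → ℝ := fun x σ => (1 - σ ^ 2) * ((e x ^ l)⁻¹ * (e x ^ 2 + σ ^ 2)⁻¹) with hu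
  have hu0 : ∀ x, ∀ σ ∈ Ioo (-1 : ℝ) 1, 0 ≤ u x σ := fun x σ hσ => by
    have := one_sub_sq_pos hσ
    have := he0 x
    simp only [hu]
    positivity
  have hwu : ∀ x, ∀ σ ∈ Ioo (-1 : ℝ) 1, (1 - σ ^ 2) ^ (l + 1 + 2) * ((lowWeight x σ)⁻¹ *
      highWeight x ^ (n + 2)) ≤ u x σ * scaleWeight x σ ^ (l + 1) := by
    intro x σ hσ
    have hp := one_sub_sq_pos hσ
    have hp1 := one_sub_sq_le_one σ
    have hlw := lowWeight_pos x σ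
    have hA := highWeight_pos x
    have hA1 := highWeight_le_one x
    have hex := he0 x
    have hs : 0 < e x + |σ| := by positivity
    have h1 : highWeight x ^ (n + 2) ≤ highWeight x ^ (l + 2) := pow_le_pow_of_le_one hA.le hA1 (by omega)
    -- Splits the exponent so that the remaining integral is the elementary one of `(a²+σ²)⁻¹` with
    -- `a = κ²`.
    have h2 : e x ^ l * (e x ^ 2 + σ ^ 2) ≤ (e x + |σ|) ^ (l + 2) := by
      rw [pow_add (e x + |σ|)]
      have h3 : e x ^ 2 + σ ^ 2 ≤ (e x + |σ|) ^ 2 := by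
        rw [← sq_abs σ]; nlinarith [abs_nonneg σ]
      have h4 : e x ^ l ≤ (e x + |σ|) ^ l := by
        gcongr; exact le_add_of_nonneg_right (abs_nonneg σ)
      gcongr
    -- Here the powers of `highWeight` are used up: they replace `lowWeight` by `κ² + |σ|` in the
    -- denominator.
    have h3 : (lowWeight x σ)⁻¹ * highWeight x ^ (l + 2)
        = lowWeight x σ ^ (l + 1) * ((e x + |σ|) ^ (l + 2))⁻¹ := by
      rw [lowWeight_eq]
      have := hA.ne'
      simp only [he] at hs ⊢
      have hs' := hs.ne'
      rw [mul_pow, mul_inv]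
      field_simp
      ring
    calc (1 - σ ^ 2) ^ (l + 1 + 2) * ((lowWeight x σ)⁻¹ * highWeight x ^ (n + 2))
        ≤ (1 - σ ^ 2) ^ (l + 2) * ((lowWeight x σ)⁻¹ * highWeight x ^ (l + 2)) := by
          gcongr ?_ * (_ * ?_)
          exact pow_le_pow_of_le_one hp.le hp1 (by omega)
      _ ≤ (1 - σ ^ 2) ^ (l + 2) * (lowWeight x σ ^ (l + 1) * (e x ^ l * (e x ^ 2 + σ ^ 2))⁻¹) := by
          rw [h3]
          gcongr
      _ = _ := by simp only [hu]; rw [scaleWeight, mul_pow, mul_inv]; ring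
  have hui : ∀ x, IntegrableOn (u x) (Ioo (-1 : ℝ) 1) := fun x => by
    have hc : Continuous (u x) := by
      refine Continuous.mul (by fun_prop) (continuous_const.mul (Continuous.inv₀ (by fun_prop) fun σ => ?_))
      have := he0 x
      positivity
    exact (hc.continuousOn.integrableOn_compact isCompact_Icc).mono_set Ioo_subset_Icc_self
  have hut : ∀ x, ∃ B, 0 ≤ B ∧ ∀ σ ∈ Ioo (-1 : ℝ) 1, u x σ ≤ B * (1 - σ ^ 2) := fun x => by
    have := he0 x
    refine ⟨(e x ^ l)⁻¹ * (e x ^ 2)⁻¹, by positivity, fun σ hσ => ?_⟩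
    have hp := one_sub_sq_pos hσ
    rw [mul_comm]
    simp only [hu]
    gcongr
    exact le_add_of_nonneg_right (sq_nonneg σ)
  obtain ⟨C₂, hC₂, h₂⟩ := hg.exists_decay (l + 1) le_rfl hu0 hwu hui hut
  have hint : ∀ x, ∫ σ in Ioo (-1 : ℝ) 1, u x σ ≤ Real.pi * (e x ^ (l + 1))⁻¹ := by
    intro x
    obtain ⟨hi, hv⟩ := integral_inv_sq_add_sq (he0 x)
    have hex := he0 x
    calc ∫ σ in Ioo (-1 : ℝ) 1, u x σ ≤ ∫ σ in Ioo (-1 : ℝ) 1, (e x ^ l)⁻¹ * (e x ^ 2 + σ ^ 2)⁻¹ :=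
          setIntegral_mono_on (hui x) (hi.const_mul _).integrableOn measurableSet_Ioo fun σ _ =>
            mul_le_of_le_one_left (by positivity) (one_sub_sq_le_one σ)
      _ ≤ ∫ σ : ℝ, (e x ^ l)⁻¹ * (e x ^ 2 + σ ^ 2)⁻¹ :=
          setIntegral_le_integral (hi.const_mul _) (ae_of_all _ fun σ => by positivity)
      _ = _ := by rw [integral_const_mul, hv, pow_succ]; field_simp
  -- short times
  have hshort : ∃ C₁ : ℝ, 0 ≤ C₁ ∧ ∀ x T, ‖oscInt (g x) T‖ ≤ C₁ := by
    obtain ⟨⟨D, hD, hb⟩, gx, gσ, hd, _, hs⟩ := hg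
    obtain ⟨D', hD', hb'⟩ := hs.bound
    refine ⟨4 * Real.pi * D', by positivity, fun x T => ?_⟩
    have hex := he0 x
    have hA := highWeight_pos x
    have hA1 := highWeight_le_one x
    have hA2 : highWeight x ^ (n + 2) ≤ 1 := pow_le_one₀ hA.le hA1
    have hlge : ∀ σ, e x * highWeight x ≤ lowWeight x σ := fun σ => lowWeight_ge x σ
    have hkey : ∀ σ ∈ Ioo (-1 : ℝ) 1, ‖gσ x σ‖ ≤ D' * ((lowWeight x σ ^ 2)⁻¹ * highWeight x ^ (n + 2)) := by
      intro σ hσ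
      refine (hb' x σ hσ).trans (mul_le_mul_of_nonneg_left ?_ hD')
      have hp := one_sub_sq_pos hσ
      have hlw := lowWeight_pos x σ
      calc (1 - σ ^ 2) ^ (l + 1 + 2) * ((lowWeight x σ)⁻¹ * highWeight x ^ (n + 2)) / scaleWeight x σ
          = (1 - σ ^ 2) ^ (l + 2) * ((lowWeight x σ ^ 2)⁻¹ * highWeight x ^ (n + 2)) := by
            rw [scaleWeight]; field_simp; ring
        _ ≤ _ := mul_le_of_le_one_left (by positivity) (pow_le_one₀ hp.le (one_sub_sq_le_one σ))
    refine norm_oscInt_le_of_odd (B := D * (e x * highWeight x)⁻¹) hD' (fun σ hσ => (hd x σ hσ).2) (ho x)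
      (fun σ hσ => ?_) (integrableOn_of_continuousOn_of_bound (hs.continuousOn x)
      (integrableOn_Ioo_const (D' * (((e x * highWeight x) ^ 2)⁻¹ * 1))) fun σ hσ => ?_) (fun σ hσ => ?_) T
    · refine (hb x σ hσ).trans ?_
      rw [mul_assoc]
      refine mul_le_mul_of_nonneg_left ?_ hD
      have hp := one_sub_sq_pos hσ
      have hlw := lowWeight_pos x σ
      calc _ ≤ (1 - σ ^ 2) ^ 2 * ((e x * highWeight x)⁻¹ * 1) := by
            gcongr ?_ * (?_ * ?_)
            · exact pow_le_pow_of_le_one hp.le (one_sub_sq_le_one σ) (by omega)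
            · exact inv_anti₀ (by positivity) (hlge σ)
        _ = _ := by ring
    · refine (hkey σ hσ).trans ?_
      have hlw := lowWeight_pos x σ
      have := hlge σ
      gcongr
    · have hlw := lowWeight_pos x σ
      have hσl : σ ^ 2 ≤ lowWeight x σ ^ 2 := by
        rw [← sq_abs σ]
        gcongr
        exact abs_le_lowWeight x hσ
      calc σ ^ 2 * ‖gσ x σ‖ ≤ lowWeight x σ ^ 2 * (D' * ((lowWeight x σ ^ 2)⁻¹ * 1)) := by
            gcongr
            exact (hkey σ hσ).trans (by gcongr)
        _ = D' := by field_simp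
  obtain ⟨C₁, hC₁, h₁⟩ := hshort
  refine ⟨2 ^ (l + 1) * (C₁ + C₂ * Real.pi), by positivity, fun x t => ?_⟩
  have hex := he0 x
  have h := jap_pow_mul_le (y := ‖oscInt (g x) (Real.exp x * t)‖) (C₁ := C₁)
    (C₂ := C₂ * Real.pi) (T := Real.exp x ^ 3 * t) (L := l + 1) (norm_nonneg _) (h₁ _ _) (by
      have h3 := (h₂ x (Real.exp x * t)).trans (mul_le_mul_of_nonneg_left (hint x) hC₂)
      have h4 : Real.exp x ^ 3 * t = e x * (Real.exp x * t) := by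
        simp only [he, two_mul, Real.exp_add]; ring
      rw [h4, abs_mul, abs_of_pos hex, mul_pow, mul_assoc]
      calc _ ≤ e x ^ (l + 1) * (C₂ * (Real.pi * (e x ^ (l + 1))⁻¹)) := by gcongr
        _ = _ := by field_simp)
  rw [flow, norm_mul, Complex.norm_real, Real.norm_eq_abs, Real.abs_exp]
  calc _ = Real.exp x * (jap (Real.exp x ^ 3 * t) ^ (l + 1) * ‖oscInt (g x) (Real.exp x * t)‖) := by ring
    _ ≤ Real.exp x * (2 ^ (l + 1) * (C₁ + C₂ * Real.pi)) := by gcongr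
    _ = _ := by ring

/-! ### Radial functions -/

theorem isOpen_ne_zero : IsOpen {k : R3 | k ≠ 0} := isOpen_ne

theorem contDiffOn_log_norm (m : ℕ∞) : ContDiffOn ℝ m (fun k : R3 => Real.log ‖k‖) {k : R3 | k ≠ 0} :=
  fun _ hk => ((contDiffAt_id.norm ℝ hk).log (norm_ne_zero_iff.2 hk)).contDiffWithinAt

theorem contDiffOn_comp_log_norm {m : ℕ} {H : ℝ → ℂ} (hH : ContDiff ℝ m H) :
    ContDiffOn ℝ m (fun k : R3 => H (Real.log ‖k‖)) {k : R3 | k ≠ 0} :=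
  hH.comp_contDiffOn (contDiffOn_log_norm m)

/-- Scale invariance: dilating `k` to the unit sphere shifts the argument of `H` by `log ‖k‖` and
produces the factor `‖k‖^m`. The derivatives of `log ‖·‖` are bounded on the compact sphere, so a
composition bound gives a constant depending only on `m`. -/
theorem exists_radial_bound (m : ℕ) : ∃ K : ℝ, 0 ≤ K ∧ ∀ (H : ℝ → ℂ), ContDiff ℝ m H →
    ∀ (k : R3), k ≠ 0 → ∀ M : ℝ, (∀ j ≤ m, ‖iteratedDeriv j H (Real.log ‖k‖)‖ ≤ M) →
    ‖k‖ ^ m * ‖iteratedFDeriv ℝ m (fun k : R3 => H (Real.log ‖k‖)) k‖ ≤ K * M := by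
  have hso := isOpen_ne_zero
  have hsu := hso.uniqueDiffOn (𝕜 := ℝ)
  have hD : ∀ i : ℕ, ∃ D : ℝ, ∀ y ∈ Metric.sphere (0 : R3) 1,
      ‖iteratedFDerivWithin ℝ i (fun k : R3 => Real.log ‖k‖) {k : R3 | k ≠ 0} y‖ ≤ D := by
    intro i
    refine (isCompact_sphere (0 : R3) 1).exists_bound_of_continuousOn ?_
    refine ((contDiffOn_log_norm i).continuousOn_iteratedFDerivWithin le_rfl hsu).mono fun y hy => ?_
    exact ne_zero_of_mem_unit_sphere (⟨y, hy⟩ : Metric.sphere (0 : R3) 1)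
  choose D hD using hD
  set E := 1 + ∑ i ∈ Finset.range (m + 1), |D i| with hE
  have hE1 : 1 ≤ E := by
    have : 0 ≤ ∑ i ∈ Finset.range (m + 1), |D i| := Finset.sum_nonneg fun _ _ => abs_nonneg _
    linarith
  have hDE : ∀ i ≤ m, D i ≤ E := fun i hi => by
    have := Finset.single_le_sum (f := fun i => |D i|) (fun _ _ => abs_nonneg _)
      (Finset.mem_range.2 (Nat.lt_succ_of_le hi))
    have h2 := le_abs_self (D i)
    linarith
  refine ⟨m.factorial * E ^ m, by positivity, fun H hH k hk M hM => ?_⟩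
  have hκ : 0 < ‖k‖ := norm_pos_iff.2 hk
  set κ := ‖k‖ with hκdef
  set G : ℝ → ℂ := fun x => H (Real.log κ + x) with hG
  have hGc : ContDiff ℝ m G := hH.comp (by fun_prop)
  set L : R3 →L[ℝ] R3 := κ⁻¹ • ContinuousLinearMap.id ℝ R3 with hLdef
  have hLapp : ∀ z, L z = κ⁻¹ • z := fun z => rfl
  have hLn : ‖L‖ ≤ κ⁻¹ := L.opNorm_le_bound (inv_pos.2 hκ).le fun z => by
    rw [hLapp, norm_smul, Real.norm_eq_abs, abs_of_pos (inv_pos.2 hκ)]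
  have hpre : L ⁻¹' {k : R3 | k ≠ 0} = {k : R3 | k ≠ 0} := by
    ext z
    change L z ≠ 0 ↔ z ≠ 0
    rw [hLapp, smul_ne_zero_iff]
    exact ⟨fun h => h.2, fun h => ⟨(inv_pos.2 hκ).ne', h⟩⟩
  set Ψ : R3 → ℂ := fun z => G (Real.log ‖z‖) with hΨ
  have hΨc : ContDiffOn ℝ m Ψ {k : R3 | k ≠ 0} := contDiffOn_comp_log_norm hGc
  have heq : EqOn (fun k : R3 => H (Real.log ‖k‖)) (Ψ ∘ L) {k : R3 | k ≠ 0} := fun z hz => by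
    have hz' : ‖z‖ ≠ 0 := norm_ne_zero_iff.2 hz
    simp only [Function.comp, hΨ, hG, hLapp, norm_smul, Real.norm_eq_abs, abs_of_pos (inv_pos.2 hκ)]
    rw [Real.log_mul (inv_pos.2 hκ).ne' hz', Real.log_inv]
    ring_nf
  have hyn : ‖L k‖ = 1 := by
    rw [hLapp, norm_smul, Real.norm_eq_abs, abs_of_pos (inv_pos.2 hκ), ← hκdef, inv_mul_cancel₀ hκ.ne']
  have hy0 : L k ∈ {k : R3 | k ≠ 0} := fun h => by rw [h, norm_zero] at hyn; norm_num at hyn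
  have hcomp : ‖iteratedFDerivWithin ℝ m Ψ {k : R3 | k ≠ 0} (L k)‖ ≤ m.factorial * M * E ^ m := by
    have hlogy : Real.log ‖L k‖ = 0 := by rw [hyn, Real.log_one]
    refine norm_iteratedFDerivWithin_comp_le (g := G) (f := fun z : R3 => Real.log ‖z‖) (t := univ)
      (N := m) hGc.contDiffOn (contDiffOn_log_norm m) le_rfl uniqueDiffOn_univ hsu (mapsTo_univ _ _) hy0 ?_ ?_
    · intro i hi
      rw [iteratedFDerivWithin_univ, norm_iteratedFDeriv_eq_norm_iteratedDeriv, hlogy]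
      have := congrFun (iteratedDeriv_comp_const_add i H (Real.log κ)) 0
      simp only [add_zero] at this
      rw [hG, this]
      exact hM i hi
    · intro i hi1 hi
      refine (hD i (L k) (by rw [mem_sphere_zero_iff_norm, hyn])).trans ((hDE i hi).trans ?_)
      exact le_self_pow₀ hE1 (by omega)
  rw [← iteratedFDerivWithin_of_isOpen m hso hk, iteratedFDerivWithin_congr heq hk]
  have hright := L.iteratedFDerivWithin_comp_right hΨc hsu (by rw [hpre]; exact hsu) hy0 le_rfl
  rw [hpre] at hright
  rw [hright]
  have hnorm := (ContinuousMultilinearMap.norm_compContinuousLinearMap_le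
    (iteratedFDerivWithin ℝ m Ψ {k : R3 | k ≠ 0} (L k)) (fun _ => L))
  rw [Finset.prod_const, Finset.card_univ, Fintype.card_fin] at hnorm
  have hcomp0 := (norm_nonneg _).trans hcomp
  calc κ ^ m * _ ≤ κ ^ m * (‖iteratedFDerivWithin ℝ m Ψ {k : R3 | k ≠ 0} (L k)‖ * ‖L‖ ^ m) := by gcongr
    _ ≤ κ ^ m * (m.factorial * M * E ^ m * κ⁻¹ ^ m) := by gcongr
    _ = _ := by
      rw [inv_pow]
      field_simp

theorem iteratedDeriv_chain {n : ℕ} {h : ℕ → ℝ → ℂ} (hd : ∀ j < n, ∀ x, HasDerivAt (h j) (h (j + 1) x) x) :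
    ∀ j ≤ n, iteratedDeriv j (h 0) = h j := by
  intro j
  induction j with
  | zero => intro _; exact iteratedDeriv_zero
  | succ j ih =>
    intro hj
    rw [iteratedDeriv_succ, ih (by omega)]
    exact funext fun x => (hd j (by omega) x).deriv

theorem contDiff_chain {n : ℕ} {h : ℕ → ℝ → ℂ} (hd : ∀ j < n, ∀ x, HasDerivAt (h j) (h (j + 1) x) x) {m : ℕ}
    (hm : m < n) : ContDiff ℝ m (h 0) := by
  have : ContDiff ℝ ((m : ℕ∞) : WithTop ℕ∞) (h 0) := by
    refine contDiff_of_differentiable_iteratedDeriv fun j hj => ?_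
    have hj' : j ≤ m := by exact_mod_cast hj
    rw [iteratedDeriv_chain hd j (by omega)]
    exact fun x => (hd j (by omega) x).differentiableAt
  exact_mod_cast this

/-- The `j`-th derivative in `log κ` still decays to order `n - j`. As `j ≤ m` and `N ≤ n`, this is
at least the order `N - m` asked for, and strictness of `m < N` leaves every `j` in use below `n`.
-/
theorem exists_flow_radial_bound {n : ℕ} {g : ℕ → ℝ → ℝ → ℂ} {a b : ℝ → ℝ} (ha : ∀ x, 0 ≤ a x)
    (hd : ∀ j < n, ∀ t x, HasDerivAt (flow (g j) t) (flow (g (j + 1)) t x) x)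
    (hb : ∀ j < n, ∃ C : ℝ, 0 ≤ C ∧ ∀ x t, jap (b x * t) ^ (n - j) * ‖flow (g j) t x‖ ≤ C * a x)
    {N m : ℕ} (hN : N ≤ n) (hm : m < N) :
    (∀ t, ContDiffOn ℝ m (fun k : R3 => flow (g 0) t (Real.log ‖k‖)) {k : R3 | k ≠ 0}) ∧
    ∃ C : ℝ, 0 ≤ C ∧ ∀ k : R3, k ≠ 0 → ∀ t : ℝ,
      ‖k‖ ^ m * ‖iteratedFDeriv ℝ m (fun k : R3 => flow (g 0) t (Real.log ‖k‖)) k‖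
        ≤ C * (a (Real.log ‖k‖) * jap (b (Real.log ‖k‖) * t) ^ ((m : ℤ) - (N : ℤ))) := by
  have hcd : ∀ t, ContDiff ℝ m (flow (g 0) t) := fun t =>
    contDiff_chain (h := fun j => flow (g j) t) (fun j hj => hd j hj t) (lt_of_lt_of_le hm hN)
  refine ⟨fun t => contDiffOn_comp_log_norm (hcd t), ?_⟩
  obtain ⟨K, hK, hrad⟩ := exists_radial_bound m
  have hb' : ∀ j, ∃ C : ℝ, 0 ≤ C ∧ (j < n → ∀ x t, jap (b x * t) ^ (n - j) * ‖flow (g j) t x‖ ≤ C * a x) := by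
    intro j
    by_cases hj : j < n
    · obtain ⟨C, hC, h⟩ := hb j hj
      exact ⟨C, hC, fun _ => h⟩
    · exact ⟨0, le_rfl, fun h => absurd h hj⟩
  choose C hC hCb using hb'
  set S := ∑ j ∈ Finset.range (m + 1), C j with hS
  have hS0 : 0 ≤ S := Finset.sum_nonneg fun j _ => hC j
  refine ⟨K * S, mul_nonneg hK hS0, fun k hk t => ?_⟩
  set x := Real.log ‖k‖
  rw [mul_assoc]
  refine hrad (flow (g 0) t) (hcd t) k hk _ fun j hj => ?_
  have hjn : j < n := by omega
  have hch := iteratedDeriv_chain (h := fun j => flow (g j) t) (fun j hj => hd j hj t) j hjn.le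
  rw [hch]
  have hJ := jap_pos (b x * t)
  have hJ1 := one_le_jap (b x * t)
  have h1 : ‖flow (g j) t x‖ ≤ C j * a x * jap (b x * t) ^ ((j : ℤ) - (n : ℤ)) := by
    have h2 := hCb j hjn x t
    have h3 : jap (b x * t) ^ ((j : ℤ) - (n : ℤ)) = (jap (b x * t) ^ (n - j))⁻¹ := by
      rw [← zpow_natCast, ← zpow_neg, Nat.cast_sub hjn.le]
      congr 1
      ring
    rw [h3, ← div_eq_mul_inv, le_div_iff₀ (by positivity), mul_comm]
    exact h2
  have hCS : C j ≤ S := Finset.single_le_sum (fun i _ => hC i) (Finset.mem_range.2 (by omega))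
  have hpow : jap (b x * t) ^ ((j : ℤ) - (n : ℤ)) ≤ jap (b x * t) ^ ((m : ℤ) - (N : ℤ)) :=
    zpow_le_zpow_right₀ hJ1 (by omega)
  have hax := ha x
  calc _ ≤ C j * a x * jap (b x * t) ^ ((j : ℤ) - (n : ℤ)) := h1
    _ ≤ S * a x * jap (b x * t) ^ ((m : ℤ) - (N : ℤ)) := by gcongr
    _ = _ := by ring

/-! ### The regular part in terms of the flows -/

theorem integral_exp_mul_comp_div {h : ℝ → ℂ} (h0 : ∀ σ, σ ∉ Ioo (-1 : ℝ) 1 → h σ = 0) {κ : ℝ} (hκ : 0 < κ)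
    (t : ℝ) : ∫ τ : ℝ, Complex.exp (Complex.I * (τ : ℂ) * (t : ℂ)) * h (τ / κ)
      = (κ : ℂ) * oscInt h (κ * t) := by
  have h1 := Measure.integral_comp_div
    (fun σ : ℝ => Complex.exp (Complex.I * (σ : ℂ) * ((κ * t : ℝ) : ℂ)) * h σ) κ
  have hκ' : (κ : ℂ) ≠ 0 := by exact_mod_cast hκ.ne'
  have h2 : ∀ τ : ℝ, Complex.exp (Complex.I * ((τ / κ : ℝ) : ℂ) * ((κ * t : ℝ) : ℂ)) * h (τ / κ)
      = Complex.exp (Complex.I * (τ : ℂ) * (t : ℂ)) * h (τ / κ) := fun τ => by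
    congr 2
    push_cast
    field_simp
  simp_rw [h2] at h1
  rw [h1, abs_of_pos hκ, Complex.real_smul, oscInt, ← integral_indicator measurableSet_Ioo]
  congr 1
  refine integral_congr_ae (ae_of_all _ fun σ => ?_)
  by_cases hσ : σ ∈ Ioo (-1 : ℝ) 1
  · simp only [indicator_of_mem hσ]
  · simp only [indicator_of_notMem hσ, h0 σ hσ, mul_zero]

section

variable {F : ℂ → ℂ} {N₀ : ℕ}

theorem multiplier_eq_flow (F : ℂ → ℂ) (ε : ℝ) {k : R3} (hk : k ≠ 0) (t : ℝ) :
    multiplier (cutoff ε) (specMeasure F) k t = flow (lowDensity F ε) t (Real.log ‖k‖) := by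
  have hκ : 0 < ‖k‖ := norm_pos_iff.2 hk
  have h := integral_exp_mul_comp_div (h := lowDensity F ε (Real.log ‖k‖)) (fun σ hσ => by
    rw [lowDensity, regDensity_of_notMem F _ hσ, mul_zero]) hκ t
  rw [flow, Real.exp_log hκ, ← h, multiplier, synth]
  simp only [cutoff, specMeasure, if_neg hk, lowDensity, Real.exp_log hκ]

theorem IsAdmissible.synth_sub_multiplier_eq_flow (hF : IsAdmissible F N₀) (hN : 11 ≤ N₀) (ε : ℝ) {k : R3}
    (hk : k ≠ 0) (t : ℝ) : synth (specMeasure F) k t - multiplier (cutoff ε) (specMeasure F) k t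
      = flow (highDensity F ε) t (Real.log ‖k‖) := by
  have hκ : 0 < ‖k‖ := norm_pos_iff.2 hk
  have h := integral_exp_mul_comp_div (h := highDensity F ε (Real.log ‖k‖)) (fun σ hσ => by
    rw [highDensity, regDensity_of_notMem F _ hσ, mul_zero]) hκ t
  have hi := hF.integrable_specMeasure hN k
  have he : ∀ {f : ℝ → ℂ}, Integrable f → Integrable fun τ : ℝ =>
      Complex.exp (Complex.I * (τ : ℂ) * (t : ℂ)) * f τ := fun hf =>
    hf.bdd_mul (c := 1) (Continuous.aestronglyMeasurable (by fun_prop))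
      (ae_of_all _ fun τ => (norm_exp_I_mul τ t).le)
  have hχ : Integrable fun τ : ℝ => (cutoff ε k τ : ℂ) * specMeasure F k τ := by
    refine hi.bdd_mul (c := 1) (Continuous.aestronglyMeasurable ?_) (ae_of_all _ fun τ => ?_)
    · simp only [cutoff, if_neg hk]
      have := (contDiff_slowCut ε).continuous
      fun_prop
    · rw [Complex.norm_real, Real.norm_eq_abs]
      simp only [cutoff, if_neg hk]
      have h1 := Real.smoothTransition.nonneg (2 - 2 * (τ / ‖k‖) ^ 2 / ε ^ 2)
      have h2 := Real.smoothTransition.le_one (2 - 2 * (τ / ‖k‖) ^ 2 / ε ^ 2)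
      have h3 := Real.smoothTransition.nonneg (Real.log ε - Real.log ‖k‖)
      have h4 := Real.smoothTransition.le_one (Real.log ε - Real.log ‖k‖)
      rw [slowCut, lowCut, abs_of_nonneg (mul_nonneg h1 h3)]
      exact mul_le_one₀ h2 h3 h4
  rw [flow, Real.exp_log hκ, ← h, multiplier, synth, synth, ← integral_sub (he hi) (he hχ)]
  refine integral_congr_ae (ae_of_all _ fun τ => ?_)
  simp only [cutoff, specMeasure, if_neg hk, highDensity, Real.exp_log hκ]
  push_cast
  ring

theorem tame_of_continuous {v : ℝ → ℝ → ℝ} {B : ℝ → ℝ} (hB : Continuous B)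
    (h : ∀ x, ∀ σ ∈ Ioo (-1 : ℝ) 1, v x σ ≤ B x) : Tame 0 v := fun x₀ => by
  obtain ⟨C, hC⟩ := (isCompact_Icc (a := x₀ - 1) (b := x₀ + 1)).exists_bound_of_continuousOn hB.continuousOn
  refine ⟨max C 0, le_max_right _ _, fun x hx σ hσ => ?_⟩
  rw [pow_zero, mul_one]
  exact ((h x σ hσ).trans (le_abs_self _)).trans ((hC x (Ioo_subset_Icc_self hx)).trans (le_max_left _ _))

theorem continuous_highWeight : Continuous highWeight :=
  Continuous.inv₀ (by fun_prop) fun x => by positivity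

theorem highWeight_log {r : ℝ} (hr : 0 < r) : highWeight (Real.log r) = jap r ^ (-2 : ℤ) := by
  rw [highWeight, two_mul, Real.exp_add, Real.exp_log hr, zpow_neg]
  congr 1
  rw [show ((2 : ℤ)) = ((2 : ℕ) : ℤ) from rfl, zpow_natCast, jap_sq, sq]

theorem IsAdmissible.exists_high_bound (hF : IsAdmissible F N₀) (hN₀ : 11 ≤ N₀) {ε : ℝ} (hε : 0 < ε) {N m : ℕ}
    (hN : N ≤ (N₀ - 9) / 2) (hm : m < N) :
    (∀ t, ContDiffOn ℝ m (fun k : R3 => flow (highDensity F ε) t (Real.log ‖k‖)) {k : R3 | k ≠ 0}) ∧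
    ∃ C : ℝ, 0 ≤ C ∧ ∀ k : R3, k ≠ 0 → ∀ t : ℝ,
      ‖k‖ ^ m * ‖iteratedFDeriv ℝ m (fun k : R3 => flow (highDensity F ε) t (Real.log ‖k‖)) k‖
        ≤ C * (‖k‖ * jap ‖k‖ ^ (-2 : ℤ) * jap (‖k‖ * t) ^ ((m : ℤ) - (N : ℤ))) := by
  -- The regularity budget: `2(n + 4) ≤ N₀` is what the symbol bounds require, and `N₀ ≥ 11` makes
  -- the truncated subtraction harmless.
  set n := (N₀ - 9) / 2
  have hsym := hF.sym_highDensity hN₀ (n := n) (by omega) hε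
  obtain ⟨g, hg0, hgs, -, hgd⟩ := hsym.exists_chain n (fun x σ hσ => by
    have := lowWeight_pos x σ
    have := highWeight_pos x
    positivity) (tame_of_continuous continuous_highWeight fun x σ hσ =>
      mul_le_of_le_one_left (highWeight_pos x).le (pow_le_one₀ (lowWeight_pos x σ).le (lowWeight_le_one x hσ)))
  obtain ⟨h1, C, hC, h2⟩ := exists_flow_radial_bound (g := g) (a := fun x => Real.exp x * highWeight x)
    (b := Real.exp) (fun x => mul_nonneg (Real.exp_pos x).le (highWeight_pos x).le) hgd
    (fun j hj => (hgs j hj.le).exists_flow_high (Nat.sub_le n j)) hN hm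
  rw [hg0] at h1 h2
  refine ⟨h1, C, hC, fun k hk t => ?_⟩
  have hκ : 0 < ‖k‖ := norm_pos_iff.2 hk
  have := h2 k hk t
  simp only [Real.exp_log hκ, highWeight_log hκ] at this
  exact this

theorem IsAdmissible.exists_low_bound (hF : IsAdmissible F N₀) (hN₀ : 11 ≤ N₀) (ε : ℝ) {N m : ℕ}
    (hN : N ≤ (N₀ - 9) / 2) (hm : m < N) :
    (∀ t, ContDiffOn ℝ m (fun k : R3 => flow (lowDensity F ε) t (Real.log ‖k‖)) {k : R3 | k ≠ 0}) ∧
    ∃ C : ℝ, 0 ≤ C ∧ ∀ k : R3, k ≠ 0 → ∀ t : ℝ,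
      ‖k‖ ^ m * ‖iteratedFDeriv ℝ m (fun k : R3 => flow (lowDensity F ε) t (Real.log ‖k‖)) k‖
        ≤ C * (‖k‖ * jap (‖k‖ ^ 3 * t) ^ ((m : ℤ) - (N : ℤ))) := by
  set n := (N₀ - 9) / 2
  have hsym := hF.sym_lowDensity hN₀ (n := n) (by omega) ε
  obtain ⟨g, hg0, hgs, hgo, hgd⟩ := hsym.exists_chain n (fun x σ hσ => by
    have := lowWeight_pos x σ
    have := highWeight_pos x
    positivity) (tame_of_continuous (B := fun x => (Real.exp (2 * x) * highWeight x)⁻¹) (by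
      have := continuous_highWeight
      refine Continuous.inv₀ (by fun_prop) fun x => ?_
      exact (mul_pos (Real.exp_pos _) (highWeight_pos x)).ne') fun x σ hσ => by
        have h1 := lowWeight_ge x σ
        have h2 := mul_pos (Real.exp_pos (2 * x)) (highWeight_pos x)
        have h3 := highWeight_pos x
        have h4 := lowWeight_pos x σ
        calc _ ≤ (lowWeight x σ)⁻¹ * 1 := by
              gcongr
              exact pow_le_one₀ h3.le (highWeight_le_one x)
          _ ≤ _ := by rw [mul_one]; exact inv_anti₀ h2 h1)
  obtain ⟨h1, C, hC, h2⟩ := exists_flow_radial_bound (g := g) (a := Real.exp)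
    (b := fun x => Real.exp x ^ 3) (fun x => (Real.exp_pos x).le) hgd
    (fun j hj => by
      have hs := hgs j hj.le
      have ho := hgo (fun x σ _ => lowDensity_neg F ε x σ) j hj.le
      -- `j < n` guarantees the one derivative needed for the short-time bound.
      obtain ⟨l, hl⟩ : ∃ l, n - j = l + 1 := ⟨n - j - 1, by omega⟩
      rw [hl] at hs ⊢
      exact Sym.exists_flow_low (n := n) (by omega) ho hs) hN hm
  rw [hg0] at h1 h2
  refine ⟨h1, C, hC, fun k hk t => ?_⟩
  have hκ : 0 < ‖k‖ := norm_pos_iff.2 hk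
  have := h2 k hk t
  simp only [Real.exp_log hκ] at this
  exact this

theorem synth_zero (F : ℂ → ℂ) (t : ℝ) : synth (specMeasure F) 0 t = 0 := by simp [synth, specMeasure]

theorem multiplier_zero (F : ℂ → ℂ) (ε t : ℝ) : multiplier (cutoff ε) (specMeasure F) 0 t = 0 := by
  simp [multiplier, synth, specMeasure]

/-- At `k = 0` the weighted bounds are trivial: the regular part vanishes there, and for `m > 0` the
factor `‖0‖^m` kills the derivative whatever its value. -/
theorem pow_mul_norm_iteratedFDeriv_zero {f : R3 → ℂ} (hf : f 0 = 0) (m : ℕ) :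
    ‖(0 : R3)‖ ^ m * ‖iteratedFDeriv ℝ m f 0‖ = 0 := by
  rcases Nat.eq_zero_or_pos m with rfl | hm
  · rw [norm_iteratedFDeriv_zero, hf, norm_zero (E := ℂ), mul_zero]
  · rw [norm_zero, zero_pow hm.ne', zero_mul]

theorem IsAdmissible.regularPart_bound (hF : IsAdmissible F N₀) (hN₀ : 11 ≤ N₀) {ε : ℝ} (hε : 0 < ε) {N m : ℕ}
    (hN : N ≤ (N₀ - 9) / 2) (hm : m < N) :
    (∀ t : ℝ, ContDiffOn ℝ m (fun k => synth (specMeasure F) k t) {k : R3 | k ≠ 0} ∧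
      ContDiffOn ℝ m (fun k => multiplier (cutoff ε) (specMeasure F) k t) {k : R3 | k ≠ 0}) ∧
    ∃ C : ℝ, ∀ (k : R3) (t : ℝ),
      ‖k‖ ^ m * ‖iteratedFDeriv ℝ m
        (fun k => synth (specMeasure F) k t - multiplier (cutoff ε) (specMeasure F) k t) k‖
        ≤ C * (‖k‖ * jap ‖k‖ ^ (-2 : ℤ) * jap (‖k‖ * t) ^ ((m : ℤ) - (N : ℤ))) ∧
      ‖k‖ ^ m * ‖iteratedFDeriv ℝ m (fun k => multiplier (cutoff ε) (specMeasure F) k t) k‖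
        ≤ C * (‖k‖ * jap (‖k‖ ^ 3 * t) ^ ((m : ℤ) - (N : ℤ))) := by
  obtain ⟨hhc, C₁, hC₁, hh⟩ := hF.exists_high_bound hN₀ hε hN hm
  obtain ⟨hlc, C₂, hC₂, hl⟩ := hF.exists_low_bound hN₀ ε hN hm
  have heqh : ∀ t, EqOn (fun k => synth (specMeasure F) k t - multiplier (cutoff ε) (specMeasure F) k t)
      (fun k : R3 => flow (highDensity F ε) t (Real.log ‖k‖)) {k : R3 | k ≠ 0} := fun t k hk =>
    hF.synth_sub_multiplier_eq_flow hN₀ ε hk t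
  have heql : ∀ t, EqOn (fun k => multiplier (cutoff ε) (specMeasure F) k t)
      (fun k : R3 => flow (lowDensity F ε) t (Real.log ‖k‖)) {k : R3 | k ≠ 0} := fun t k hk =>
    multiplier_eq_flow F ε hk t
  have hev : ∀ {f g : R3 → ℂ} {k : R3}, EqOn f g {k : R3 | k ≠ 0} → k ≠ 0 →
      iteratedFDeriv ℝ m f k = iteratedFDeriv ℝ m g k := fun h hk =>
    (h.eventuallyEq_of_mem (isOpen_ne_zero.mem_nhds hk)).iteratedFDeriv ℝ m |>.eq_of_nhds
  refine ⟨fun t => ?_, C₁ + C₂, fun k t => ?_⟩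
  · have hm2 := (hlc t).congr (heql t)
    refine ⟨(((hhc t).congr (heqh t)).add hm2).congr fun k _ => ?_, hm2⟩
    simp
  · rcases eq_or_ne k 0 with rfl | hk
    · rw [pow_mul_norm_iteratedFDeriv_zero (by rw [synth_zero, multiplier_zero, sub_zero]),
        pow_mul_norm_iteratedFDeriv_zero (multiplier_zero F ε t)]
      simp
    · rw [hev (heqh t) hk, hev (heql t) hk]
      have hκ := norm_nonneg k
      have hj1 := (jap_pos ‖k‖).le
      have hj2 := (jap_pos (‖k‖ * t)).le
      have hj3 := (jap_pos (‖k‖ ^ 3 * t)).le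
      constructor
      · refine (hh k hk t).trans ?_
        gcongr
        linarith
      · refine (hl k hk t).trans ?_
        gcongr
        linarith

end

end VlasovMaxwell

end

/-! ### Assembly of the proposition -/

open VlasovMaxwell in
theorem proposition3p2 (F : ℂ → ℂ) (N₀ : ℕ) (hN₀ : 11 ≤ N₀) (hF : IsAdmissible F N₀) :
    -- the oscillatory integral defining the Green function converges
    (∀ γ : ℝ, 0 < γ → ∀ (k : R3) (t : ℝ), 0 ≤ t → Integrable (greenIntegrand F γ k t)) ∧
    ∃ (ν : ℝ → ℝ) (bp bm : R3 → ℂ) (ρ : R3 → ℝ → ℂ),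
      -- `± i ν(|k|)` are exactly the imaginary zeros of the magnetic dispersion function
      (∀ k : R3, ‖k‖ < ν ‖k‖ ∧ {τ : ℝ | IsMagneticZero F k τ} = {ν ‖k‖, -ν ‖k‖}) ∧
      -- the amplitudes
      ContDiff ℝ ∞ bp ∧ ContDiff ℝ ∞ bm ∧
      (∃ C : ℝ, ∀ k : R3, ‖bp k‖ ≤ C * (jap ‖k‖)⁻¹ ∧ ‖bm k‖ ≤ C * (jap ‖k‖)⁻¹) ∧
      -- the decomposition, with regular part `synth ρ`
      (∀ k : R3, Integrable (ρ k)) ∧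
      (∀ γ : ℝ, 0 < γ → ∀ (k : R3) (t : ℝ), 0 ≤ t →
        magGreen F γ k t =
          Complex.exp (Complex.I * (ν ‖k‖ : ℂ) * (t : ℂ)) * bp k
            + Complex.exp (-(Complex.I * (ν ‖k‖ : ℂ) * (t : ℂ))) * bm k
            + synth ρ k t) ∧
      -- the bounds on the regular part, split by a low-frequency multiplier
      (∀ ε : ℝ, 0 < ε → ∃ χ : R3 → ℝ → ℝ, IsLowFrequencyCutoff ε χ ∧
        ∀ N : ℕ, N ≤ (N₀ - 9) / 2 → ∀ m : ℕ, m < N →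
          (∀ t : ℝ, 0 ≤ t →
            ContDiffOn ℝ m (fun k => synth ρ k t) {k : R3 | k ≠ 0} ∧
            ContDiffOn ℝ m (fun k => multiplier χ ρ k t) {k : R3 | k ≠ 0}) ∧
          ∃ C : ℝ, ∀ (k : R3) (t : ℝ), 0 ≤ t →
            ‖k‖ ^ m * ‖iteratedFDeriv ℝ m (fun k => synth ρ k t - multiplier χ ρ k t) k‖
              ≤ C * (‖k‖ * jap ‖k‖ ^ (-2 : ℤ) * jap (‖k‖ * t) ^ ((m : ℤ) - (N : ℤ))) ∧
            ‖k‖ ^ m * ‖iteratedFDeriv ℝ m (fun k => multiplier χ ρ k t) k‖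
              ≤ C * (‖k‖ * jap (‖k‖ ^ 3 * t) ^ ((m : ℤ) - (N : ℤ)))) := by
  have hnorm : ∀ c : ℂ, ‖c‖ = 1 → ∀ a : ℝ, ‖c * (a : ℂ)‖ = |a| := fun c hc a => by
    rw [norm_mul, hc, one_mul, Complex.norm_real, Real.norm_eq_abs]
  have hamp : ContDiff ℝ ∞ fun k : R3 => ((amplitude F (specRatio F (‖k‖ ^ 2)) : ℝ) : ℂ) :=
    Complex.ofRealCLM.contDiff.comp (hF.contDiff_comp_specRatio hN₀ fun s hs => hF.contDiffAt_amplitude hN₀ hs)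
  obtain ⟨C, hC⟩ := hF.exists_amplitude_le hN₀
  refine ⟨fun γ hγ k t _ => hF.integrable_greenIntegrand hN₀ hγ k t, freq F,
    fun k => -Complex.I * (amplitude F (specRatio F (‖k‖ ^ 2)) : ℂ),
    fun k => Complex.I * (amplitude F (specRatio F (‖k‖ ^ 2)) : ℂ), specMeasure F,
    fun k => ⟨hF.lt_freq hN₀ ‖k‖, ?_⟩, contDiff_const.mul hamp, contDiff_const.mul hamp,
    ⟨C, fun k => ⟨?_, ?_⟩⟩, hF.integrable_specMeasure hN₀, fun γ hγ k t ht => hF.magGreen_eq hN₀ hγ k ht,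
    fun ε hε => ⟨cutoff ε, isLowFrequencyCutoff_cutoff hε, fun N hN m hm => ?_⟩⟩
  · ext τ
    exact hF.isMagneticZero_iff hN₀ k τ
  · rw [hnorm _ (by simp)]
    exact hC ‖k‖
  · rw [hnorm _ (by simp)]
    exact hC ‖k‖
  · obtain ⟨h1, D, h2⟩ := hF.regularPart_bound hN₀ hε hN hm
    exact ⟨fun t _ => h1 t, D, fun k t _ => h2 k t⟩
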